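/- Consider deterministic machines with a finite control unit, two one-directional read-only binary input tapes with end markers (for a program $p$ and a condition $x$), a one-directional write-only binary output tape, and two binary stacks, initially empty. The memory used at a given moment is the sum of the two stack lengths. For a machine $M$, let $C_M^s(y\,|\,x)$ be the minimal length of a binary string $p$ such that $M$ on inputs $p,x$ halts with output $y$ and never uses more than $s$ units of memory during the computation ($C_M^s(y\,|\,x)=\infty$ if there is no such $p$). A machine $V$ is called optimal if for every machine $P$ there is a constant $c$ such that $C_V^{s+c}(y\,|\,x)\le C_P^s(y\,|\,x)+c$ for all natural numbers $s$ and binary strings $x,y$. Fix an optimal machine $V$ and write $C^s(y\,|\,x)=C_V^s(y\,|\,x)$, $C^s(x)=C^s(x\,|\,\varepsilon)$, where $\varepsilon$ is the empty string, and $C^s(x,y)=C^s(\overline{x}01y)$, where $\overline{x}$ is $x$ with every bit doubled. **Theorem.** There exists a constant $c$ (depending only on $V$) such that for all binary strings $x,y$ and all natural numbers $s\ge 0$ $$C^{s'}(x)+C^{s'}(y\,|\,x)\le C^s(x,y)+c\,\lfloor\log_2 (C^s(x,y)+2)\rfloor,\qquad\text{where } s'=s+c\,\lfloor\log_2 (s+2)\rfloor+c\,(|x|+|y|)$$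 (the right-hand side is $\infty$ if $C^s(x,y)=\infty$). -/

import Mathlib

/-- Elementary actions on one binary stack. -/
inductive StackOp where
  | keep
  | pop
  | push (b : Bool)

/-- Effect of a stack action; the head of the list is the top of the stack. Popping an empty
stack leaves it empty. -/
def StackOp.apply : StackOp → List Bool → List Bool
  | keep, l => l
  | pop, l => l.tail
  | push b, l => b :: l

/-- What the control unit does in one step: the next state, whether the head on each of the two
input tapes moves one cell forward, the bit (if any) that is written on the output tape, and the
actions on the two stacks. -/
structure StepAction (Q : Type) where
  next : Q
  advProg : Bool
  advCond : Bool
  out : Option Bool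
  opLeft : StackOp
  opRight : StackOp

/-- A deterministic machine with a finite control unit, two one-directional read-only binary input
tapes with end markers (for the program and for the condition), a one-directional write-only
binary output tape, and two binary stacks. -/
structure StackMachine where
  Q : Type
  finite : Finite Q
  start : Q
  /-- `δ q a b u v` is the action in state `q` when the heads on the program and condition tapes
  see `a` and `b` (`none` is the end marker) and the tops of the stacks are `u` and `v` (`none`
  for an empty stack). The value `none` means that the machine halts. -/
  δ : Q → Option Bool → Option Bool → Option Bool → Option Bool → Option (StepAction Q)

namespace StackMachine

/-- A configuration: the state, the unread parts of the input tapes (starting at the head), the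
two stacks and the output written so far. -/
structure Cfg (M : StackMachine) where
  state : M.Q
  prog : List Bool
  cond : List Bool
  left : List Bool
  right : List Bool
  out : List Bool

/-- The amount of memory used in a configuration: the sum of the lengths of the stacks. -/
def Cfg.space {M : StackMachine} (c : M.Cfg) : ℕ := c.left.length + c.right.length

/-- The initial configuration on program `p` and condition `x`. -/
def init (M : StackMachine) (p x : List Bool) : M.Cfg := ⟨M.start, p, x, [], [], []⟩

/-- One step of the computation (`none` if the machine has halted). -/
def step (M : StackMachine) (c : M.Cfg) : Option M.Cfg :=
  (M.δ c.state c.prog.head? c.cond.head? c.left.head? c.right.head?).map fun a =>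
    { state := a.next
      prog := if a.advProg then c.prog.tail else c.prog
      cond := if a.advCond then c.cond.tail else c.cond
      left := a.opLeft.apply c.left
      right := a.opRight.apply c.right
      out := c.out ++ a.out.toList }

/-- One step that leads to a configuration with space at most `s`. -/
def StepWithin (M : StackMachine) (s : ℕ) (c d : M.Cfg) : Prop :=
  M.step c = some d ∧ d.space ≤ s

/-- `M.Produces s p x y`: on program `p` and condition `x` the machine halts with output `y`, and
the amount of used memory never exceeds `s` during the computation (the initial configuration has
empty stacks). -/
def Produces (M : StackMachine) (s : ℕ) (p x y : List Bool) : Prop :=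
  ∃ c : M.Cfg, Relation.ReflTransGen (M.StepWithin s) (M.init p x) c ∧
    M.step c = none ∧ c.out = y

/-- Space-bounded conditional complexity of `y` given `x` with respect to `M`: the minimal length
of a program that transforms `x` to `y` in space `s`, and `⊤` if there is no such program. -/
noncomputable def condKS (M : StackMachine) (s : ℕ) (y x : List Bool) : ℕ∞ :=
  ⨅ (p : List Bool) (_ : M.Produces s p x y), (p.length : ℕ∞)

/-- Unconditional space-bounded complexity: the condition is the empty string. -/
noncomputable def KS (M : StackMachine) (s : ℕ) (x : List Bool) : ℕ∞ := M.condKS s x []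

/-- The encoding of a pair of strings: all bits of `x` doubled, then `01`, then `y`. -/
def pairCode (x y : List Bool) : List Bool :=
  x.flatMap (fun b => [b, b]) ++ [false, true] ++ y

/-- Space-bounded complexity of a pair of strings. -/
noncomputable def pairKS (M : StackMachine) (s : ℕ) (x y : List Bool) : ℕ∞ :=
  M.KS s (pairCode x y)

/-- `V` is optimal: for every machine `P`, its complexity function is at most that of `P`, up to an
additive constant both in the complexity and in the space bound. -/
def IsOptimal (V : StackMachine) : Prop :=
  ∀ P : StackMachine, ∃ c : ℕ, ∀ (s : ℕ) (x y : List Bool),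
    V.condKS (s + c) y x ≤ P.condKS s y x + c

end StackMachine

/-- `⌊log₂ (n + 2)⌋`. The shift makes it positive at every `n`, so that constant terms are absorbed
in `O(log)`. -/
def log2 (n : ℕ) : ℕ := Nat.log 2 (n + 2)

/-- The same function on extended natural numbers, with value `⊤` at `⊤`. -/
def elog2 (n : ℕ∞) : ℕ∞ := n.map log2

/-! The inequality is the Kolmogorov–Levin counting argument, carried out in bounded space. Let q be
a program of length n for the pair, let N be the number of programs of length n whose output in the
given space is the code of a pair with first component x, and put m = ⌊log₂ N⌋. A program has only
one output, so at most 2^(n-m) strings have 2^m such programs or more (`Micro.count_discovered`); x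
is therefore described by n, m and a rank of n-m bits (`exists_first`). Given x, the program q is
one of at most 2^(m+1) candidates, and its rank, m+1 bits, leads to y (`exists_second`). The lengths
add up to n + O(log n). If n is at least |x| + |y|, printing x and y literally is short enough.
Otherwise there is room to store programs, candidates and counters.

Two points need care. The first is that the descriptions cannot afford to contain s. Both searches
therefore let the space bound grow and list an object at the least bound at which it qualifies, so
that ranks make sense without knowledge of s. The bounds are of the form 3g. In the search for x,
the pairs of g and a candidate of length L are enumerated by increasing g + L, so nothing that
precedes the target needs much more memory than the target does.

The second point is that the searches must decide whether a simulated computation halts in f cells,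
while the coefficient of s in the final bound is 1. Counting steps up to the number of
configurations would take about f further bits. Instead, the configuration graph is traversed in the
manner of Sipser: the walk makes a transition, undoes the transitions that enter the same
configuration one label after the other, and goes on. The walk is injective, so it either arrives at
the final configuration reached by its start or returns to its start
(`LabeledSystem.walk_dichotomy`). It remembers only a configuration and a mark from a finite set.
Undoing requires that a transition be recoverable from a label in a finite set; for this purpose
`sim` splits the steps of V into single pushes, pops and reads.

The rest is programming. Structured programs with registers are compiled to machines
(`Op.exec_compile`, `RProg.produces_toMachine`) in such a way that the two simulated stacks are
stored cell for cell, whereas all other data cost three cells per bit. The predicate `Wp`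
establishes termination, space and result together. -/

/-! ### Structured programs -/

/-- Structured programs over primitive actions `ι` and tests `τ`. -/
inductive Prog (ι τ : Type) where
  | prim (i : ι)
  | seq (a b : Prog ι τ)
  | ite (t : τ) (a b : Prog ι τ)
  | loop (t : τ) (a : Prog ι τ)

namespace Prog

variable {ι τ S : Type}

/-- Big-step execution of a structured program, in which every state produced by a primitive
action has to satisfy `ok`. -/
inductive Exec (sem : ι → S → S) (tst : τ → S → Bool) (ok : S → Prop) : Prog ι τ → S → S → Prop
  | prim {i : ι} {x : S} : ok (sem i x) → Exec sem tst ok (.prim i) x (sem i x)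
  | seq {a b : Prog ι τ} {x y z : S} : Exec sem tst ok a x y → Exec sem tst ok b y z →
      Exec sem tst ok (.seq a b) x z
  | iteTrue {t : τ} {a b : Prog ι τ} {x y : S} : tst t x = true → Exec sem tst ok a x y →
      Exec sem tst ok (.ite t a b) x y
  | iteFalse {t : τ} {a b : Prog ι τ} {x y : S} : tst t x = false → Exec sem tst ok b x y →
      Exec sem tst ok (.ite t a b) x y
  | loopDone {t : τ} {a : Prog ι τ} {x : S} : tst t x = false → Exec sem tst ok (.loop t a) x x
  | loopStep {t : τ} {a : Prog ι τ} {x y z : S} : tst t x = true → Exec sem tst ok a x y →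
      Exec sem tst ok (.loop t a) y z → Exec sem tst ok (.loop t a) x z

variable {sem : ι → S → S} {tst : τ → S → Bool} {ok : S → Prop}

theorem Exec.prim_eq {i : ι} {x y : S} (h : sem i x = y) (hy : ok y) :
    Exec sem tst ok (.prim i) x y := by
  subst h; exact .prim hy

theorem Exec.ok_of {a : Prog ι τ} {x y : S} (h : Exec sem tst ok a x y) (hx : ok x) : ok y := by
  induction h with
  | prim h => exact h
  | seq _ _ ih1 ih2 => exact ih2 (ih1 hx)
  | iteTrue _ _ ih => exact ih hx
  | iteFalse _ _ ih => exact ih hx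
  | loopDone _ => exact hx
  | loopStep _ _ _ ih1 ih2 => exact ih2 (ih1 hx)

/-- Translation of programs, given translations of the primitive actions and of the tests. -/
def translate {ι' τ' : Type} (f : ι → Prog ι' τ') (g : τ → τ') : Prog ι τ → Prog ι' τ'
  | .prim i => f i
  | .seq a b => .seq (translate f g a) (translate f g b)
  | .ite t a b => .ite (g t) (translate f g a) (translate f g b)
  | .loop t a => .loop (g t) (translate f g a)

/-- Induction on the execution. The translation of a primitive action may use `ok` of the data
before it, so this property is carried through sequences and loops by `Exec.ok_of`. -/
theorem Exec.translate {ι' τ' S' : Type} {sem' : ι' → S' → S'} {tst' : τ' → S' → Bool}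
    {ok' : S' → Prop} {f : ι → Prog ι' τ'} {g : τ → τ'} {e : S → S'}
    (hf : ∀ i x, ok x → ok (sem i x) → Exec sem' tst' ok' (f i) (e x) (e (sem i x)))
    (hg : ∀ t x, tst' (g t) (e x) = tst t x)
    {a : Prog ι τ} {x y : S} (h : Exec sem tst ok a x y) (hx : ok x) :
    Exec sem' tst' ok' (a.translate f g) (e x) (e y) := by
  induction h with
  | prim h => exact hf _ _ hx h
  | seq h1 _ ih1 ih2 => exact .seq (ih1 hx) (ih2 (h1.ok_of hx))
  | iteTrue ht _ ih => exact .iteTrue (by rw [hg, ht]) (ih hx)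
  | iteFalse ht _ ih => exact .iteFalse (by rw [hg, ht]) (ih hx)
  | loopDone ht => exact .loopDone (by rw [hg, ht])
  | loopStep ht h1 _ ih1 ih2 => exact .loopStep (by rw [hg, ht]) (ih1 hx) (ih2 (h1.ok_of hx))

end Prog

/-! ### Programs acting directly on the tapes and stacks of a machine -/

namespace StackMachine

/-- The symbols seen by the four heads. -/
structure View where
  prog : Option Bool
  cond : Option Bool
  left : Option Bool
  right : Option Bool

/-- The part of an action that does not concern the control state. -/
structure Move where
  advProg : Bool := false
  advCond : Bool := false
  out : Option Bool := none
  opLeft : StackOp := .keep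
  opRight : StackOp := .keep

/-- Data of a machine with control memory `K`. -/
structure Raw (K : Type) where
  k : K
  prog : List Bool
  cond : List Bool
  left : List Bool
  right : List Bool
  out : List Bool

namespace Raw

variable {K : Type}

def view (d : Raw K) : View := ⟨d.prog.head?, d.cond.head?, d.left.head?, d.right.head?⟩

def space (d : Raw K) : ℕ := d.left.length + d.right.length

def act (d : Raw K) (k : K) (m : Move) : Raw K where
  k := k
  prog := if m.advProg then d.prog.tail else d.prog
  cond := if m.advCond then d.cond.tail else d.cond
  left := m.opLeft.apply d.left
  right := m.opRight.apply d.right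
  out := d.out ++ m.out.toList

def sem (f : K → View → K × Move) (d : Raw K) : Raw K := d.act (f d.k d.view).1 (f d.k d.view).2

def tst (t : K → View → Bool) (d : Raw K) : Bool := t d.k d.view

end Raw

/-- Programs whose primitive actions are single steps of a machine with control memory `K`. -/
abbrev RawProg (K : Type) := Prog (K → View → K × Move) (K → View → Bool)

/-- Execution of a program without ever using more than `s` units of memory. -/
abbrev RawExec {K : Type} (s : ℕ) : RawProg K → Raw K → Raw K → Prop :=
  Prog.Exec Raw.sem Raw.tst (fun d => d.space ≤ s)

namespace RawProg

variable {K : Type}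

/-- Control points of a program. -/
def Node : RawProg K → Type
  | .prim _ => Unit
  | .seq a b => Node a ⊕ Node b
  | .ite _ a b => Option (Node a ⊕ Node b)
  | .loop _ a => Option (Node a)

theorem finite_node : (p : RawProg K) → Finite (Node p)
  | .prim _ => inferInstanceAs (Finite Unit)
  | .seq a b =>
    have := finite_node a
    have := finite_node b
    inferInstanceAs (Finite (Node a ⊕ Node b))
  | .ite _ a b =>
    have := finite_node a
    have := finite_node b
    inferInstanceAs (Finite (Option (Node a ⊕ Node b)))
  | .loop _ a =>
    have := finite_node a
    inferInstanceAs (Finite (Option (Node a)))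

def entry : (p : RawProg K) → Node p
  | .prim _ => ()
  | .seq a _ => Sum.inl (entry a)
  | .ite _ _ _ => none
  | .loop _ _ => none

/-- The step at a control point; `none` is the exit. -/
def trans : (p : RawProg K) → Node p → K → View → Option (Node p) × K × Move
  | .prim f, _, k, v => (none, f k v)
  | .seq a b, .inl n, k, v =>
    let r := trans a n k v
    (some (r.1.elim (.inr (entry b)) .inl), r.2)
  | .seq _ b, .inr n, k, v =>
    let r := trans b n k v
    (r.1.map .inr, r.2)
  | .ite t a b, none, k, v =>
    (some (some (if t k v then .inl (entry a) else .inr (entry b))), k, {})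
  | .ite _ a _, some (.inl n), k, v =>
    let r := trans a n k v
    (r.1.map fun m => some (.inl m), r.2)
  | .ite _ _ b, some (.inr n), k, v =>
    let r := trans b n k v
    (r.1.map fun m => some (.inr m), r.2)
  | .loop t a, none, k, v => (if t k v then some (some (entry a)) else none, k, {})
  | .loop _ a, some n, k, v =>
    let r := trans a n k v
    (some (r.1.elim none some), r.2)

/-- One step of a program that leads to data of size at most `s`. -/
def NodeStep (p : RawProg K) (s : ℕ) (c d : Option (Node p) × Raw K) : Prop :=
  ∃ n x, c = (some n, x) ∧
    d = ((p.trans n x.k x.view).1, x.act (p.trans n x.k x.view).2.1 (p.trans n x.k x.view).2.2) ∧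
    d.2.space ≤ s

theorem act_idle (x : Raw K) : x.act x.k {} = x := by
  simp [Raw.act, StackOp.apply]

/-- The map `φ` embeds the control points of a subprogram and says where its exit leads: to the
entry of the second half of a sequence, or back to the test of a loop. Runs of the subprogram thus
become runs of the whole program. -/
theorem NodeStep.lift {p q : RawProg K} {s : ℕ} (φ : Option (Node p) → Option (Node q))
    (hφ : ∀ n, ∃ m, φ (some n) = some m ∧
      ∀ k v, q.trans m k v = (φ (p.trans n k v).1, (p.trans n k v).2))
    {c d : Option (Node p) × Raw K} (h : Relation.ReflTransGen (p.NodeStep s) c d) :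
    Relation.ReflTransGen (q.NodeStep s) (φ c.1, c.2) (φ d.1, d.2) := by
  refine Relation.ReflTransGen.lift (fun c : Option (Node p) × Raw K => (φ c.1, c.2)) ?_ _ _ h
  rintro c d ⟨n, x, rfl, rfl, hs⟩
  obtain ⟨m, hm, ht⟩ := hφ n
  exact ⟨m, x, by simp [hm], by simp [ht], hs⟩

/-- A test costs the machine an idle step that repeats the present data. This is why the initial
data must obey the space bound, although `RawExec` restricts only the results of primitive actions.
-/
theorem reaches_of_exec {s : ℕ} {p : RawProg K} {x y : Raw K} (h : RawExec s p x y)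
    (hx : x.space ≤ s) :
    Relation.ReflTransGen (p.NodeStep s) (some p.entry, x) (none, y) := by
  induction h with
  | @prim f x h => exact .single ⟨(), x, rfl, rfl, h⟩
  | @seq a b x y z h1 h2 ih1 ih2 =>
    refine .trans (NodeStep.lift (q := .seq a b)
      (fun o => some (o.elim (.inr (entry b)) .inl)) ?_ (ih1 hx))
      (NodeStep.lift (q := .seq a b) (fun o => o.map .inr) ?_ (ih2 (h1.ok_of hx)))
    · exact fun n => ⟨.inl n, rfl, fun k v => rfl⟩
    · exact fun n => ⟨.inr n, rfl, fun k v => rfl⟩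
  | @iteTrue t a b x y ht h ih =>
    have ht' : t x.k x.view = true := ht
    refine .head ⟨none, x, rfl, ?_, hx⟩ (NodeStep.lift (q := .ite t a b)
      (fun o => o.map fun m => some (.inl m)) ?_ (ih hx))
    · simp [trans, ht', act_idle]; rfl
    · exact fun n => ⟨some (.inl n), rfl, fun k v => rfl⟩
  | @iteFalse t a b x y ht h ih =>
    have ht' : t x.k x.view = false := ht
    refine .head ⟨none, x, rfl, ?_, hx⟩ (NodeStep.lift (q := .ite t a b)
      (fun o => o.map fun m => some (.inr m)) ?_ (ih hx))
    · simp [trans, ht', act_idle]; rfl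
    · exact fun n => ⟨some (.inr n), rfl, fun k v => rfl⟩
  | @loopDone t a x ht =>
    have ht' : t x.k x.view = false := ht
    exact .single ⟨none, x, rfl, by simp [trans, ht', act_idle], hx⟩
  | @loopStep t a x y z ht h1 h2 ih1 ih2 =>
    have ht' : t x.k x.view = true := ht
    refine .head (b := (some (some (entry a)), x)) ⟨none, x, rfl, ?_, hx⟩
      (.trans (NodeStep.lift (q := .loop t a) (fun o => some (o.elim none some)) ?_ (ih1 hx))
        (ih2 (h1.ok_of hx)))
    · simp [trans, ht', act_idle]; rfl
    · exact fun n => ⟨some n, rfl, fun k v => rfl⟩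

/-- The machine that executes a program, starting with control memory `k`. -/
def toMachine [Finite K] (p : RawProg K) (k : K) : StackMachine where
  Q := Option (Node p) × K
  finite := by
    have := finite_node p
    infer_instance
  start := (some p.entry, k)
  δ q a b u v := q.1.map fun n =>
    let r := p.trans n q.2 ⟨a, b, u, v⟩
    { next := (r.1, r.2.1), advProg := r.2.2.advProg, advCond := r.2.2.advCond, out := r.2.2.out
      opLeft := r.2.2.opLeft, opRight := r.2.2.opRight }

def toCfg [Finite K] (p : RawProg K) (k : K) (c : Option (Node p) × Raw K) : (p.toMachine k).Cfg :=
  ⟨(c.1, c.2.k), c.2.prog, c.2.cond, c.2.left, c.2.right, c.2.out⟩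

theorem produces_toMachine [Finite K] {p : RawProg K} {k : K} {s : ℕ} {q x : List Bool}
    {y : Raw K} (h : RawExec s p ⟨k, q, x, [], [], []⟩ y) :
    (p.toMachine k).Produces s q x y.out := by
  refine ⟨p.toCfg k (none, y), ?_, rfl, rfl⟩
  refine Relation.ReflTransGen.lift (p.toCfg k) ?_ _ _ (reaches_of_exec h (by simp [Raw.space]))
  rintro c d ⟨n, x, rfl, rfl, hs⟩
  exact ⟨rfl, hs⟩

end RawProg

theorem condKS_le_of_produces {M : StackMachine} {s : ℕ} {p x y : List Bool}
    (h : M.Produces s p x y) : M.condKS s y x ≤ p.length :=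
  iInf₂_le p h

end StackMachine

/-! ### Registers -/

namespace StackMachine

namespace RawProg

variable {K : Type}

/-- Code of a bit stored in a register. -/
def sym (b : Bool) : List Bool := [false, b, false]

/-- The delimiter of registers. -/
def mark : List Bool := [true, true, true]

/-- A stored bit begins and ends with `false`, and a delimiter consists of `true`. Hence one cell,
seen from either side, tells whether the head stands at a delimiter. -/
def encReg (l : List Bool) : List Bool := l.flatMap sym

/-- A register with the delimiter that follows it. -/
def block (l : List Bool) : List Bool := encReg l ++ mark

@[simp] theorem encReg_nil : encReg [] = [] := rfl

@[simp] theorem encReg_cons (b : Bool) (l : List Bool) :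
    encReg (b :: l) = false :: b :: false :: encReg l := rfl

@[simp] theorem encReg_append (l m : List Bool) : encReg (l ++ m) = encReg l ++ encReg m := by
  simp [encReg]

@[simp] theorem length_encReg (l : List Bool) : (encReg l).length = 3 * l.length := by
  induction l with
  | nil => rfl
  | cons b l ih => simp [ih]; ring

@[simp] theorem length_mark : mark.length = 3 := rfl

/-! ### Moving over the registers -/

def bitOp : Option Bool → StackOp
  | some b => .push b
  | none => .keep

def nop : RawProg K := .prim fun k _ => (k, {})

/-- The two stacks act as the two sides of one tape. Moving a cell across preserves the sum of their
lengths, so access to a distant register costs no memory. -/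
def shiftR : RawProg K := .prim fun k v => (k, { opLeft := bitOp v.right, opRight := .pop })

def shiftL : RawProg K := .prim fun k v => (k, { opRight := bitOp v.left, opLeft := .pop })

def shiftSymR : RawProg K := .seq shiftR (.seq shiftR shiftR)

def shiftSymL : RawProg K := .seq shiftL (.seq shiftL shiftL)

/-- Move right to the next delimiter. -/
def toMarkR : RawProg K := .loop (fun _ v => v.right == some false) shiftSymR

/-- Move left to the next delimiter. -/
def toMarkL : RawProg K := .loop (fun _ v => v.left == some false) shiftSymL

def skip : RawProg K := .seq toMarkR shiftSymR

def unskip : RawProg K := .seq shiftSymL toMarkL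

def skips : ℕ → RawProg K
  | 0 => nop
  | n + 1 => .seq skip (skips n)

def unskips : ℕ → RawProg K
  | 0 => nop
  | n + 1 => .seq (unskips n) unskip

/-- Run a program at the beginning of the `n`-th register and return. -/
def atReg (n : ℕ) (op : RawProg K) : RawProg K :=
  .seq shiftSymR (.seq (skips n) (.seq op (.seq (unskips n) shiftSymL)))

/-- What is to the left of the head after it has passed the registers `pre`. -/
def back : List (List Bool) → List Bool → List Bool
  | [], L => mark ++ L
  | l :: pre, L => back pre (encReg l.reverse ++ (mark ++ L))

section

variable {s : ℕ} {k k' : K} {p c o L R : List Bool}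

theorem exec_nop (h : L.length + R.length ≤ s) :
    RawExec s nop ⟨k, p, c, L, R, o⟩ ⟨k, p, c, L, R, o⟩ := by
  refine .prim_eq ?_ h
  simp [Raw.sem, Raw.act, StackOp.apply]

theorem exec_shiftR {b : Bool} (h : L.length + R.length + 1 ≤ s) :
    RawExec s shiftR ⟨k, p, c, L, b :: R, o⟩ ⟨k, p, c, b :: L, R, o⟩ := by
  refine .prim_eq ?_ (by simp [Raw.space]; omega)
  simp [Raw.sem, Raw.act, StackOp.apply, Raw.view, bitOp]

theorem exec_shiftL {b : Bool} (h : L.length + R.length + 1 ≤ s) :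
    RawExec s shiftL ⟨k, p, c, b :: L, R, o⟩ ⟨k, p, c, L, b :: R, o⟩ := by
  refine .prim_eq ?_ (by simp [Raw.space]; omega)
  simp [Raw.sem, Raw.act, StackOp.apply, Raw.view, bitOp]

theorem exec_shiftSymR {b₁ b₂ b₃ : Bool} (h : L.length + R.length + 3 ≤ s) :
    RawExec s shiftSymR ⟨k, p, c, L, b₁ :: b₂ :: b₃ :: R, o⟩
      ⟨k, p, c, b₃ :: b₂ :: b₁ :: L, R, o⟩ :=
  .seq (exec_shiftR (by simp; omega)) (.seq (exec_shiftR (by simp; omega))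
    (exec_shiftR (by simp; omega)))

theorem exec_shiftSymL {b₁ b₂ b₃ : Bool} (h : L.length + R.length + 3 ≤ s) :
    RawExec s shiftSymL ⟨k, p, c, b₁ :: b₂ :: b₃ :: L, R, o⟩
      ⟨k, p, c, L, b₃ :: b₂ :: b₁ :: R, o⟩ :=
  .seq (exec_shiftL (by simp; omega)) (.seq (exec_shiftL (by simp; omega))
    (exec_shiftL (by simp; omega)))

theorem exec_toMarkR (l : List Bool) (h : L.length + 3 * l.length + R.length + 1 ≤ s) :
    RawExec s toMarkR ⟨k, p, c, L, encReg l ++ true :: R, o⟩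
      ⟨k, p, c, encReg l.reverse ++ L, true :: R, o⟩ := by
  induction l generalizing L with
  | nil => exact .loopDone (by simp [Raw.tst, Raw.view])
  | cons b l ih =>
    simp only [List.length_cons] at h
    refine .loopStep (by simp [Raw.tst, Raw.view])
      (exec_shiftSymR (R := encReg l ++ true :: R) ?_) ?_
    · simp; omega
    · have := ih (L := false :: b :: false :: L) (by simp; omega)
      simpa [toMarkR] using this

theorem exec_toMarkL (l : List Bool) (h : L.length + 3 * l.length + R.length + 1 ≤ s) :
    RawExec s toMarkL ⟨k, p, c, encReg l ++ true :: L, R, o⟩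
      ⟨k, p, c, true :: L, encReg l.reverse ++ R, o⟩ := by
  induction l generalizing R with
  | nil => exact .loopDone (by simp [Raw.tst, Raw.view])
  | cons b l ih =>
    simp only [List.length_cons] at h
    refine .loopStep (by simp [Raw.tst, Raw.view])
      (exec_shiftSymL (L := encReg l ++ true :: L) ?_) ?_
    · simp; omega
    · have := ih (R := false :: b :: false :: R) (by simp; omega)
      simpa [toMarkL] using this

theorem exec_skip (l : List Bool) (h : L.length + 3 * l.length + R.length + 3 ≤ s) :
    RawExec s skip ⟨k, p, c, L, block l ++ R, o⟩
      ⟨k, p, c, mark ++ (encReg l.reverse ++ L), R, o⟩ := by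
  have h1 := exec_toMarkR (s := s) (k := k) (p := p) (c := c) (o := o) (L := L)
    (R := true :: true :: R) l (by simp; omega)
  refine .seq (by simpa [block, mark] using h1) (exec_shiftSymR (by simp; omega))

theorem exec_unskip (l : List Bool) (h : L.length + 3 * l.length + R.length + 6 ≤ s) :
    RawExec s unskip ⟨k, p, c, mark ++ (encReg l.reverse ++ (mark ++ L)), R, o⟩
      ⟨k, p, c, mark ++ L, block l ++ R, o⟩ := by
  have h1 := exec_toMarkL (s := s) (k := k) (p := p) (c := c) (o := o) (L := true :: true :: L)
    (R := true :: true :: true :: R) l.reverse (by simp; omega)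
  refine .seq (exec_shiftSymL (by simp; omega)) (by simpa [block, mark] using h1)

theorem length_back (pre : List (List Bool)) (L : List Bool) :
    (back pre L).length = (pre.flatMap block).length + L.length + 3 := by
  induction pre generalizing L with
  | nil => simp [back]; omega
  | cons l pre ih => simp [back, ih, block]; omega

theorem exists_back (pre : List (List Bool)) (L : List Bool) : ∃ L', back pre L = mark ++ L' := by
  induction pre generalizing L with
  | nil => exact ⟨L, rfl⟩
  | cons l pre ih => exact ih _

theorem exec_skips (pre : List (List Bool))
    (h : L.length + (pre.flatMap block).length + R.length + 3 ≤ s) :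
    RawExec s (skips pre.length) ⟨k, p, c, mark ++ L, pre.flatMap block ++ R, o⟩
      ⟨k, p, c, back pre L, R, o⟩ := by
  induction pre generalizing L with
  | nil => exact exec_nop (by simp at h ⊢; omega)
  | cons l pre ih =>
    simp [block] at h
    have h1 := exec_skip (s := s) (k := k) (p := p) (c := c) (o := o) (L := mark ++ L)
      (R := pre.flatMap block ++ R) l (by simp [block]; omega)
    exact .seq (by simpa using h1) (ih (by simp [block]; omega))

theorem exec_unskips (pre : List (List Bool))
    (h : L.length + (pre.flatMap block).length + R.length + 3 ≤ s) :
    RawExec s (unskips pre.length) ⟨k, p, c, back pre L, R, o⟩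
      ⟨k, p, c, mark ++ L, pre.flatMap block ++ R, o⟩ := by
  induction pre generalizing L with
  | nil => exact exec_nop (by simp [back] at h ⊢; omega)
  | cons l pre ih =>
    simp [block] at h
    have h1 := exec_unskip (s := s) (k := k) (p := p) (c := c) (o := o) (L := L)
      (R := pre.flatMap block ++ R) l (by simp [block]; omega)
    exact .seq (ih (by simp [block]; omega)) (by simpa using h1)

/-- While `op` runs, the registers that were passed lie reversed on the left stack. For its space
estimate `op` needs only the length of `L'`, and the delimiter above `L'` is the place to which it
can return. -/
theorem exec_atReg {op : RawProg K} {pre : List (List Bool)} {n : ℕ} {R' : List Bool}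
    (hn : pre.length = n)
    (hop : ∀ L', L'.length = (pre.flatMap block).length + L.length →
      RawExec s op ⟨k, p, c, mark ++ L', R, o⟩ ⟨k', p, c, mark ++ L', R', o⟩)
    (h : L.length + (pre.flatMap block).length + R.length + 3 ≤ s)
    (h' : L.length + (pre.flatMap block).length + R'.length + 3 ≤ s) :
    RawExec s (atReg n op) ⟨k, p, c, L, mark ++ (pre.flatMap block ++ R), o⟩
      ⟨k', p, c, L, mark ++ (pre.flatMap block ++ R'), o⟩ := by
  subst hn
  obtain ⟨L', hL'⟩ := exists_back pre L
  have hlen := length_back pre L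
  rw [hL'] at hlen
  simp only [List.length_append, length_mark] at hlen
  refine .seq (exec_shiftSymR (R := pre.flatMap block ++ R)
    (by simp only [List.length_append]; omega)) (.seq (exec_skips pre h) (.seq ?_ (.seq
    (exec_unskips pre h') (exec_shiftSymL (L := L) (by simp only [List.length_append]; omega)))))
  rw [hL']
  exact hop L' (by omega)

end

/-! Operations on the register that begins at the head -/

def popHere (upd : K → Option Bool → K) : RawProg K :=
  .ite (fun _ v => v.right == some false)
    (.seq (.prim fun k _ => (k, { opRight := .pop }))
      (.seq (.prim fun k v => (upd k v.right, { opRight := .pop }))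
        (.prim fun k _ => (k, { opRight := .pop }))))
    (.prim fun k _ => (upd k none, {}))

def pushHere (f : K → Bool) : RawProg K :=
  .seq (.prim fun k _ => (k, { opRight := .push false }))
    (.seq (.prim fun k _ => (k, { opRight := .push (f k) }))
      (.prim fun k _ => (k, { opRight := .push false })))

/-- Rewrite the bits of a register from left to right, changing the control memory on the way. -/
def sweepLoop (f : K → Bool → K × Bool) : RawProg K :=
  .loop (fun _ v => v.right == some false)
    (.seq shiftR (.seq (.prim fun k v =>
      let r := f k (v.right.getD false)
      (r.1, { opRight := .pop, opLeft := .push r.2 })) shiftR))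

def emitHere (e : K → Option Bool) : RawProg K :=
  .ite (fun k _ => (e k).isSome)
    (.seq (.prim fun k _ => (k, { opLeft := .push false }))
      (.seq (.prim fun k _ => (k, { opLeft := bitOp (e k) }))
        (.prim fun k _ => (k, { opLeft := .push false }))))
    nop

def sweepHere (f : K → Bool → K × Bool) (e : K → Option Bool) : RawProg K :=
  .seq (sweepLoop f) (.seq (emitHere e) toMarkL)

/-- The effect of `sweepLoop`. -/
def sweepList (f : K → Bool → K × Bool) : K → List Bool → K × List Bool
  | k, [] => (k, [])
  | k, b :: l => ((sweepList f (f k b).1 l).1, (f k b).2 :: (sweepList f (f k b).1 l).2)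

@[simp] theorem length_sweepList (f : K → Bool → K × Bool) (k : K) (l : List Bool) :
    (sweepList f k l).2.length = l.length := by
  induction l generalizing k with
  | nil => rfl
  | cons b l ih => simp [sweepList, ih]

section

variable {s : ℕ} {k k' : K} {p c o L R : List Bool}

theorem exec_popHere (upd : K → Option Bool → K) (l : List Bool)
    (h : L.length + 3 * l.length + R.length + 3 ≤ s) :
    RawExec s (popHere upd) ⟨k, p, c, L, block l ++ R, o⟩
      ⟨upd k l.head?, p, c, L, block l.tail ++ R, o⟩ := by
  cases l with
  | nil =>
    refine .iteFalse (by simp [Raw.tst, Raw.view, block, mark]) (.prim_eq ?_ ?_)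
    · simp [Raw.sem, Raw.act, StackOp.apply]
    · simp [Raw.space, block]; simp at h; omega
  | cons b l =>
    simp at h
    refine .iteTrue (by simp [Raw.tst, Raw.view, block])
      (.seq (y := ⟨k, p, c, L, b :: false :: (block l ++ R), o⟩) (.prim_eq ?_ ?_)
      (.seq (y := ⟨upd k b, p, c, L, false :: (block l ++ R), o⟩) (.prim_eq ?_ ?_)
      (.prim_eq ?_ ?_)))
    all_goals simp [Raw.sem, Raw.act, Raw.view, StackOp.apply, Raw.space, block]
    all_goals omega

theorem exec_pushHere (f : K → Bool) (l : List Bool)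
    (h : L.length + 3 * l.length + R.length + 6 ≤ s) :
    RawExec s (pushHere f) ⟨k, p, c, L, block l ++ R, o⟩
      ⟨k, p, c, L, block (f k :: l) ++ R, o⟩ := by
  refine .seq (y := ⟨k, p, c, L, false :: (block l ++ R), o⟩) (.prim_eq ?_ ?_)
    (.seq (y := ⟨k, p, c, L, f k :: false :: (block l ++ R), o⟩) (.prim_eq ?_ ?_)
    (.prim_eq ?_ ?_))
  all_goals simp [Raw.sem, Raw.act, StackOp.apply, Raw.space, block]
  all_goals omega

theorem exec_sweepLoop (f : K → Bool → K × Bool) (l : List Bool)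
    (h : L.length + 3 * l.length + R.length + 3 ≤ s) :
    RawExec s (sweepLoop f) ⟨k, p, c, L, block l ++ R, o⟩
      ⟨(sweepList f k l).1, p, c, encReg (sweepList f k l).2.reverse ++ L, mark ++ R, o⟩ := by
  induction l generalizing L k with
  | nil => exact .loopDone (by simp [Raw.tst, Raw.view, mark, block])
  | cons b l ih =>
    simp at h
    refine .loopStep (y := ⟨(f k b).1, p, c, false :: (f k b).2 :: false :: L, block l ++ R, o⟩)
      (by simp [Raw.tst, Raw.view, block])
      (.seq (exec_shiftR (R := b :: false :: (block l ++ R)) ?_) (.seq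
        (y := ⟨(f k b).1, p, c, (f k b).2 :: false :: L, false :: (block l ++ R), o⟩)
        (.prim_eq ?_ ?_) (exec_shiftR ?_))) ?_
    · simp [block]; omega
    · simp [Raw.sem, Raw.act, Raw.view, StackOp.apply]
    · simp [Raw.space, block]; omega
    · simp [block]; omega
    · have := ih (k := (f k b).1) (L := false :: (f k b).2 :: false :: L) (by simp; omega)
      simpa [sweepList, sweepLoop] using this

theorem exec_emitHere (e : K → Option Bool)
    (h : L.length + R.length + 3 * (e k).toList.length ≤ s) :
    RawExec s (emitHere e) ⟨k, p, c, L, R, o⟩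
      ⟨k, p, c, encReg (e k).toList ++ L, R, o⟩ := by
  cases he : e k with
  | none =>
    simp [he] at h
    exact .iteFalse (by simp [Raw.tst, he]) (exec_nop h)
  | some b =>
    simp [he] at h
    refine .iteTrue (by simp [Raw.tst, he])
      (.seq (y := ⟨k, p, c, false :: L, R, o⟩) (.prim_eq ?_ ?_)
      (.seq (y := ⟨k, p, c, b :: false :: L, R, o⟩) (.prim_eq ?_ ?_) (.prim_eq ?_ ?_)))
    all_goals simp [Raw.sem, Raw.act, StackOp.apply, Raw.space, he, bitOp]
    all_goals omega

/-- The truncated subtraction treats two cases at once: besides the register and the two delimiters,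
three more cells are required exactly when a digit is appended. -/
theorem exec_sweepHere (f : K → Bool → K × Bool) (e : K → Option Bool) (l : List Bool)
    (h : L.length + 3 * l.length + R.length + 9 ≤
      s + (3 - 3 * (e (sweepList f k l).1).toList.length)) :
    RawExec s (sweepHere f e) ⟨k, p, c, mark ++ L, block l ++ R, o⟩
      ⟨(sweepList f k l).1, p, c, mark ++ L,
        block ((sweepList f k l).2 ++ (e (sweepList f k l).1).toList) ++ R, o⟩ := by
  have he : (e (sweepList f k l).1).toList.length ≤ 1 := by
    cases e (sweepList f k l).1 <;> simp
  refine .seq (exec_sweepLoop f l ?_) (.seq (exec_emitHere e ?_) ?_)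
  · simp; omega
  · simp; omega
  · have := exec_toMarkL (s := s) (k := (sweepList f k l).1) (p := p) (c := c) (o := o)
      (L := true :: true :: L) (R := mark ++ R)
      (((sweepList f k l).2 ++ (e (sweepList f k l).1).toList).reverse) (by simp; omega)
    have h2 : (e (sweepList f k l).1).toList.reverse = (e (sweepList f k l).1).toList := by
      cases e (sweepList f k l).1 <;> rfl
    simpa [block, mark, h2] using this

end

end RawProg

/-! ### Programs with registers -/

/-- `pd` and `pr` hold the read and the unread part of the simulated program, `xd` and `xr` the
matched and the unmatched part of the first component, `fr` the number of free cells of the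
simulation, `ct` a count of accepted programs, and `ix` the rank that is searched for. -/
inductive Reg where
  | pd | pr | xd | xr | fr | ct | ix

/-- The two stacks that are stored without overhead, and the registers. -/
inductive Idx where
  | a | b
  | reg (r : Reg)

structure Store where
  a : List Bool
  b : List Bool
  pd : List Bool
  pr : List Bool
  xd : List Bool
  xr : List Bool
  fr : List Bool
  ct : List Bool
  ix : List Bool

namespace Store

def get (σ : Store) : Idx → List Bool
  | .a => σ.a
  | .b => σ.b
  | .reg .pd => σ.pd
  | .reg .pr => σ.pr
  | .reg .xd => σ.xd
  | .reg .xr => σ.xr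
  | .reg .fr => σ.fr
  | .reg .ct => σ.ct
  | .reg .ix => σ.ix

def set (σ : Store) (i : Idx) (l : List Bool) : Store :=
  match i with
  | .a => { σ with a := l }
  | .b => { σ with b := l }
  | .reg .pd => { σ with pd := l }
  | .reg .pr => { σ with pr := l }
  | .reg .xd => { σ with xd := l }
  | .reg .xr => { σ with xr := l }
  | .reg .fr => { σ with fr := l }
  | .reg .ct => { σ with ct := l }
  | .reg .ix => { σ with ix := l }

/-- The stacks `a` and `b` count once, which keeps the coefficient of `s` in the theorem equal to 1;
a register bit takes three cells. -/
def weight (σ : Store) : ℕ :=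
  σ.a.length + σ.b.length + 3 * (σ.pd.length + σ.pr.length + σ.xd.length + σ.xr.length +
    σ.fr.length + σ.ct.length + σ.ix.length)

def regs (σ : Store) : List (List Bool) := [σ.pd, σ.pr, σ.xd, σ.xr, σ.fr, σ.ct, σ.ix]

end Store

def Reg.pos : Reg → ℕ
  | pd => 0
  | pr => 1
  | xd => 2
  | xr => 3
  | fr => 4
  | ct => 5
  | ix => 6

theorem Store.regs_split (σ : Store) (r : Reg) : ∃ pre post : List (List Bool), pre.length = r.pos ∧
    ∀ l, (σ.set (.reg r) l).regs = pre ++ l :: post ∧ (σ.set (.reg r) l).a = σ.a ∧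
      (σ.set (.reg r) l).b = σ.b := by
  cases r
  · exact ⟨[], [σ.pr, σ.xd, σ.xr, σ.fr, σ.ct, σ.ix], rfl, fun l => ⟨rfl, rfl, rfl⟩⟩
  · exact ⟨[σ.pd], [σ.xd, σ.xr, σ.fr, σ.ct, σ.ix], rfl, fun l => ⟨rfl, rfl, rfl⟩⟩
  · exact ⟨[σ.pd, σ.pr], [σ.xr, σ.fr, σ.ct, σ.ix], rfl, fun l => ⟨rfl, rfl, rfl⟩⟩
  · exact ⟨[σ.pd, σ.pr, σ.xd], [σ.fr, σ.ct, σ.ix], rfl, fun l => ⟨rfl, rfl, rfl⟩⟩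
  · exact ⟨[σ.pd, σ.pr, σ.xd, σ.xr], [σ.ct, σ.ix], rfl, fun l => ⟨rfl, rfl, rfl⟩⟩
  · exact ⟨[σ.pd, σ.pr, σ.xd, σ.xr, σ.fr], [σ.ix], rfl, fun l => ⟨rfl, rfl, rfl⟩⟩
  · exact ⟨[σ.pd, σ.pr, σ.xd, σ.xr, σ.fr, σ.ct], [], rfl, fun l => ⟨rfl, rfl, rfl⟩⟩

theorem Store.set_get (σ : Store) (i : Idx) : σ.set i (σ.get i) = σ := by
  cases i with
  | reg r => cases r <;> rfl
  | _ => rfl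

/-- Data of a program with registers. -/
structure Data (K : Type) where
  k : K
  st : Store
  prog : List Bool
  cond : List Bool
  out : List Bool

/-- Primitive actions of programs with registers. -/
inductive Op (K : Type) where
  | pop (i : Idx) (upd : K → Option Bool → K)
  | push (i : Idx) (f : K → Bool)
  | sweep (r : Reg) (f : K → Bool → K × Bool) (e : K → Option Bool)
  | set (f : K → K)
  | readProg (upd : K → Option Bool → K)
  | readCond (upd : K → Option Bool → K)
  | write (f : K → Bool)

namespace Op

variable {K : Type}

def sem : Op K → Data K → Data K
  | pop i upd, d => { d with k := upd d.k (d.st.get i).head?, st := d.st.set i (d.st.get i).tail }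
  | push i f, d => { d with st := d.st.set i (f d.k :: d.st.get i) }
  | sweep r f e, d =>
    let q := RawProg.sweepList f d.k (d.st.get (.reg r))
    { d with k := q.1, st := d.st.set (.reg r) (q.2 ++ (e q.1).toList) }
  | set f, d => { d with k := f d.k }
  | readProg upd, d => { d with k := upd d.k d.prog.head?, prog := d.prog.tail }
  | readCond upd, d => { d with k := upd d.k d.cond.head?, cond := d.cond.tail }
  | write f, d => { d with out := d.out ++ [f d.k] }

def compile : Op K → RawProg K
  | pop .a upd => .prim fun k v => (upd k v.left, { opLeft := .pop })
  | pop .b upd => RawProg.atReg 7 (.prim fun k v => (upd k v.right, { opRight := .pop }))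
  | pop (.reg r) upd => RawProg.atReg r.pos (RawProg.popHere upd)
  | push .a f => .prim fun k _ => (k, { opLeft := .push (f k) })
  | push .b f => RawProg.atReg 7 (.prim fun k _ => (k, { opRight := .push (f k) }))
  | push (.reg r) f => RawProg.atReg r.pos (RawProg.pushHere f)
  | sweep r f e => RawProg.atReg r.pos (RawProg.sweepHere f e)
  | set f => .prim fun k _ => (f k, {})
  | readProg upd => .prim fun k v => (upd k v.prog, { advProg := true })
  | readCond upd => .prim fun k v => (upd k v.cond, { advCond := true })
  | write f => .prim fun k _ => (k, { out := some (f k) })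

end Op

namespace Data

variable {K : Type}

/-- The layout of the stacks and registers on the two stacks of a machine. -/
def toRaw (d : Data K) : Raw K where
  k := d.k
  prog := d.prog
  cond := d.cond
  left := d.st.a
  right := RawProg.mark ++ (d.st.regs.flatMap RawProg.block ++ d.st.b)
  out := d.out

/-- One delimiter before the seven registers and one after each of them make 8 · 3 = 24 cells. -/
theorem space_toRaw (d : Data K) : d.toRaw.space = d.st.weight + 24 := by
  simp [toRaw, Raw.space, Store.regs, Store.weight, RawProg.block]
  ring

end Data

open RawProg in
theorem Store.flatMap_split (σ : Store) (r : Reg) : ∃ (pre : List (List Bool)) (P : List Bool), pre.length = r.pos ∧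
    ∀ l, (σ.set (.reg r) l).regs.flatMap block ++ σ.b =
        pre.flatMap block ++ (block l ++ P) ∧ (σ.set (.reg r) l).a = σ.a ∧
      (σ.set (.reg r) l).b = σ.b := by
  obtain ⟨pre, post, h1, h2⟩ := σ.regs_split r
  refine ⟨pre, post.flatMap block ++ σ.b, h1, fun l => ⟨?_, (h2 l).2⟩⟩
  rw [(h2 l).1]
  simp

open RawProg in
theorem Op.exec_compile {K : Type} (i : Op K) (d : Data K) (s : ℕ) (h : d.st.weight ≤ s)
    (h' : (i.sem d).st.weight ≤ s) : RawExec (s + 24) i.compile d.toRaw (i.sem d).toRaw := by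
  have e := d.space_toRaw
  have e' := (i.sem d).space_toRaw
  -- `hr` and `hb` deal with the way to a register and to the stack `b` once for all operations; `b`
  -- begins behind the seven registers. Only the effect at the head remains for the single cases.
  have hr : ∀ (r : Reg) (op : RawProg K) (k' : K) (l' : List Bool),
      (d.st.set (.reg r) l').weight ≤ s →
      (∀ L R, L.length + (block (d.st.get (.reg r)) ++ R).length + 3 ≤ s + 24 →
        L.length + (block l' ++ R).length + 3 ≤ s + 24 →
        RawExec (s + 24) op ⟨d.k, d.prog, d.cond, mark ++ L, block (d.st.get (.reg r)) ++ R, d.out⟩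
          ⟨k', d.prog, d.cond, mark ++ L, block l' ++ R, d.out⟩) →
      RawExec (s + 24) (atReg r.pos op) d.toRaw
        (Data.toRaw { d with k := k', st := d.st.set (.reg r) l' }) := by
    intro r op k' l' hw hop
    obtain ⟨pre, P, hpre, hs⟩ := d.st.flatMap_split r
    have e'' := Data.space_toRaw { d with k := k', st := d.st.set (.reg r) l' }
    have h0 := hs (d.st.get (.reg r))
    rw [Store.set_get] at h0
    have h1 := hs l'
    simp only [Data.toRaw, Raw.space, h0.1, h1.1, h1.2.1, h1.2.2, List.length_append, length_mark]
      at e e'' ⊢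
    refine exec_atReg hpre (fun L' hL' => hop _ _ ?_ ?_) ?_ ?_
    all_goals simp only [List.length_append]
    all_goals omega
  have hb : ∀ (op : RawProg K) (k' : K) (l' : List Bool),
      (d.st.set .b l').weight ≤ s →
      (∀ L, L.length + d.st.b.length + 3 ≤ s + 24 → L.length + l'.length + 3 ≤ s + 24 →
        RawExec (s + 24) op ⟨d.k, d.prog, d.cond, mark ++ L, d.st.b, d.out⟩
          ⟨k', d.prog, d.cond, mark ++ L, l', d.out⟩) →
      RawExec (s + 24) (atReg 7 op) d.toRaw
        (Data.toRaw { d with k := k', st := d.st.set .b l' }) := by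
    intro op k' l' hw hop
    have e'' := Data.space_toRaw { d with k := k', st := d.st.set .b l' }
    have h1 : (d.st.set .b l').regs = d.st.regs := rfl
    have h2 : (d.st.set .b l').a = d.st.a := rfl
    have h3 : (d.st.set .b l').b = l' := rfl
    simp only [Data.toRaw, Raw.space, List.length_append, length_mark, h1, h2, h3] at e e'' ⊢
    refine exec_atReg (pre := d.st.regs) rfl (fun L' hL' => hop _ ?_ ?_) ?_ ?_
    all_goals omega
  match i with
  | pop .a upd =>
    refine .prim_eq ?_ (by rw [e']; omega)
    simp [Raw.sem, Raw.act, Data.toRaw, Raw.view, StackOp.apply, Op.sem, Store.get, Store.set,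
      Store.regs]
  | pop .b upd =>
    refine hb _ _ _ h' fun L h1 h2 => .prim_eq ?_ ?_
    · simp [Raw.sem, Raw.act, Raw.view, StackOp.apply, Store.get]
    · simp [Raw.space, Store.get] at h2 ⊢; omega
  | pop (.reg r) upd =>
    refine hr r _ _ _ h' fun L R h1 h2 => exec_popHere upd _ ?_
    simp [block] at h1 ⊢; omega
  | push .a f =>
    refine .prim_eq ?_ (by rw [e']; omega)
    simp [Raw.sem, Raw.act, Data.toRaw, StackOp.apply, Op.sem, Store.get, Store.set, Store.regs]
  | push .b f =>
    refine hb _ _ _ h' fun L h1 h2 => .prim_eq ?_ ?_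
    · simp [Raw.sem, Raw.act, StackOp.apply, Store.get]
    · simp [Raw.space, Store.get] at h2 ⊢; omega
  | push (.reg r) f =>
    refine hr r _ _ _ h' fun L R h1 h2 => exec_pushHere f _ ?_
    simp [block] at h2 ⊢; omega
  | sweep r f g =>
    refine hr r _ _ _ h' fun L R h1 h2 => exec_sweepHere f g _ ?_
    have he : ∀ o : Option Bool, o.toList.length ≤ 1 := by rintro (_ | _) <;> simp
    have := he (g (sweepList f d.k (d.st.get (.reg r))).1)
    simp [block] at h1 h2 ⊢; omega
  | set f =>
    refine .prim_eq ?_ (by rw [e']; omega)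
    simp [Raw.sem, Raw.act, Data.toRaw, StackOp.apply, Op.sem]
  | readProg upd =>
    refine .prim_eq ?_ (by rw [e']; omega)
    simp [Raw.sem, Raw.act, Raw.view, Data.toRaw, StackOp.apply, Op.sem]
  | readCond upd =>
    refine .prim_eq ?_ (by rw [e']; omega)
    simp [Raw.sem, Raw.act, Raw.view, Data.toRaw, StackOp.apply, Op.sem]
  | write f =>
    refine .prim_eq ?_ (by rw [e']; omega)
    simp [Raw.sem, Raw.act, Data.toRaw, StackOp.apply, Op.sem]

/-- Programs with registers. -/
abbrev RProg (K : Type) := Prog (Op K) (K → Bool)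

/-- Execution of a program with registers whose weight never exceeds `s`. -/
abbrev RExec {K : Type} (s : ℕ) : RProg K → Data K → Data K → Prop :=
  Prog.Exec Op.sem (fun t d => t d.k) (fun d => d.st.weight ≤ s)

def Store.empty : Store := ⟨[], [], [], [], [], [], [], [], []⟩

/-- The initial layout of the registers. -/
def setup {K : Type} : RawProg K :=
  (List.replicate 24 ()).foldr
    (fun _ q => .seq (.prim fun k _ => (k, { opRight := .push true })) q) RawProg.nop

open RawProg in
theorem exec_setup {K : Type} (k : K) (p c : List Bool) (s : ℕ) :
    RawExec (s + 24) setup ⟨k, p, c, [], [], []⟩ (Data.toRaw ⟨k, .empty, p, c, []⟩) := by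
  have : ∀ n m, n + m ≤ 24 → RawExec (s + 24) ((List.replicate n ()).foldr
      (fun _ q => .seq (.prim fun k _ => (k, { opRight := .push true })) q) RawProg.nop)
      ⟨k, p, c, [], List.replicate m true, []⟩
      ⟨k, p, c, [], List.replicate (m + n) true, []⟩ := by
    intro n
    induction n with
    | zero => intro m h; exact exec_nop (by simp; omega)
    | succ n ih =>
      intro m h
      refine .seq (.prim_eq (y := ⟨k, p, c, [], List.replicate (m + 1) true, []⟩) ?_ ?_) ?_
      · simp [Raw.sem, Raw.act, StackOp.apply, List.replicate_succ]
      · simp [Raw.space]; omega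
      · have := ih (m + 1) (by omega)
        rwa [add_assoc, add_comm 1 n] at this
  exact this 24 0 (by omega)

/-- The machine that executes a program with registers. -/
def RProg.toMachine {K : Type} [Finite K] (p : RProg K) (k : K) : StackMachine :=
  RawProg.toMachine (.seq setup (p.translate Op.compile fun t k _ => t k)) k

theorem RProg.produces_toMachine {K : Type} [Finite K] {p : RProg K} {k : K} {s : ℕ}
    {q x : List Bool} {d : Data K} (h : RExec s p ⟨k, .empty, q, x, []⟩ d) :
    (RProg.toMachine p k).Produces (s + 24) q x d.out := by
  refine RawProg.produces_toMachine (y := d.toRaw) (.seq (exec_setup k q x s) ?_)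
  exact Prog.Exec.translate (e := Data.toRaw) (fun i d h h' => i.exec_compile d s h h')
    (fun t d => rfl) h (by simp [Store.weight, Store.empty])

end StackMachine

/-! ### Binary counters of fixed width -/

namespace StackMachine

/-- The `w` lowest binary digits of `v`, the lowest one first. -/
def bits : ℕ → ℕ → List Bool
  | 0, _ => []
  | w + 1, v => (v % 2 == 1) :: bits w (v / 2)

@[simp] theorem length_bits (w v : ℕ) : (bits w v).length = w := by
  induction w generalizing v with
  | zero => rfl
  | succ w ih => simp [bits, ih]

theorem bits_zero (w : ℕ) : bits w 0 = List.replicate w false := by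
  induction w with
  | zero => rfl
  | succ w ih => simp [bits, ih, List.replicate_succ]

theorem bits_add_pow (w v : ℕ) : bits w (v + 2 ^ w) = bits w v := by
  induction w generalizing v with
  | zero => rfl
  | succ w ih =>
    have h1 : (v + 2 ^ (w + 1)) % 2 = v % 2 := by omega
    have h2 : (v + 2 ^ (w + 1)) / 2 = v / 2 + 2 ^ w := by omega
    simp [bits, h1, h2, ih]

theorem bits_pow (w : ℕ) : bits w (2 ^ w) = bits w 0 := by
  simpa using bits_add_pow w 0

theorem bits_succ_pow (w : ℕ) : bits (w + 1) (2 ^ w) = bits w 0 ++ [true] := by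
  induction w with
  | zero => rfl
  | succ w ih =>
    have h1 : 2 ^ (w + 1) % 2 = 0 := by omega
    have h2 : 2 ^ (w + 1) / 2 = 2 ^ w := by omega
    rw [bits, h1, h2, ih]
    simp [bits]

theorem exists_eq_bits (l : List Bool) : ∃ v, v < 2 ^ l.length ∧ l = bits l.length v := by
  induction l with
  | nil => exact ⟨0, by simp, rfl⟩
  | cons b l ih =>
    obtain ⟨v, hv, hl⟩ := ih
    refine ⟨2 * v + b.toNat, ?_, ?_⟩
    · have := b.toNat_lt
      simp [pow_succ]; omega
    · have h1 : (2 * v + b.toNat) / 2 = v := by have := b.toNat_lt; omega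
      have h2 : b = (b.toNat % 2 == 1) := by cases b <;> rfl
      simp [bits, h1, ← h2, ← hl]

theorem bits_injOn {w v v' : ℕ} (hv : v < 2 ^ w) (hv' : v' < 2 ^ w) (h : bits w v = bits w v') :
    v = v' := by
  induction w generalizing v v' with
  | zero => simp at hv hv'; omega
  | succ w ih =>
    simp [bits] at h
    have h1 := ih (by omega) (by omega) h.2
    rcases Nat.mod_two_eq_zero_or_one v with h2 | h2 <;>
      rcases Nat.mod_two_eq_zero_or_one v' with h3 | h3 <;> simp [h2, h3] at h <;> omega

/-- Add one (if `b`) or subtract one (if `!b`) at the lowest digit, provided that the carry `c` is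
set; returns the final carry. -/
def bumpList (b : Bool) : Bool → List Bool → Bool × List Bool
  | c, [] => (c, [])
  | c, d :: l =>
    if c then ((bumpList b (d == b) l).1, (!d) :: (bumpList b (d == b) l).2)
    else ((bumpList b false l).1, d :: (bumpList b false l).2)

theorem bumpList_false (b : Bool) (l : List Bool) : bumpList b false l = (false, l) := by
  induction l with
  | nil => rfl
  | cons d l ih => simp [bumpList, ih]

theorem pow_succ_dvd_iff (w m : ℕ) (h : m % 2 = 0) : 2 ^ (w + 1) ∣ m ↔ 2 ^ w ∣ m / 2 := by
  rw [pow_succ]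
  obtain ⟨k, rfl⟩ := Nat.dvd_of_mod_eq_zero h
  rw [mul_comm 2 k, Nat.mul_div_cancel _ (by norm_num)]
  exact Nat.mul_dvd_mul_iff_right (by norm_num)

theorem not_pow_succ_dvd (w m : ℕ) (h : m % 2 = 1) : ¬ 2 ^ (w + 1) ∣ m := fun h' => by
  have : 2 ∣ m := (dvd_pow_self 2 (by omega)).trans h'
  omega

/-- The carry passes through the lowest ones and leaves the register if all digits are ones, that
is, if the new value vanishes modulo 2^w. Stated by divisibility, this needs no bound on `v`. -/
theorem bumpList_true_bits (w v : ℕ) :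
    bumpList true true (bits w v) = (decide (2 ^ w ∣ v + 1), bits w (v + 1)) := by
  induction w generalizing v with
  | zero => simp [bits, bumpList]
  | succ w ih =>
    rcases Nat.mod_two_eq_zero_or_one v with h | h
    · have h1 : (v + 1) % 2 = 1 := by omega
      have h2 : (v + 1) / 2 = v / 2 := by omega
      have := not_pow_succ_dvd w (v + 1) h1
      simp [bits, bumpList, h, h1, h2, bumpList_false, this]
    · have h1 : (v + 1) % 2 = 0 := by omega
      have h2 : (v + 1) / 2 = v / 2 + 1 := by omega
      have := pow_succ_dvd_iff w (v + 1) h1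
      simp [bits, bumpList, h, h1, h2, ih, this]

theorem bumpList_false_bits (w v : ℕ) :
    bumpList false true (bits w (v + 1)) = (decide (2 ^ w ∣ v + 1), bits w v) := by
  induction w generalizing v with
  | zero => simp [bits, bumpList]
  | succ w ih =>
    rcases Nat.mod_two_eq_zero_or_one v with h | h
    · have h1 : (v + 1) % 2 = 1 := by omega
      have h2 : (v + 1) / 2 = v / 2 := by omega
      have := not_pow_succ_dvd w (v + 1) h1
      simp [bits, bumpList, h, h1, h2, bumpList_false, this]
    · have h1 : (v + 1) % 2 = 0 := by omega
      have h2 : (v + 1) / 2 = v / 2 + 1 := by omega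
      have := pow_succ_dvd_iff w (v + 1) h1
      simp [bits, bumpList, h, h1, h2, ih, this]

theorem bumpList_false_bits_zero (w : ℕ) :
    bumpList false true (bits w 0) = (true, bits w (2 ^ w - 1)) := by
  have h := bumpList_false_bits w (2 ^ w - 1)
  have h1 : 2 ^ w - 1 + 1 = 2 ^ w := Nat.sub_add_cancel Nat.one_le_two_pow
  rw [h1, bits_pow] at h
  simpa using h

end StackMachine

/-! ### Walks in the configuration graph of a deterministic system -/

/-- A deterministic system whose transitions can be undone, given the label of the transition. Only
finitely many states are valid. -/
structure LabeledSystem (C : Type) (N : ℕ) where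
  fwd : C → Option C
  label : C → Fin N
  bwd : Fin N → C → Option C
  valid : C → Prop
  finite_valid : {c | valid c}.Finite
  valid_fwd : ∀ {c d}, valid c → fwd c = some d → valid d
  bwd_iff : ∀ {i c d}, valid d → (bwd i d = some c ↔ valid c ∧ fwd c = some d ∧ label c = i)

namespace LabeledSystem

variable {C : Type} {N : ℕ} (L : LabeledSystem C N)

/-- One step of the traversal of the configuration graph: at `(c, none)` the transition from `c` is
made, at `(c, some j)` the transitions that lead to `c` and have labels from `j` on are yet to be
undone. -/
def walk : C × Option (Fin (N + 1)) → Option (C × Option (Fin (N + 1)))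
  | (c, none) => (L.fwd c).map fun d => (d, some (L.label c).succ)
  | (c, some j) => some <|
    if h : j.val < N then
      match L.bwd ⟨j, h⟩ c with
      | some c' => (c', some 0)
      | none => (c, some (Fin.succ ⟨j, h⟩))
    else (c, none)

def Reach : C → C → Prop := Relation.ReflTransGen fun c d => L.fwd c = some d

def WalkReach : C × Option (Fin (N + 1)) → C × Option (Fin (N + 1)) → Prop :=
  Relation.ReflTransGen fun x y => L.walk x = some y

variable {L}

theorem valid_walk {x y : C × Option (Fin (N + 1))} (hx : L.valid x.1) (h : L.walk x = some y) :
    L.valid y.1 := by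
  obtain ⟨c, _ | j⟩ := x
  · simp only [walk, Option.map_eq_some_iff] at h
    obtain ⟨d, hd, rfl⟩ := h
    exact L.valid_fwd hx hd
  · simp only [walk, Option.some.injEq] at h
    split_ifs at h with hj
    · split at h
      · rename_i c' hc
        subst h
        exact ((L.bwd_iff hx).1 hc).1
      · subst h; exact hx
    · subst h; exact hx

/-- The walk stays in place or crosses an edge of the graph in one of the two directions. As a
configuration has at most one successor, the final configuration it leads to does not change. -/
theorem reach_iff_of_walk {x y : C × Option (Fin (N + 1))} (hx : L.valid x.1)
    (h : L.walk x = some y) {d : C} (hd : L.fwd d = none) : L.Reach x.1 d ↔ L.Reach y.1 d := by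
  have key : ∀ {c c' : C}, L.fwd c = some c' → (L.Reach c d ↔ L.Reach c' d) := by
    intro c c' hc
    refine ⟨fun hr => ?_, fun hr => .head hc hr⟩
    rcases hr.cases_head with rfl | ⟨e, he, hr⟩
    · simp [hd] at hc
    · rw [hc, Option.some.injEq] at he; subst he; exact hr
  obtain ⟨c, _ | j⟩ := x
  · simp only [walk, Option.map_eq_some_iff] at h
    obtain ⟨d, hd, rfl⟩ := h
    exact key hd
  · simp only [walk, Option.some.injEq] at h
    split_ifs at h with hj
    · split at h
      · rename_i c' hc
        subst h
        exact (key ((L.bwd_iff hx).1 hc).2.1).symm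
      · subst h; rfl
    · subst h; rfl

/-- The mark of `y` reveals the previous position. With `none`, the labels were exhausted; with
`some 0`, a transition was undone, and it can be made again. With `some i.succ`, either the
transition labelled `i` was made or the attempt to undo it failed, and `bwd_iff` excludes that both
occur at the same configuration. -/
theorem walk_injective {x x' y : C × Option (Fin (N + 1))} (hx : L.valid x.1) (hx' : L.valid x'.1)
    (h : L.walk x = some y) (h' : L.walk x' = some y) : x = x' := by
  have key : ∀ {x y : C × Option (Fin (N + 1))}, L.valid x.1 → L.walk x = some y →
      (x.2 = none ∧ L.fwd x.1 = some y.1 ∧ y.2 = some (L.label x.1).succ) ∨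
      (∃ i : Fin N, x.2 = some i.castSucc ∧ y.2 = some 0 ∧ L.fwd y.1 = some x.1 ∧ L.label y.1 = i) ∨
      (∃ i : Fin N, x.2 = some i.castSucc ∧ y = (x.1, some i.succ) ∧ L.bwd i x.1 = none) ∨
      (x.2 = some (Fin.last N) ∧ y = (x.1, none)) := by
    rintro ⟨c, _ | j⟩ y hx h
    · simp only [walk, Option.map_eq_some_iff] at h
      obtain ⟨d, hd, rfl⟩ := h
      exact .inl ⟨rfl, hd, rfl⟩
    · simp only [walk, Option.some.injEq] at h
      split_ifs at h with hj
      · split at h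
        · rename_i c' hc
          subst h
          have := (L.bwd_iff hx).1 hc
          exact .inr (.inl ⟨⟨j, hj⟩, rfl, rfl, this.2.1, this.2.2⟩)
        · rename_i hc
          subst h
          exact .inr (.inr (.inl ⟨⟨j, hj⟩, rfl, rfl, hc⟩))
      · subst h
        refine .inr (.inr (.inr ⟨?_, rfl⟩))
        simp only [Option.some.injEq]
        exact Fin.ext (by have := j.isLt; change j.val = N; omega)
  obtain ⟨c, m⟩ := x
  obtain ⟨c', m'⟩ := x'
  obtain ⟨d, t⟩ := y
  have hz : ∀ i : Fin N, (0 : Fin (N + 1)) ≠ i.succ := fun i => (Fin.succ_ne_zero i).symm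
  rcases key hx h with ⟨h1, h2, h3⟩ | ⟨i, h1, h2, h3, h4⟩ | ⟨i, h1, h2, h3⟩ | ⟨h1, h2⟩ <;>
    rcases key hx' h' with ⟨g1, g2, g3⟩ | ⟨j, g1, g2, g3, g4⟩ | ⟨j, g1, g2, g3⟩ | ⟨g1, g2⟩ <;>
    simp only [Prod.mk.injEq] at * <;> subst_vars
  · simp only [Option.some.injEq, Fin.succ_inj] at g3
    have e1 := (L.bwd_iff (L.valid_fwd hx h2)).2 ⟨hx, h2, rfl⟩
    have e2 := (L.bwd_iff (L.valid_fwd hx h2)).2 ⟨hx', g2, rfl⟩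
    rw [← g3, e1, Option.some.injEq] at e2
    exact ⟨e2, rfl⟩
  · simp at g2
  · obtain ⟨rfl, g2⟩ := g2
    simp only [Option.some.injEq, Fin.succ_inj] at g2
    subst g2
    rw [(L.bwd_iff (L.valid_fwd hx h2)).2 ⟨hx, h2, rfl⟩] at g3
    simp at g3
  · simp at g2
  · simp at g3; exact absurd g3.symm (Fin.succ_ne_zero _)
  · rw [h3, Option.some.injEq] at g3
    exact ⟨g3, rfl⟩
  · simp at g2; exact absurd g2.2.symm (Fin.succ_ne_zero _)
  · simp at g2
  · obtain ⟨rfl, h2⟩ := h2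
    simp only [Option.some.injEq, Fin.succ_inj] at h2
    subst h2
    rw [(L.bwd_iff (L.valid_fwd hx' g2)).2 ⟨hx', g2, rfl⟩] at h3
    simp at h3
  · simp only [Option.some.injEq] at h2
    exact absurd h2.2 (hz i)
  · obtain ⟨rfl, h2⟩ := h2
    obtain ⟨rfl, g2⟩ := g2
    rw [h2, Option.some.injEq, Fin.succ_inj] at g2
    subst g2; exact ⟨rfl, rfl⟩
  · simp [h2.2] at g2
  · simp at h2
  · simp at h2
  · simp [h2.2] at g2
  · exact ⟨h2.1.symm.trans g2.1, rfl⟩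

/-- `c` reaches `d` in exactly `n` steps. -/
def Dist (L : LabeledSystem C N) : ℕ → C → C → Prop
  | 0, c, d => c = d
  | n + 1, c, d => ∃ e, L.fwd c = some e ∧ L.Dist n e d

theorem Reach.exists_dist {c d : C} (h : L.Reach c d) : ∃ n, L.Dist n c d := by
  induction h using Relation.ReflTransGen.head_induction_on with
  | refl => exact ⟨0, rfl⟩
  | head h _ ih =>
    obtain ⟨n, hn⟩ := ih
    exact ⟨n + 1, _, h, hn⟩

theorem Dist.unique {c d : C} (hd : L.fwd d = none) {m n : ℕ} (hm : L.Dist m c d)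
    (hn : L.Dist n c d) : m = n := by
  induction m generalizing c n with
  | zero =>
    cases hm
    cases n with
    | zero => rfl
    | succ n => obtain ⟨e, he, _⟩ := hn; simp [hd] at he
  | succ m ih =>
    obtain ⟨e, he, hm⟩ := hm
    cases n with
    | zero => cases hn; simp [hd] at he
    | succ n =>
      obtain ⟨e', he', hn⟩ := hn
      rw [he, Option.some.injEq] at he'
      subst he'
      rw [ih hm hn]

theorem Dist.exists_lower {c d : C} (hc : L.valid c) {n : ℕ} (h : L.Dist n c d) :
    ∀ m ≤ n, ∃ e, L.valid e ∧ L.Dist m e d := by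
  induction n generalizing c with
  | zero =>
    intro m hm
    obtain rfl : m = 0 := by omega
    exact ⟨c, hc, h⟩
  | succ n ih =>
    intro m hm
    rcases hm.lt_or_eq with hm | rfl
    · obtain ⟨e, he, h⟩ := h
      exact ih (L.valid_fwd hc he) h m (by omega)
    · exact ⟨c, hc, h⟩

/-- Pigeonhole: there are valid configurations at all distances 0, ..., n from `d`, and they differ
because the distance to a final configuration is unique. -/
theorem Dist.lt_card {c d : C} (hc : L.valid c) (hd : L.fwd d = none) {n : ℕ} (h : L.Dist n c d) :
    n < L.finite_valid.toFinset.card := by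
  have : Nonempty C := ⟨c⟩
  choose! e he1 he2 using h.exists_lower hc
  have : (Finset.range (n + 1)).card ≤ L.finite_valid.toFinset.card := by
    refine Finset.card_le_card_of_injOn e (fun m hm => ?_) (fun m hm m' hm' hh => ?_)
    · simp at hm ⊢
      exact he1 m (by omega)
    · simp at hm hm'
      have h1 := he2 m (by omega)
      rw [hh] at h1
      exact h1.unique hd (he2 m' (by omega))
  simpa using this

/-- The configurations that lead to a final one form a tree of bounded depth. In the induction on
the remaining depth `k`, a predecessor of `c` lies one level deeper, so its subtree is finished by
the induction hypothesis; its transition then leads back to `c` with the next label. The labels are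
treated by reverse induction. -/
theorem walkReach_of_down {d : C} (hd : L.fwd d = none) (k : ℕ) : ∀ {n : ℕ} {c : C}, L.valid c →
    L.Dist n c d → L.finite_valid.toFinset.card ≤ n + k → ∀ j, L.WalkReach (c, some j) (c, none) := by
  induction k with
  | zero =>
    intro n c hc hn hk
    have := hn.lt_card hc hd
    omega
  | succ k ih =>
    intro n c hc hn hk
    refine Fin.reverseInduction ?_ ?_
    · exact .single (by simp [walk])
    · intro i hi
      cases hb : L.bwd i c with
      | none =>
        refine .head ?_ hi
        simp [walk, hb]
      | some c' =>
        have hc' := (L.bwd_iff hc).1 hb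
        have h1 : L.WalkReach (c', some 0) (c', none) :=
          ih (n := n + 1) hc'.1 ⟨c, hc'.2.1, hn⟩ (by omega) 0
        refine .head (b := (c', some 0)) (by simp [walk, hb]) (.trans h1 (.head ?_ hi))
        simp [walk, hc'.2.1, hc'.2.2]

/-- Each transition of the computation is made by the walk as well, and between two of them the walk
makes a detour through the subtrees of the remaining labels. These detours are finite. -/
theorem walkReach_of_reach {c d : C} (hc : L.valid c) (hd : L.fwd d = none) (h : L.Reach c d) :
    L.WalkReach (c, none) (d, none) := by
  induction h using Relation.ReflTransGen.head_induction_on with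
  | refl => exact .refl
  | @head e e' h h' ih =>
    obtain ⟨n, hn⟩ := Reach.exists_dist h'
    have hv := L.valid_fwd hc h
    exact .head (b := (_, some (L.label e).succ)) (by simp [walk, h]) (.trans (walkReach_of_down hd _ hv hn le_add_self _) (ih hv))

/-- The traversal that starts in `c` either reaches a final configuration that is reached by `c`,
without returning to its beginning on the way, or it returns to its beginning, and `c` does not
reach final configurations. -/
theorem walk_dichotomy {c : C} (hc : L.valid c) :
    ∃ (n : ℕ) (g : ℕ → C × Option (Fin (N + 1))), g 0 = (c, none) ∧
      (∀ i < n, L.walk (g i) = some (g (i + 1))) ∧ (∀ i < n, 0 < i → g i ≠ (c, none)) ∧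
      (∀ i ≤ n, L.valid (g i).1) ∧
      ((∃ d, L.Reach c d ∧ L.fwd d = none ∧ g n = (d, none) ∧ (0 < n → g n ≠ (c, none))) ∨
        ((∀ d, L.Reach c d → L.fwd d ≠ none) ∧ 0 < n ∧ g n = (c, none))) := by
  classical
  -- With `getD` a walk that has stopped stands still, which makes `g` a total sequence.
  set g : ℕ → C × Option (Fin (N + 1)) := fun n => (fun x => (L.walk x).getD x)^[n] (c, none)
    with hg
  have g0 : g 0 = (c, none) := rfl
  have gs : ∀ n, g (n + 1) = (L.walk (g n)).getD (g n) := fun n =>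
    Function.iterate_succ_apply' _ _ _
  have hvalid : ∀ n, L.valid (g n).1 := by
    intro n
    induction n with
    | zero => exact hc
    | succ n ih =>
      rw [gs]
      cases hw : L.walk (g n) with
      | none => exact ih
      | some y => exact valid_walk ih hw
  by_cases hr : ∃ d, L.Reach c d ∧ L.fwd d = none
  · obtain ⟨d, hcd, hd⟩ := hr
    have hreach : ∃ n, g n = (d, none) := by
      have : ∀ y, L.WalkReach (c, none) y → ∃ n, g n = y := by
        intro y hy
        induction hy with
        | refl => exact ⟨0, rfl⟩
        | tail _ h ih =>
          obtain ⟨n, rfl⟩ := ih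
          exact ⟨n + 1, by rw [gs, h]; rfl⟩
      exact this _ (walkReach_of_reach hc hd hcd)
    have hmin := fun m (hm : m < Nat.find hreach) => Nat.find_min hreach hm
    have hn := Nat.find_spec hreach
    -- If the walk returned to its start earlier, the part before the return could be cut off,
    -- contrary to the minimality of the first visit to `(d, none)`.
    have hne : ∀ i ≤ Nat.find hreach, 0 < i → g i ≠ (c, none) := by
      intro i hi hpos he
      refine hmin (Nat.find hreach - i) (by omega) ?_
      have : g (Nat.find hreach) = g (Nat.find hreach - i) := by
        conv_lhs => rw [← Nat.sub_add_cancel hi]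
        simp only [hg, Function.iterate_add_apply]
        exact congrArg _ he
      rw [← this, hn]
    refine ⟨Nat.find hreach, g, g0, ?_, fun i hi => hne i hi.le, fun i _ => hvalid i,
      .inl ⟨d, hcd, hd, hn, fun h => hne _ le_rfl h⟩⟩
    intro i hi
    cases hw : L.walk (g i) with
    | none =>
      have hstay : ∀ j, g (i + j) = g i := by
        intro j
        induction j with
        | zero => rfl
        | succ j ih => rw [← add_assoc, gs, ih, hw]; rfl
      have := hstay (Nat.find hreach - i)
      rw [Nat.add_sub_cancel' hi.le, hn] at this
      exact absurd this.symm (hmin i hi)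
    | some y => rw [gs, hw]; rfl
  · push Not at hr
    -- The walk can stop only at a final configuration, and by the invariance of reachability this
    -- one would be reached from `c`.
    have hw : ∀ n, L.walk (g n) = some (g (n + 1)) := by
      intro n
      have hs : ∀ n, ∀ d, L.fwd d = none → (L.Reach c d ↔ L.Reach (g n).1 d) := by
        intro n d hd
        induction n with
        | zero => rfl
        | succ n ih =>
          rw [ih, gs]
          cases hw : L.walk (g n) with
          | none => rfl
          | some y => exact reach_iff_of_walk (hvalid n) hw hd
      cases hw : L.walk (g n) with
      | some y => rw [gs, hw]; rfl
      | none =>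
        exfalso
        rcases hgn : g n with ⟨d, _ | j⟩
        · rw [hgn] at hw
          simp only [walk, Option.map_eq_none_iff] at hw
          have := (hs n d hw).2 (by rw [hgn]; exact .refl)
          exact hr d this hw
        · rw [hgn] at hw
          simp [walk] at hw
    -- Among finitely many positions two coincide, and injectivity moves this coincidence back to
    -- time 0, so the walk is purely periodic.
    have hper : ∃ n, 0 < n ∧ g n = (c, none) := by
      have hfin : (Set.range g).Finite := by
        refine (L.finite_valid.prod (Set.finite_univ (α := Option (Fin (N + 1))))).subset ?_
        rintro _ ⟨n, rfl⟩
        exact ⟨hvalid n, trivial⟩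
      obtain ⟨i, j, hij, he⟩ : ∃ i j, i < j ∧ g i = g j := by
        by_contra hno
        push Not at hno
        refine Set.infinite_range_of_injective (f := g) ?_ hfin
        intro i j he
        rcases lt_trichotomy i j with h | h | h
        · exact absurd he (hno i j h)
        · exact h
        · exact absurd he.symm (hno j i h)
      induction i generalizing j with
      | zero => exact ⟨j, hij, he.symm⟩
      | succ i ih =>
        obtain ⟨j, rfl⟩ : ∃ m, j = m + 1 := ⟨j - 1, by omega⟩
        refine ih j (by omega) ?_
        exact walk_injective (hvalid i) (hvalid j) (hw i) (by rw [hw j, he])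
    refine ⟨Nat.find hper, g, g0, fun i _ => hw i, ?_, fun i _ => hvalid i,
      .inr ⟨hr, Nat.find_spec hper⟩⟩
    intro i hi hpos he
    exact Nat.find_min hper hi ⟨hpos, he⟩

end LabeledSystem

/-! ### Machines whose steps concern a single stack or tape -/

namespace StackMachine

inductive Instr where
  | push (i : Bool) (b : Bool)
  | pop (i : Bool)
  | read
  | out (o : Option Bool)
  | halt

/-- A machine with a program tape, two stacks and an output tape; in one step it does one of the
actions of `Instr`, and the next state depends on the bit that is popped or read. -/
structure Micro (S : Type) where
  start : S
  instr : S → Instr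
  next : S → Option Bool → S

/-- A configuration of a machine: the state, the two stacks, the part of the program that has been
read (in reverse), and the part yet to be read. -/
structure Conf (S : Type) where
  s : S
  a : List Bool
  b : List Bool
  pd : List Bool
  pr : List Bool

namespace Conf

variable {S : Type}

def get (c : Conf S) : Bool → List Bool
  | true => c.a
  | false => c.b

def set (c : Conf S) (i : Bool) (l : List Bool) : Conf S :=
  match i with
  | true => { c with a := l }
  | false => { c with b := l }

def space (c : Conf S) : ℕ := c.a.length + c.b.length

def initial (s : S) (p : List Bool) : Conf S := ⟨s, [], [], [], p⟩

end Conf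

namespace Micro

variable {S : Type} (M : Micro S)

/-- The bit that is popped or read in the next step. -/
def res (c : Conf S) : Option Bool :=
  match M.instr c.s with
  | .pop i => (c.get i).head?
  | .read => c.pr.head?
  | _ => none

/-- The output of the next step. -/
def emit (c : Conf S) : List Bool :=
  match M.instr c.s with
  | .out o => o.toList
  | _ => []

/-- One step, possible only if the space does not exceed `f` afterwards. -/
def step (f : ℕ) (c : Conf S) : Option (Conf S) :=
  match M.instr c.s with
  | .push i b =>
    if c.space < f then some { c.set i (b :: c.get i) with s := M.next c.s none } else none
  | .pop i => some { c.set i (c.get i).tail with s := M.next c.s (c.get i).head? }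
  | .read => some { c with
      s := M.next c.s c.pr.head?, pd := c.pr.head?.toList ++ c.pd, pr := c.pr.tail }
  | .out _ => some { c with s := M.next c.s none }
  | .halt => none

open Classical in
/-- Undo a step that was made in the state `e.1` with result `e.2`. -/
noncomputable def undo (f : ℕ) (e : S × Option Bool) (d : Conf S) : Option (Conf S) :=
  if M.next e.1 e.2 = d.s then
    match M.instr e.1, e.2 with
    | .push i b, none =>
      if (d.get i).head? = some b then some { d.set i (d.get i).tail with s := e.1 } else none
    | .pop i, none => if (d.get i).head? = none then some { d with s := e.1 } else none
    | .pop i, some b =>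
      if d.space < f then some { d.set i (b :: d.get i) with s := e.1 } else none
    | .read, none => if d.pr.head? = none then some { d with s := e.1 } else none
    | .read, some b =>
      if d.pd.head? = some b then some { d with s := e.1, pd := d.pd.tail, pr := b :: d.pr }
      else none
    | .out _, none => some { d with s := e.1 }
    | _, _ => none
  else none

theorem space_le_of_step {f : ℕ} {c d : Conf S} (hc : c.space ≤ f) (h : M.step f c = some d) :
    d.space ≤ f := by
  unfold step at h
  split at h
  · rename_i i b _
    split_ifs at h with hs
    cases h
    cases i <;> simp [Conf.set, Conf.get, Conf.space] at * <;> omega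
  · rename_i i _
    cases h
    cases i <;> simp [Conf.set, Conf.get, Conf.space] at * <;> omega
  · cases h; exact hc
  · cases h; exact hc
  · cases h

/-- The old state and the popped or read bit are all the information that an instruction destroys.
The space has to be checked only when a popped bit is restored; undoing a push frees a cell, and
this shows that the push was allowed. -/
theorem undo_iff {f : ℕ} {e : S × Option Bool} {c d : Conf S} (hd : d.space ≤ f) :
    M.undo f e d = some c ↔ c.space ≤ f ∧ M.step f c = some d ∧ (c.s, M.res c) = e := by
  constructor
  · intro h
    obtain ⟨q, r⟩ := e
    unfold undo at h
    by_cases hn : M.next q r = d.s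
    swap
    · rw [if_neg hn] at h; cases h
    rw [if_pos hn] at h
    dsimp only at h
    split at h
    · rename_i i b hi
      split_ifs at h with hb
      cases h
      obtain ⟨s, a, b, pd, pr⟩ := d
      subst hn
      cases i
      all_goals
        simp only [Conf.get] at hb
        obtain ⟨t, ht⟩ := List.head?_eq_some_iff.1 hb
        subst ht
        simp [step, res, hi, Conf.get, Conf.set, Conf.space] at hd ⊢
        exact ⟨by omega, if_pos (by omega)⟩
    · rename_i i hi
      split_ifs at h with hb
      cases h
      obtain ⟨s, a, b, pd, pr⟩ := d
      subst hn
      cases i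
      all_goals
        simp only [Conf.get, List.head?_eq_none_iff] at hb
        subst hb
        simp [step, res, hi, Conf.get, Conf.set, Conf.space] at hd ⊢
        omega
    · rename_i i b hi
      split_ifs at h with hb
      cases h
      obtain ⟨s, a, b, pd, pr⟩ := d
      subst hn
      cases i
      all_goals
        simp [step, res, hi, Conf.get, Conf.set, Conf.space] at hb ⊢
        omega
    · rename_i hi
      split_ifs at h with hb
      cases h
      obtain ⟨s, a, b, pd, pr⟩ := d
      subst hn
      simp only [List.head?_eq_none_iff] at hb
      subst hb
      simp [step, res, hi, Conf.space] at hd ⊢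
      omega
    · rename_i b hi
      split_ifs at h with hb
      cases h
      obtain ⟨s, a, b, pd, pr⟩ := d
      subst hn
      obtain ⟨t, ht⟩ := List.head?_eq_some_iff.1 hb
      simp only at ht
      subst ht
      simp [step, res, hi, Conf.space] at hd ⊢
      omega
    · rename_i hi
      cases h
      obtain ⟨s, a, b, pd, pr⟩ := d
      subst hn
      simp [step, res, hi, Conf.space] at hd ⊢
      omega
    · cases h
  · rintro ⟨hc, h, rfl⟩
    obtain ⟨s, a, b, pd, pr⟩ := c
    unfold step at h
    split at h
    · rename_i i b' hi
      split_ifs at h with hs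
      cases h
      dsimp only at hi
      cases i <;> simp [undo, res, hi, Conf.get, Conf.set]
    · rename_i i hi
      cases h
      dsimp only at hi
      cases i
      · cases b <;> simp [undo, res, hi, Conf.get, Conf.set, Conf.space] at hc ⊢
        exact if_pos (by omega)
      · cases a <;> simp [undo, res, hi, Conf.get, Conf.set, Conf.space] at hc ⊢
        exact if_pos (by omega)
    · rename_i hi
      cases h
      dsimp only at hi
      cases pr <;> simp [undo, res, hi]
    · rename_i o hi
      cases h
      dsimp only at hi
      simp [undo, res, hi]
    · cases h

theorem program_of_step {f : ℕ} {c d : Conf S} (h : M.step f c = some d) :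
    d.pd.reverse ++ d.pr = c.pd.reverse ++ c.pr := by
  unfold step at h
  split at h
  · rename_i i b _
    split_ifs at h with hs
    cases h
    cases i <;> rfl
  · rename_i i _
    cases h
    cases i <;> rfl
  · cases h
    obtain ⟨s, a, b, pd, pr⟩ := c
    cases pr <;> simp
  · cases h; rfl
  · cases h

/-- The configurations with a given program and bounded space. -/
def Valid (f : ℕ) (p : List Bool) (c : Conf S) : Prop :=
  c.space ≤ f ∧ c.pd.reverse ++ c.pr = p

theorem finite_valid [Finite S] (f : ℕ) (p : List Bool) : {c : Conf S | Valid f p c}.Finite := by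
  have h1 := List.finite_length_le Bool f
  have h2 := List.finite_length_le Bool p.length
  refine Set.Finite.of_finite_image (f := fun c : Conf S => (c.s, c.a, c.b, c.pd, c.pr)) ?_ ?_
  · refine (Set.finite_univ.prod (h1.prod (h1.prod (h2.prod h2)))).subset ?_
    rintro _ ⟨c, ⟨hs, rfl⟩, rfl⟩
    simp [Conf.space] at hs ⊢
    omega
  · rintro ⟨⟩ _ ⟨⟩ _ h
    simp at h
    simp [h]

/-- The configuration graph for a given program and space bound. -/
noncomputable def system [Finite S] (f : ℕ) (p : List Bool) :
    LabeledSystem (Conf S) (Nat.card (S × Option Bool)) where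
  fwd := M.step f
  label c := Finite.equivFin _ (c.s, M.res c)
  bwd i d := M.undo f ((Finite.equivFin _).symm i) d
  valid := Valid f p
  finite_valid := finite_valid f p
  valid_fwd hc h := ⟨M.space_le_of_step hc.1 h, (M.program_of_step h).trans hc.2⟩
  bwd_iff {i c d} hd := by
    rw [M.undo_iff hd.1, Equiv.eq_symm_apply]
    constructor
    · rintro ⟨h1, h2, h3⟩
      exact ⟨⟨h1, (M.program_of_step h2).symm.trans hd.2⟩, h2, h3⟩
    · rintro ⟨h1, h2, h3⟩
      exact ⟨h1.1, h2, h3⟩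

/-- A computation and its output. -/
inductive Path (f : ℕ) : Conf S → List Bool → Conf S → Prop
  | nil (c : Conf S) : Path f c [] c
  | cons {c d e : Conf S} {l : List Bool} : M.step f c = some d → Path f d l e →
      Path f c (M.emit c ++ l) e

variable {M}

theorem Path.trans {f : ℕ} {c d e : Conf S} {l m : List Bool} (h : M.Path f c l d)
    (h' : M.Path f d m e) : M.Path f c (l ++ m) e := by
  induction h with
  | nil => exact h'
  | cons hs _ ih => rw [List.append_assoc]; exact .cons hs (ih h')

theorem Path.single {f : ℕ} {c d : Conf S} (h : M.step f c = some d) :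
    M.Path f c (M.emit c) d := by
  simpa using Path.cons h (.nil d)

theorem step_mono {f g : ℕ} (hfg : f ≤ g) {c d : Conf S} (h : M.step f c = some d) :
    M.step g c = some d := by
  unfold step at h ⊢
  split at h
  · rename_i hi
    split_ifs at h with hs
    simp only
    rw [if_pos (by omega)]
    exact h
  all_goals exact h

theorem Path.mono {f g : ℕ} (hfg : f ≤ g) {c d : Conf S} {l : List Bool} (h : M.Path f c l d) :
    M.Path g c l d := by
  induction h with
  | nil => exact .nil _
  | cons hs _ ih => exact .cons (step_mono hfg hs) ih

theorem step_of_halt {f : ℕ} {c : Conf S} (h : M.instr c.s = .halt) : M.step f c = none := by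
  simp [step, h]

theorem Path.unique {f : ℕ} {c d e : Conf S} {l m : List Bool} (h : M.Path f c l d)
    (h' : M.Path f c m e) (hd : M.step f d = none) (he : M.step f e = none) : l = m ∧ d = e := by
  induction h generalizing m with
  | nil c =>
    cases h' with
    | nil => exact ⟨rfl, rfl⟩
    | cons hs _ => simp [hd] at hs
  | cons hs _ ih =>
    cases h' with
    | nil => simp [he] at hs
    | cons hs' h' =>
      rw [hs, Option.some.injEq] at hs'
      subst hs'
      obtain ⟨rfl, rfl⟩ := ih h' hd
      exact ⟨rfl, rfl⟩

theorem Path.reach [Finite S] {f : ℕ} {p : List Bool} {c d : Conf S} {l : List Bool}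
    (h : M.Path f c l d) : (M.system f p).Reach c d := by
  induction h with
  | nil => exact .refl
  | cons hs _ ih => exact .head hs ih

theorem exists_path [Finite S] {f : ℕ} {p : List Bool} {c d : Conf S}
    (h : (M.system f p).Reach c d) : ∃ l, M.Path f c l d := by
  induction h using Relation.ReflTransGen.head_induction_on with
  | refl => exact ⟨[], .nil _⟩
  | head hs _ ih =>
    obtain ⟨l, hl⟩ := ih
    exact ⟨_, .cons hs hl⟩

variable (M)

/-- The machine halts on the program `p` in space `f` with output `z`. -/
def Outputs (f : ℕ) (p z : List Bool) : Prop :=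
  ∃ d, M.Path f (.initial M.start p) z d ∧ M.instr d.s = .halt

variable {M}

theorem Outputs.mono {f g : ℕ} (hfg : f ≤ g) {p z : List Bool} (h : M.Outputs f p z) :
    M.Outputs g p z := by
  obtain ⟨d, h1, h2⟩ := h
  exact ⟨d, h1.mono hfg, h2⟩

/-- Both computations are possible under the larger of the two bounds, where determinism applies.
Enlarging the bound thus never changes an output. -/
theorem Outputs.unique {f g : ℕ} {p z z' : List Bool} (h : M.Outputs f p z)
    (h' : M.Outputs g p z') : z = z' := by
  obtain ⟨d, h1, h2⟩ := h.mono (le_max_left f g)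
  obtain ⟨d', h1', h2'⟩ := h'.mono (le_max_right f g)
  exact (h1.unique h1' (step_of_halt h2) (step_of_halt h2')).1

end Micro

/-! ### Every machine can be brought to this form -/

inductive Phase where
  | popLeft | popRight | read | act | left₁ | left₂ | right₁ | right₂

instance : Finite Phase := by
  refine Finite.of_injective (β := Fin 8) (fun
    | .popLeft => 0 | .popRight => 1 | .read => 2 | .act => 3
    | .left₁ => 4 | .left₂ => 5 | .right₁ => 6 | .right₂ => 7) ?_
  intro a b h
  cases a <;> cases b <;> first | rfl | (exfalso; revert h; decide)

/-- States of the machine that simulates one step of `V` in several steps: the state of `V`, the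
symbol on the program tape if it has been read in advance, and the view of the heads. -/
structure SimState (V : StackMachine) where
  phase : Phase
  q : V.Q
  ahead : Option (Option Bool)
  u : Option Bool
  v : Option Bool
  a : Option Bool

instance (V : StackMachine) : Finite (SimState V) := by
  have := V.finite
  refine Finite.of_injective
    (β := Phase × V.Q × Option (Option Bool) × Option Bool × Option Bool × Option Bool)
    (fun s => (s.phase, s.q, s.ahead, s.u, s.v, s.a)) ?_
  rintro ⟨⟩ ⟨⟩ h
  simpa using h

/-- The symbol that has to be pushed back after the top `u` of a stack has been popped. -/
def _root_.StackOp.first : StackOp → Option Bool → Option Bool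
  | .pop, _ => none
  | _, u => u

def _root_.StackOp.second : StackOp → Option Bool
  | .push b => some b
  | _ => none

theorem _root_.StackOp.apply_eq (o : StackOp) (l : List Bool) :
    o.apply l = o.second.toList ++ ((o.first l.head?).toList ++ l.tail) := by
  cases o <;> cases l <;> rfl

def Instr.pushOpt (i : Bool) : Option Bool → Instr
  | some b => .push i b
  | none => .out none

namespace SimState

variable {V : StackMachine}

/-- The head on the condition tape sees the end marker, because only computations with empty
condition are simulated. -/
def action (s : SimState V) : Option (StepAction V.Q) := V.δ s.q s.a none s.u s.v

/-- Both tops are popped first and pushed back unless the action of `V` removes them, so each phase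
concerns one stack or tape. A read always advances the head; a symbol that `V` does not consume is
kept in `ahead` for the next round. -/
def instr (s : SimState V) : Instr :=
  match s.phase with
  | .popLeft => .pop true
  | .popRight => .pop false
  | .read => if s.ahead.isNone then .read else .out none
  | .act => s.action.elim .halt fun r => .out r.out
  | .left₁ => .pushOpt true (s.action.bind fun r => r.opLeft.first s.u)
  | .left₂ => .pushOpt true (s.action.bind fun r => r.opLeft.second)
  | .right₁ => .pushOpt false (s.action.bind fun r => r.opRight.first s.v)
  | .right₂ => .pushOpt false (s.action.bind fun r => r.opRight.second)

def next (s : SimState V) (r : Option Bool) : SimState V :=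
  match s.phase with
  | .popLeft => { s with phase := .popRight, u := r }
  | .popRight => { s with phase := .read, v := r }
  | .read => { s with phase := .act, a := s.ahead.getD r }
  | .act => { s with phase := .left₁ }
  | .left₁ => { s with phase := .left₂ }
  | .left₂ => { s with phase := .right₁ }
  | .right₁ => { s with phase := .right₂ }
  | .right₂ => s.action.elim s fun r =>
    { s with phase := .popLeft, q := r.next, ahead := if r.advProg then none else some s.a }

end SimState

/-- The machine that simulates `V` with empty condition. -/
def sim (V : StackMachine) : Micro (SimState V) where
  start := ⟨.popLeft, V.start, none, none, none, none⟩
  instr := SimState.instr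
  next := SimState.next

/-- The configuration `m` of the simulating machine corresponds to the configuration `c`. -/
structure Represents {V : StackMachine} (c : V.Cfg) (m : Conf (SimState V)) : Prop where
  phase : m.s.phase = .popLeft
  state : m.s.q = c.state
  left : m.a = c.left
  right : m.b = c.right
  cond : c.cond = []
  prog : (m.s.ahead = none ∧ m.pr = c.prog) ∨ (m.s.ahead = some c.prog.head? ∧ m.pr = c.prog.tail)

theorem path_pushOpt {S : Type} {M : Micro S} {f : ℕ} {c : Conf S} {i : Bool} {o : Option Bool}
    (hi : M.instr c.s = .pushOpt i o) (hc : c.space + 1 ≤ f) :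
    M.Path f c [] { c.set i (o.toList ++ c.get i) with s := M.next c.s none } := by
  have h : M.step f c = some { c.set i (o.toList ++ c.get i) with s := M.next c.s none } := by
    cases o with
    | none => cases i <;> simp [Micro.step, hi, Instr.pushOpt, Conf.set, Conf.get]
    | some b =>
      simp [Micro.step, hi, Instr.pushOpt]
      omega
  have := Micro.Path.single h
  have he : M.emit c = [] := by
    cases o <;> simp [Micro.emit, hi, Instr.pushOpt]
  rwa [he] at this

/-- The first steps of the simulation collect the view of the heads. -/
theorem Represents.exists_act {V : StackMachine} {c : V.Cfg} {m : Conf (SimState V)}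
    (h : Represents c m) (f : ℕ) : ∃ pd ahead, (sim V).Path f m []
      ⟨⟨.act, c.state, ahead, c.left.head?, c.right.head?, c.prog.head?⟩, c.left.tail,
        c.right.tail, pd, c.prog.tail⟩ := by
  obtain ⟨⟨ph, q, ahead, u, v, a⟩, A, B, pd, pr⟩ := m
  obtain ⟨h1, h2, h3, h4, h5, h6⟩ := h
  simp only at h1 h2 h3 h4 h6
  subst h1 h2 h3 h4
  have e1 : (sim V).Path f ⟨⟨.popLeft, c.state, ahead, u, v, a⟩, c.left, c.right, pd, pr⟩ []
      ⟨⟨.popRight, c.state, ahead, c.left.head?, v, a⟩, c.left.tail, c.right, pd, pr⟩ :=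
    Micro.Path.single rfl
  have e2 : (sim V).Path f
      ⟨⟨.popRight, c.state, ahead, c.left.head?, v, a⟩, c.left.tail, c.right, pd, pr⟩ []
      ⟨⟨.read, c.state, ahead, c.left.head?, c.right.head?, a⟩, c.left.tail, c.right.tail, pd,
        pr⟩ :=
    Micro.Path.single rfl
  rcases h6 with ⟨rfl, rfl⟩ | ⟨rfl, rfl⟩
  · exact ⟨_, _, (e1.trans e2).trans (Micro.Path.single rfl)⟩
  · exact ⟨_, _, (e1.trans e2).trans (Micro.Path.single rfl)⟩

/-- Before the last push the stacks hold at most `s + 1` cells, and `path_pushOpt` asks for one more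
free cell even if nothing is pushed; hence `s + 2`. -/
theorem Represents.exists_path {V : StackMachine} {s f : ℕ} {c d : V.Cfg} {m : Conf (SimState V)}
    (h : Represents c m) (hs : s + 2 ≤ f) (hc : c.space ≤ s) (hd : V.StepWithin s c d) :
    ∃ m' l, (sim V).Path f m l m' ∧ Represents d m' ∧ d.out = c.out ++ l := by
  obtain ⟨pd, ahead, h0⟩ := h.exists_act f
  obtain ⟨hstep, hds⟩ := hd
  unfold StackMachine.step at hstep
  rw [h.cond, Option.map_eq_some_iff] at hstep
  obtain ⟨r, hr, rfl⟩ := hstep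
  have hact : ∀ ph, (SimState.mk ph c.state ahead c.left.head? c.right.head?
    c.prog.head? : SimState V).action = some r := fun ph => hr
  have e1 : (sim V).Path f
      ⟨⟨.act, c.state, ahead, c.left.head?, c.right.head?, c.prog.head?⟩, c.left.tail,
        c.right.tail, pd, c.prog.tail⟩ r.out.toList
      ⟨⟨.left₁, c.state, ahead, c.left.head?, c.right.head?, c.prog.head?⟩, c.left.tail,
        c.right.tail, pd, c.prog.tail⟩ := by
    have := Micro.Path.single (M := sim V) (f := f)
      (c := ⟨⟨.act, c.state, ahead, c.left.head?, c.right.head?, c.prog.head?⟩, c.left.tail,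
        c.right.tail, pd, c.prog.tail⟩)
      (d := ⟨⟨.left₁, c.state, ahead, c.left.head?, c.right.head?, c.prog.head?⟩, c.left.tail,
        c.right.tail, pd, c.prog.tail⟩)
      (by simp [Micro.step, sim, SimState.instr, hact, SimState.next])
    simpa [Micro.emit, sim, SimState.instr, hact] using this
  have hL := r.opLeft.apply_eq c.left
  have hR := r.opRight.apply_eq c.right
  have hle1 : (r.opLeft.first c.left.head?).toList.length + c.left.tail.length ≤ c.left.length := by
    cases c.left <;> cases r.opLeft <;> simp [StackOp.first, add_comm]
  have hle2 : (r.opRight.first c.right.head?).toList.length + c.right.tail.length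
      ≤ c.right.length := by
    cases c.right <;> cases r.opRight <;> simp [StackOp.first, add_comm]
  have ho : ∀ o : Option Bool, o.toList.length ≤ 1 := by rintro (_ | _) <;> simp
  have hle3 := ho r.opLeft.second
  simp only [Cfg.space] at hc
  have e2 := path_pushOpt (M := sim V) (f := f) (i := true) (o := r.opLeft.first c.left.head?)
    (c := ⟨⟨.left₁, c.state, ahead, c.left.head?, c.right.head?, c.prog.head?⟩, c.left.tail,
        c.right.tail, pd, c.prog.tail⟩) (by simp [sim, SimState.instr, hact])
    (by simp only [Conf.space]; omega)
  simp only [Conf.set, Conf.get, sim, SimState.next] at e2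
  have e3 := path_pushOpt (M := sim V) (f := f) (i := true) (o := r.opLeft.second)
    (c := ⟨⟨.left₂, c.state, ahead, c.left.head?, c.right.head?, c.prog.head?⟩,
        (r.opLeft.first c.left.head?).toList ++ c.left.tail,
        c.right.tail, pd, c.prog.tail⟩) (by simp [sim, SimState.instr, hact])
    (by simp only [Conf.space, List.length_append]; omega)
  simp only [Conf.set, Conf.get, sim, SimState.next, ← hL] at e3
  have e4 := path_pushOpt (M := sim V) (f := f) (i := false) (o := r.opRight.first c.right.head?)
    (c := ⟨⟨.right₁, c.state, ahead, c.left.head?, c.right.head?, c.prog.head?⟩,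
        r.opLeft.apply c.left,
        c.right.tail, pd, c.prog.tail⟩) (by simp [sim, SimState.instr, hact])
    (by simp only [Conf.space, hL, List.length_append]; omega)
  simp only [Conf.set, Conf.get, sim, SimState.next] at e4
  have e5 := path_pushOpt (M := sim V) (f := f) (i := false) (o := r.opRight.second)
    (c := ⟨⟨.right₂, c.state, ahead, c.left.head?, c.right.head?, c.prog.head?⟩,
        r.opLeft.apply c.left,
        (r.opRight.first c.right.head?).toList ++ c.right.tail, pd, c.prog.tail⟩)
        (by simp [sim, SimState.instr, hact])
    (by simp only [Conf.space, hL, List.length_append]; omega)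
  simp only [Conf.set, Conf.get, sim, SimState.next, ← hR, hact, Option.elim_some] at e5
  refine ⟨_, _, h0.trans (e1.trans (e2.trans (e3.trans (e4.trans e5)))), ?_, by simp⟩
  refine ⟨rfl, rfl, rfl, rfl, ?_, ?_⟩
  · simp
  · by_cases hp : r.advProg <;> simp [hp]

theorem Produces.outputs_sim {V : StackMachine} {s : ℕ} {p z : List Bool}
    (h : V.Produces s p [] z) : (sim V).Outputs (s + 2) p z := by
  obtain ⟨d, hd, hhalt, rfl⟩ := h
  have key : d.space ≤ s ∧ ∃ m, (sim V).Path (s + 2) (.initial (sim V).start p) d.out m ∧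
      Represents d m := by
    clear hhalt
    induction hd with
    | refl => exact ⟨by simp [init, Cfg.space], _, .nil _, rfl, rfl, rfl, rfl, rfl, .inl ⟨rfl, rfl⟩⟩
    | @tail c d _ hcd ih =>
      obtain ⟨hc, m, hm, hrep⟩ := ih
      obtain ⟨m', l, hl, hrep', ho⟩ := hrep.exists_path le_rfl hc hcd
      exact ⟨hcd.2, m', by rw [ho]; exact hm.trans hl, hrep'⟩
  obtain ⟨-, m, hm, hrep⟩ := key
  obtain ⟨pd, ahead, h0⟩ := hrep.exists_act (s + 2)
  refine ⟨_, by simpa using hm.trans h0, ?_⟩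
  unfold StackMachine.step at hhalt
  rw [hrep.cond, Option.map_eq_none_iff] at hhalt
  simp only [sim, SimState.instr, SimState.action]
  simp only [List.head?_nil] at hhalt
  rw [hhalt]
  rfl

end StackMachine

/-! ### Weakest preconditions -/

namespace StackMachine

section

variable {K : Type}

/-- The program `P`, started in `d`, terminates in space `s` with data that satisfy `Q`. -/
def Wp (s : ℕ) (P : RProg K) (Q : Data K → Prop) (d : Data K) : Prop :=
  ∃ d', RExec s P d d' ∧ Q d'

variable {s : ℕ} {P P' : RProg K} {Q : Data K → Prop} {d : Data K}

theorem wp_prim {i : Op K} : Wp s (.prim i) Q d ↔ (i.sem d).st.weight ≤ s ∧ Q (i.sem d) := by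
  constructor
  · rintro ⟨d', h, hQ⟩
    cases h with
    | prim h => exact ⟨h, hQ⟩
  · rintro ⟨h, hQ⟩
    exact ⟨_, .prim h, hQ⟩

theorem wp_seq : Wp s (.seq P P') Q d ↔ Wp s P (Wp s P' Q) d := by
  constructor
  · rintro ⟨d', h, hQ⟩
    cases h with
    | seq h1 h2 => exact ⟨_, h1, _, h2, hQ⟩
  · rintro ⟨_, h1, _, h2, hQ⟩
    exact ⟨_, .seq h1 h2, hQ⟩

theorem wp_ite {t : K → Bool} :
    Wp s (.ite t P P') Q d ↔ if t d.k then Wp s P Q d else Wp s P' Q d := by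
  constructor
  · rintro ⟨d', h, hQ⟩
    cases h with
    | iteTrue ht h => rw [if_pos ht]; exact ⟨_, h, hQ⟩
    | iteFalse ht h => simp only [ht]; exact ⟨_, h, hQ⟩
  · intro h
    cases ht : t d.k with
    | true => rw [if_pos ht] at h; obtain ⟨_, h, hQ⟩ := h; exact ⟨_, .iteTrue ht h, hQ⟩
    | false => simp only [ht] at h; obtain ⟨_, h, hQ⟩ := h; exact ⟨_, .iteFalse ht h, hQ⟩

theorem wp_loop {t : K → Bool} :
    Wp s (.loop t P) Q d ↔ if t d.k then Wp s P (Wp s (.loop t P) Q) d else Q d := by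
  constructor
  · rintro ⟨d', h, hQ⟩
    cases h with
    | loopDone ht => simp only [ht]; exact hQ
    | loopStep ht h1 h2 => rw [if_pos ht]; exact ⟨_, h1, _, h2, hQ⟩
  · intro h
    cases ht : t d.k with
    | true =>
      rw [if_pos ht] at h; obtain ⟨_, h1, _, h2, hQ⟩ := h; exact ⟨_, .loopStep ht h1 h2, hQ⟩
    | false => simp only [ht] at h; exact ⟨_, .loopDone ht, h⟩

theorem wp_ite_true {t : K → Bool} (ht : t d.k = true) (h : Wp s P Q d) :
    Wp s (.ite t P P') Q d := by
  rw [wp_ite, if_pos ht]; exact h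

theorem wp_ite_false {t : K → Bool} (ht : t d.k = false) (h : Wp s P' Q d) :
    Wp s (.ite t P P') Q d := by
  rw [wp_ite, ht]; exact h

theorem wp_loop_true {t : K → Bool} (ht : t d.k = true) (h : Wp s P (Wp s (.loop t P) Q) d) :
    Wp s (.loop t P) Q d := by
  rw [wp_loop, if_pos ht]; exact h

theorem wp_loop_false {t : K → Bool} (ht : t d.k = false) (h : Q d) : Wp s (.loop t P) Q d := by
  rw [wp_loop, ht]; exact h

end

/-! ### Basic routines -/

/-- States of the automaton that compares an output with `pairCode x _`, bit by bit. -/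
inductive Matcher where
  | even
  | odd (b : Bool)
  | sep
  | rest
  | fail

instance : Finite Matcher := by
  refine Finite.of_injective (β := Fin 6) (fun
    | .even => 0 | .odd true => 1 | .odd false => 2 | .sep => 3 | .rest => 4 | .fail => 5) ?_
  intro a b h
  rcases a with _ | (_ | _) | _ | _ | _ <;> rcases b with _ | (_ | _) | _ | _ | _ <;>
    first | rfl | (exfalso; revert h; decide)

/-- The control memory of the programs below. -/
structure Ctl (S : Type) where
  s : S
  j : Fin (Nat.card (S × Option Bool) + 1)
  up : Bool
  run : Bool
  acc : Bool
  slot : Option Bool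
  cy : Bool
  ms : Matcher
  ov : Bool

instance (S : Type) [Finite S] : Finite (Ctl S) := by
  refine Finite.of_injective (β := S × Fin (Nat.card (S × Option Bool) + 1) × Bool × Bool × Bool ×
    Option Bool × Bool × Matcher × Bool)
    (fun k => (k.s, k.j, k.up, k.run, k.acc, k.slot, k.cy, k.ms, k.ov)) ?_
  rintro ⟨⟩ ⟨⟩ h
  simpa using h

section

variable {S : Type}

def setC (f : Ctl S → Ctl S) : RProg (Ctl S) := .prim (.set f)

def nop : RProg (Ctl S) := setC id

def popS (i : Idx) : RProg (Ctl S) := .prim (.pop i fun k o => { k with slot := o })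

def pushS (i : Idx) (f : Ctl S → Bool) : RProg (Ctl S) := .prim (.push i f)

def pushSlot (i : Idx) : RProg (Ctl S) :=
  .ite (fun k => k.slot.isSome) (pushS i fun k => k.slot.getD false) nop

/-- Add or subtract one; the final carry is stored in `cy`. If `ext` is set, a new digit is appended
when there is a carry. -/
def bump (r : Reg) (b ext : Bool) : RProg (Ctl S) :=
  .seq (setC fun k => { k with cy := true })
    (.prim (.sweep r (fun k d => if k.cy then ({ k with cy := d == b }, !d) else (k, d))
      (fun k => if ext && k.cy then some true else none)))

/-- Set all bits of a register to zero. -/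
def clear (r : Reg) : RProg (Ctl S) := .prim (.sweep r (fun k _ => (k, false)) fun _ => none)

/-- Pop a bit if the top is `o`; tell in `cy` whether it was (where `none` is the bottom). -/
def expect (i : Idx) (o : Ctl S → Option Bool) : RProg (Ctl S) :=
  .seq (popS i) (.ite (fun k => k.slot == o k) (setC fun k => { k with cy := true })
    (.seq (pushSlot i) (setC fun k => { k with cy := false })))

/-- Remove all bits from `i` and do `P` for each of them. -/
def drain (i : Idx) (P : RProg (Ctl S)) : RProg (Ctl S) :=
  .seq (setC fun k => { k with run := true }) (.loop (fun k => k.run) (.seq (popS i)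
    (.ite (fun k => k.slot.isSome) P (setC fun k => { k with run := false }))))

/-- Move all bits from `i` to `j`. -/
def moveAll (i j : Idx) : RProg (Ctl S) := drain i (pushS j fun k => k.slot.getD false)

/-- The flags that are not used by the basic routines. -/
def Ctl.Same (k k' : Ctl S) : Prop := k'.acc = k.acc ∧ k'.ov = k.ov ∧ k'.ms = k.ms

theorem Ctl.Same.trans {k k' k'' : Ctl S} (h : k.Same k') (h' : k'.Same k'') : k.Same k'' :=
  ⟨h'.1.trans h.1, h'.2.1.trans h.2.1, h'.2.2.trans h.2.2⟩

variable {s : ℕ} {k : Ctl S} {st : Store} {p c o : List Bool} {Q : Data (Ctl S) → Prop}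

theorem wp_setC {f : Ctl S → Ctl S} (hw : st.weight ≤ s) (hQ : Q ⟨f k, st, p, c, o⟩) :
    Wp s (setC f) Q ⟨k, st, p, c, o⟩ := wp_prim.2 ⟨hw, hQ⟩

theorem wp_nop (hw : st.weight ≤ s) (hQ : Q ⟨k, st, p, c, o⟩) :
    Wp s nop Q ⟨k, st, p, c, o⟩ := wp_setC hw hQ

theorem weight_set_tail (i : Idx) : (st.set i (st.get i).tail).weight ≤ st.weight := by
  rcases i with _ | _ | r
  · simp [Store.set, Store.get, Store.weight]
  · simp [Store.set, Store.get, Store.weight]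
  · cases r <;> simp [Store.set, Store.get, Store.weight]

theorem weight_set_of_length {i : Idx} {l : List Bool} (h : l.length = (st.get i).length) :
    (st.set i l).weight = st.weight := by
  rcases i with _ | _ | r
  · simp [Store.set, Store.get, Store.weight] at *; omega
  · simp [Store.set, Store.get, Store.weight] at *; omega
  · cases r <;> simp [Store.set, Store.get, Store.weight] at * <;> omega

theorem wp_popS {i : Idx} (hw : st.weight ≤ s)
    (hQ : Q ⟨{ k with slot := (st.get i).head? }, st.set i (st.get i).tail, p, c, o⟩) :
    Wp s (popS i) Q ⟨k, st, p, c, o⟩ :=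
  wp_prim.2 ⟨(weight_set_tail i).trans hw, hQ⟩

theorem wp_pushS {i : Idx} {f : Ctl S → Bool} (hw : (st.set i (f k :: st.get i)).weight ≤ s)
    (hQ : Q ⟨k, st.set i (f k :: st.get i), p, c, o⟩) :
    Wp s (pushS i f) Q ⟨k, st, p, c, o⟩ :=
  wp_prim.2 ⟨hw, hQ⟩

theorem sweepList_bump (b : Bool) (k : Ctl S) (l : List Bool) :
    RawProg.sweepList (fun (k : Ctl S) d => if k.cy then ({ k with cy := d == b }, !d) else (k, d))
      k l = ({ k with cy := (bumpList b k.cy l).1 }, (bumpList b k.cy l).2) := by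
  induction l generalizing k with
  | nil => rfl
  | cons d l ih =>
    by_cases h : k.cy
    · simp [RawProg.sweepList, bumpList, h, ih]
    · simp [RawProg.sweepList, bumpList, h, ih]

theorem length_bumpList (b c : Bool) (l : List Bool) : (bumpList b c l).2.length = l.length := by
  induction l generalizing c with
  | nil => rfl
  | cons d l ih => cases c <;> simp [bumpList, ih]

theorem wp_bump {r : Reg} {b : Bool} (hw : st.weight ≤ s)
    (hQ : Q ⟨{ k with cy := (bumpList b true (st.get (.reg r))).1 },
      st.set (.reg r) (bumpList b true (st.get (.reg r))).2, p, c, o⟩) :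
    Wp s (bump r b false) Q ⟨k, st, p, c, o⟩ := by
  refine wp_seq.2 (wp_setC hw (wp_prim.2 ?_))
  simp only [Op.sem, sweepList_bump, Bool.false_and, Bool.false_eq_true, if_false,
    Option.toList_none, List.append_nil]
  exact ⟨(weight_set_of_length (length_bumpList _ _ _)).trans_le hw, hQ⟩

/-- Increment, with a new digit in case of an overflow. -/
theorem wp_bump_ext {r : Reg} {l l' : List Bool} {cy : Bool} (hl : bumpList true true (st.get (.reg r)) = (cy, l))
    (hl' : l' = if cy then l ++ [true] else l)
    (hw : (st.set (.reg r) l').weight ≤ s) (hw' : st.weight ≤ s)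
    (hQ : Q ⟨{ k with cy := cy }, st.set (.reg r) l', p, c, o⟩) :
    Wp s (bump r true true) Q ⟨k, st, p, c, o⟩ := by
  refine wp_seq.2 (wp_setC hw' (wp_prim.2 ?_))
  simp only [Op.sem, sweepList_bump, Bool.true_and, hl]
  subst hl'
  cases cy
  · simpa using ⟨hw, hQ⟩
  · exact ⟨hw, hQ⟩

theorem sweepList_clear (k : Ctl S) (l : List Bool) :
    RawProg.sweepList (fun (k : Ctl S) _ => (k, false)) k l =
      (k, List.replicate l.length false) := by
  induction l with
  | nil => rfl
  | cons d l ih => simp [RawProg.sweepList, ih, List.replicate_succ]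

theorem wp_clear {r : Reg} (hw : st.weight ≤ s)
    (hQ : Q ⟨k, st.set (.reg r) (bits (st.get (.reg r)).length 0), p, c, o⟩) :
    Wp s (clear r) Q ⟨k, st, p, c, o⟩ := by
  refine wp_prim.2 ?_
  simp only [Op.sem, sweepList_clear, Option.toList_none, List.append_nil, ← bits_zero]
  exact ⟨(weight_set_of_length (by simp)).trans_le hw, hQ⟩

theorem wp_pushSlot {i : Idx} {r : Option Bool} (hr : k.slot = r)
    (hw : (st.set i (r.toList ++ st.get i)).weight ≤ s)
    (hQ : Q ⟨k, st.set i (r.toList ++ st.get i), p, c, o⟩) :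
    Wp s (pushSlot i) Q ⟨k, st, p, c, o⟩ := by
  cases r with
  | none =>
    simp only [Option.toList_none, List.nil_append, Store.set_get] at hw hQ
    exact wp_ite_false (by simp [hr]) (wp_nop hw hQ)
  | some b => exact wp_ite_true (by simp [hr]) (wp_pushS (by simpa [hr] using hw) (by simpa [hr] using hQ))

theorem Store.set_set (i : Idx) (l m : List Bool) : (st.set i l).set i m = st.set i m := by
  rcases i with _ | _ | r
  · rfl
  · rfl
  · cases r <;> rfl

theorem Store.get_set (i : Idx) (l : List Bool) : (st.set i l).get i = l := by
  rcases i with _ | _ | r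
  · rfl
  · rfl
  · cases r <;> rfl

theorem wp_expect {i : Idx} {f : Ctl S → Option Bool} {r : Option Bool}
    (hf : ∀ x, f { k with slot := x } = r) (hw : st.weight ≤ s)
    (h1 : (st.get i).head? = r →
      Q ⟨{ k with slot := r, cy := true }, st.set i (st.get i).tail, p, c, o⟩)
    (h2 : (st.get i).head? ≠ r → ∀ x, Q ⟨{ k with slot := x, cy := false }, st, p, c, o⟩) :
    Wp s (expect i f) Q ⟨k, st, p, c, o⟩ := by
  refine wp_seq.2 (wp_popS hw ?_)
  by_cases h : (st.get i).head? = r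
  · refine wp_ite_true (by simp [hf, h]) (wp_setC ((weight_set_tail i).trans hw) ?_)
    have := h1 h
    rw [← h] at this
    exact this
  · have e : (st.set i (st.get i).tail).set i
        ((st.get i).head?.toList ++ (st.set i (st.get i).tail).get i) = st := by
      rw [Store.get_set, Store.set_set]
      conv_rhs => rw [← Store.set_get st i]
      congr 1
      cases st.get i <;> rfl
    refine wp_ite_false (by simp [hf, h]) (wp_seq.2 (wp_pushSlot rfl ?_ ?_))
    · rw [e]; exact hw
    · rw [e]; exact wp_setC hw (h2 h _)

/-- The routine `drain`, where `T l` and `O l` describe the registers and the output at the time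
when `l` is left. -/
theorem wp_drain {i : Idx} {P : RProg (Ctl S)} (T : List Bool → Store) (O : List Bool → List Bool)
    (hT : ∀ l, (T l).get i = l) (l : List Bool)
    (hw : ∀ m, m <:+ l → (T m).weight ≤ s)
    (hP : ∀ b m k Q, (b :: m) <:+ l → k.run = true → k.slot = some b →
      (∀ k', k.Same k' → k'.run = true → Q ⟨k', T m, p, c, O m⟩) →
      Wp s P Q ⟨k, (T (b :: m)).set i m, p, c, O (b :: m)⟩)
    (hQ : ∀ k', k.Same k' → Q ⟨k', T [], p, c, O []⟩) :
    Wp s (drain i P) Q ⟨k, T l, p, c, O l⟩ := by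
  refine wp_seq.2 (wp_setC (hw l (List.suffix_refl l)) ?_)
  have key : ∀ (m : List Bool) (k' : Ctl S), m <:+ l → k.Same k' → k'.run = true →
      Wp s (.loop (fun k => k.run) (.seq (popS i)
        (.ite (fun k => k.slot.isSome) P (setC fun k => { k with run := false }))))
        Q ⟨k', T m, p, c, O m⟩ := by
    intro m
    induction m with
    | nil =>
      intro k' hm hs hr
      refine wp_loop_true hr (wp_seq.2 (wp_popS (hw _ hm) ?_))
      refine wp_ite_false (by simp [hT]) ?_
      have e : (T []).set i ((T []).get i).tail = T [] := by
        conv_rhs => rw [← Store.set_get (T []) i]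
        rw [hT]; rfl
      rw [e]
      exact wp_setC (hw _ hm) (wp_loop_false rfl (hQ _ hs))
    | cons b m ih =>
      intro k' hm hs hr
      refine wp_loop_true hr (wp_seq.2 (wp_popS (hw _ hm) ?_))
      refine wp_ite_true (by simp [hT]) ?_
      rw [hT]
      refine hP b m _ _ hm hr rfl fun k'' h1 h2 => ih k'' ?_ (hs.trans h1) h2
      exact (List.suffix_cons b m).trans hm
  exact key l _ (List.suffix_refl l) ⟨rfl, rfl, rfl⟩ rfl

end

end StackMachine

/-! ### Simulation of single steps -/

namespace StackMachine

section

variable {K α : Type}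

open Classical in
/-- Continue with the program `P a`, where `a` is the current value of `t`, provided that it occurs
in the list. -/
noncomputable def dispatchList (t : K → α) (P : α → RProg K) : List α → RProg K
  | [] => .prim (.set id)
  | a :: l => .ite (fun k => decide (t k = a)) (P a) (dispatchList t P l)

/-- Continue with the program `P a`, where `a` is the current value of `t`. -/
noncomputable def dispatch [Finite α] (t : K → α) (P : α → RProg K) : RProg K :=
  dispatchList t P (Set.finite_univ (α := α)).toFinset.toList

theorem wp_dispatch [Finite α] {s : ℕ} {t : K → α} {P : α → RProg K} {Q : Data K → Prop}
    {d : Data K} (h : Wp s (P (t d.k)) Q d) : Wp s (dispatch t P) Q d := by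
  have key : ∀ l : List α, t d.k ∈ l → Wp s (dispatchList t P l) Q d := by
    intro l
    induction l with
    | nil => simp
    | cons a l ih =>
      intro hl
      by_cases ha : t d.k = a
      · subst ha
        exact wp_ite_true (by simp) h
      · refine wp_ite_false (by simp [ha]) (ih ?_)
        rcases List.mem_cons.1 hl with h | h
        · exact absurd h ha
        · exact h
  exact key _ (by simp)

end

/-- The registers that do not change in a simulation, the space bound `f` of the simulation and the
width `w` of the register with the amount of free space. -/
structure Frame where
  xd : List Bool
  xr : List Bool
  ct : List Bool
  ix : List Bool
  f : ℕ
  w : ℕ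

def idx : Bool → Idx
  | true => .a
  | false => .b

namespace Frame

variable {S : Type}

/-- The stacks and registers in a simulation. -/
def store (F : Frame) (c : Conf S) : Store :=
  ⟨c.a, c.b, c.pd, c.pr, F.xd, F.xr, bits F.w (F.f - c.space), F.ct, F.ix⟩

theorem store_get (F : Frame) (c : Conf S) (i : Bool) : (F.store c).get (idx i) = c.get i := by
  cases i <;> rfl

/-- The memory that suffices for a simulation with a program of length `n`. -/
def bound (F : Frame) (n : ℕ) : ℕ :=
  F.f + 3 * (n + F.xd.length + F.xr.length + F.w + F.ct.length + F.ix.length)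

/-- The memory `s` suffices for a simulation with the program `p`. -/
structure Fits (F : Frame) (s : ℕ) (p : List Bool) : Prop where
  lt : F.f < 2 ^ F.w
  le : F.bound p.length ≤ s

theorem Fits.weight_le {F : Frame} {s : ℕ} {p : List Bool} (hF : F.Fits s p) {c : Conf S}
    (hc : Micro.Valid F.f p c) : (F.store c).weight ≤ s := by
  have h1 := hF.le
  have h2 := hc.1
  have h3 := congrArg List.length hc.2
  simp [Conf.space] at h2 h3
  simp [bound] at h1
  simp [Store.weight, store]
  omega

end Frame

/-! ### Arithmetic in registers and the simulation of a step -/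

section

variable {S : Type} {s : ℕ} {k : Ctl S} {st : Store} {p c o : List Bool} {Q : Data (Ctl S) → Prop}

theorem not_dvd_of_lt {w v : ℕ} (h : v + 1 < 2 ^ w) : ¬ 2 ^ w ∣ v + 1 := fun h' =>
  absurd (Nat.le_of_dvd (by omega) h') (by omega)

theorem wp_inc {r : Reg} {w v : ℕ} (hst : st.get (.reg r) = bits w v) (hw : st.weight ≤ s)
    (hQ : Q ⟨{ k with cy := decide (2 ^ w ∣ v + 1) }, st.set (.reg r) (bits w (v + 1)), p, c, o⟩) :
    Wp s (bump r true false) Q ⟨k, st, p, c, o⟩ := by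
  refine wp_bump hw ?_
  rw [hst, bumpList_true_bits]
  exact hQ

theorem wp_inc_of_lt {r : Reg} {w v : ℕ} (hst : st.get (.reg r) = bits w v) (hv : v + 1 < 2 ^ w)
    (hw : st.weight ≤ s)
    (hQ : Q ⟨{ k with cy := false }, st.set (.reg r) (bits w (v + 1)), p, c, o⟩) :
    Wp s (bump r true false) Q ⟨k, st, p, c, o⟩ :=
  wp_inc hst hw (by simpa [not_dvd_of_lt hv] using hQ)

theorem wp_dec {r : Reg} {w v : ℕ} (hst : st.get (.reg r) = bits w (v + 1)) (hv : v + 1 < 2 ^ w)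
    (hw : st.weight ≤ s)
    (hQ : Q ⟨{ k with cy := false }, st.set (.reg r) (bits w v), p, c, o⟩) :
    Wp s (bump r false false) Q ⟨k, st, p, c, o⟩ := by
  refine wp_bump hw ?_
  rw [hst, bumpList_false_bits]
  simpa [not_dvd_of_lt hv] using hQ

/-- The carry of a decrement serves as the test for zero. The register is then full of ones, and an
increment repairs it. -/
theorem wp_dec_zero {r : Reg} {w : ℕ} (hst : st.get (.reg r) = bits w 0)
    (hw : st.weight ≤ s)
    (hQ : Q ⟨{ k with cy := true }, st.set (.reg r) (bits w (2 ^ w - 1)), p, c, o⟩) :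
    Wp s (bump r false false) Q ⟨k, st, p, c, o⟩ := by
  refine wp_bump hw ?_
  rw [hst, bumpList_false_bits_zero]
  exact hQ

/-- Undo a decrement that has failed because the value was zero. -/
theorem wp_inc_restore {r : Reg} {w : ℕ} (hst : st.get (.reg r) = bits w 0)
    (hw : st.weight ≤ s) (hQ : Q ⟨{ k with cy := true }, st, p, c, o⟩) :
    Wp s (bump r true false) Q ⟨k, st.set (.reg r) (bits w (2 ^ w - 1)), p, c, o⟩ := by
  have h1 : 2 ^ w - 1 + 1 = 2 ^ w := Nat.sub_add_cancel Nat.one_le_two_pow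
  refine wp_inc (w := w) (v := 2 ^ w - 1) (Store.get_set _ _) ?_ ?_
  · rw [weight_set_of_length (by simp [hst])]; exact hw
  · rw [Store.set_set, h1, bits_pow, ← hst, Store.set_get]
    simpa using hQ

variable [Finite S] (M : Micro S)

/-- One step of the simulated machine, without the change of its state. The result of the step is
stored in `slot`; if the step is not possible then `cy` is set and nothing is changed. -/
noncomputable def stepProg : RProg (Ctl S) :=
  dispatch (fun k => k.s) fun q =>
    match M.instr q with
    | .push i b => .seq (setC fun k => { k with slot := none }) (.seq (bump .fr false false)
        (.ite (fun k => k.cy) (bump .fr true false) (pushS (idx i) fun _ => b)))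
    | .pop i => .seq (popS (idx i)) (.ite (fun k => k.slot.isSome) (bump .fr true false)
        (setC fun k => { k with cy := false }))
    | .read => .seq (popS (.reg .pr)) (.seq (pushSlot (.reg .pd))
        (setC fun k => { k with cy := false }))
    | _ => setC fun k => { k with slot := none, cy := false }

variable {M}
variable {F : Frame} {q : List Bool} {d : Conf S}

/-- Since `fr` holds the number of free cells, the guard of a push is a decrement; its carry means
that no cell is free. The change of state is left to the caller, which still needs the old state for
the label of the transition. -/
theorem wp_stepProg (hF : F.Fits s q) (hd : Micro.Valid F.f q d) (hk : k.s = d.s)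
    (hh : M.instr d.s ≠ .halt)
    (h1 : ∀ e, M.step F.f d = some e →
      Q ⟨{ k with slot := M.res d, cy := false }, F.store e, p, c, o⟩)
    (h2 : M.step F.f d = none → ∀ x, Q ⟨{ k with slot := x, cy := true }, F.store d, p, c, o⟩) :
    Wp s (stepProg M) Q ⟨k, F.store d, p, c, o⟩ := by
  have hw := hF.weight_le hd
  have hlt := hF.lt
  refine wp_dispatch ?_
  simp only [hk]
  cases hi : M.instr d.s with
  | push i b =>
    refine wp_seq.2 (wp_setC hw (wp_seq.2 ?_))
    by_cases hsp : d.space < F.f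
    · have hs : M.step F.f d = some { d.set i (b :: d.get i) with s := M.next d.s none } := by
        simp [Micro.step, hi, hsp]
      have hq := h1 _ hs
      have hw' : (F.store { d.set i (b :: d.get i) with s := M.next d.s none }).weight ≤ s :=
        hF.weight_le ⟨M.space_le_of_step hd.1 hs, (M.program_of_step hs).trans hd.2⟩
      obtain ⟨v, hv⟩ : ∃ v, F.f - d.space = v + 1 := ⟨F.f - d.space - 1, by omega⟩
      refine wp_dec (w := F.w) (v := v) (by rw [← hv]; rfl) (by omega) hw
        (wp_ite_false rfl ?_)
      have e : ((F.store d).set (.reg .fr) (bits F.w v)).set (idx i)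
          (b :: ((F.store d).set (.reg .fr) (bits F.w v)).get (idx i)) =
          F.store { d.set i (b :: d.get i) with s := M.next d.s none } := by
        have : F.f - ({ d.set i (b :: d.get i) with s := M.next d.s none } : Conf S).space = v := by
          cases i <;> simp [Conf.space, Conf.set, Conf.get] at * <;> omega
        simp only [Frame.store, this]
        cases i <;> rfl
      refine wp_pushS (by rw [e]; exact hw') ?_
      rw [e]
      simpa [Micro.res, hi] using hq
    · have hs : M.step F.f d = none := by simp [Micro.step, hi, hsp]
      have hz : (F.store d).get (.reg .fr) = bits F.w 0 := by
        have : F.f - d.space = 0 := by omega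
        simp [Frame.store, Store.get, this]
      exact wp_dec_zero hz hw (wp_ite_true rfl (wp_inc_restore hz hw (h2 hs _)))
  | pop i =>
    have hs : M.step F.f d = some
        { d.set i (d.get i).tail with s := M.next d.s (d.get i).head? } := by
      simp [Micro.step, hi]
    have hq := h1 _ hs
    refine wp_seq.2 (wp_popS hw ?_)
    rw [F.store_get]
    have hw2 := (weight_set_tail (st := F.store d) (idx i)).trans hw
    rw [F.store_get] at hw2
    cases hl : d.get i with
    | nil =>
      refine wp_ite_false rfl (wp_setC (by rwa [hl] at hw2) ?_)
      have e : (F.store d).set (idx i) [] =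
          F.store { d.set i (d.get i).tail with s := M.next d.s (d.get i).head? } := by
        cases i <;> simp [Frame.store, Conf.set, Conf.get, Store.set, idx, Conf.space] at * <;>
          simp [hl]
      simp only [List.tail_nil, List.head?_nil]
      rw [e]
      simpa [Micro.res, hi, hl] using hq
    | cons b l =>
      have hpos : F.f - d.space + 1 ≤ F.f := by
        have := hd.1
        cases i <;> simp [Conf.get, Conf.space] at * <;> simp [hl] at * <;> omega
      have e : ((F.store d).set (idx i) l).set (.reg .fr) (bits F.w (F.f - d.space + 1)) =
          F.store { d.set i (d.get i).tail with s := M.next d.s (d.get i).head? } := by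
        have : F.f - ({ d.set i (d.get i).tail with s := M.next d.s (d.get i).head? } :
            Conf S).space = F.f - d.space + 1 := by
          have := hd.1
          cases i <;> simp [Conf.space, Conf.set, Conf.get] at * <;> simp [hl] at * <;> omega
        simp only [Frame.store, this]
        cases i <;> simp [hl, Conf.set, Store.set, idx]
      refine wp_ite_true rfl (wp_inc_of_lt (w := F.w) (v := F.f - d.space) ?_ ?_ ?_ ?_)
      · cases i <;> rfl
      · omega
      · rwa [hl] at hw2
      · simp only [List.tail_cons, List.head?_cons]
        rw [e]
        simpa [Micro.res, hi, hl] using hq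
  | read =>
    have hs : M.step F.f d = some { d with
      s := M.next d.s d.pr.head?, pd := d.pr.head?.toList ++ d.pd, pr := d.pr.tail } := by
      simp [Micro.step, hi]
    have hq := h1 _ hs
    have hw' := hF.weight_le ⟨M.space_le_of_step hd.1 hs, (M.program_of_step hs).trans hd.2⟩
    refine wp_seq.2 (wp_popS hw (wp_seq.2 (wp_pushSlot rfl hw' (wp_setC hw' ?_))))
    simp only [Micro.res, hi] at hq
    exact hq
  | out x =>
    have hs : M.step F.f d = some { d with s := M.next d.s none } := by
      simp [Micro.step, hi]
    have hq := h1 _ hs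
    simp only [Micro.res, hi] at hq
    exact wp_setC hw hq
  | halt => exact absurd hi hh

/-- The label of the transition that is to be undone next. -/
noncomputable def Ctl.edge (k : Ctl S) : S × Option Bool :=
  if h : k.j.val < Nat.card (S × Option Bool) then (Finite.equivFin _).symm ⟨k.j.val, h⟩
  else (k.s, none)

variable (M) in
open Classical in
/-- Undo the transition given by the control memory, without changing the state; `cy` tells whether
this was possible. -/
noncomputable def undoProg : RProg (Ctl S) :=
  dispatch Ctl.edge fun e => .ite (fun k => decide (M.next e.1 e.2 = k.s))
    (match M.instr e.1, e.2 with
    | .push i b, none => .seq (expect (idx i) fun _ => some b) (.ite (fun k => k.cy)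
        (.seq (bump .fr true false) (setC fun k => { k with cy := true })) nop)
    | .pop i, none => expect (idx i) fun _ => none
    | .pop i, some b => .seq (bump .fr false false) (.ite (fun k => k.cy)
        (.seq (bump .fr true false) (setC fun k => { k with cy := false }))
        (.seq (pushS (idx i) fun _ => b) (setC fun k => { k with cy := true })))
    | .read, none => expect (.reg .pr) fun _ => none
    | .read, some b => .seq (expect (.reg .pd) fun _ => some b)
        (.ite (fun k => k.cy) (pushS (.reg .pr) fun _ => b) nop)
    | .out _, none => setC fun k => { k with cy := true }
    | _, _ => setC fun k => { k with cy := false })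
    (setC fun k => { k with cy := false })

/-- `expect` puts a bit back if it is not the right one, and a failed decrement of `fr` is repaired.
A failed attempt thus leaves the store unchanged, as the walk requires when it passes to the next
label. -/
theorem wp_undoProg (hF : F.Fits s q) (hd : Micro.Valid F.f q d) (hk : k.s = d.s)
    (h1 : ∀ e, M.undo F.f k.edge d = some e →
      ∀ x, Q ⟨{ k with slot := x, cy := true }, F.store e, p, c, o⟩)
    (h2 : M.undo F.f k.edge d = none →
      ∀ x, Q ⟨{ k with slot := x, cy := false }, F.store d, p, c, o⟩) :
    Wp s (undoProg M) Q ⟨k, F.store d, p, c, o⟩ := by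
  have hw := hF.weight_le hd
  have hlt := hF.lt
  have hsp := hd.1
  have hvalid : ∀ e, M.undo F.f k.edge d = some e → (F.store e).weight ≤ s := by
    intro e he
    have h := (M.undo_iff hd.1).1 he
    exact hF.weight_le ⟨h.1, (M.program_of_step h.2.1).symm.trans hd.2⟩
  refine wp_dispatch ?_
  dsimp only
  generalize k.edge = e at *
  obtain ⟨t, r⟩ := e
  dsimp only
  by_cases hn : M.next t r = d.s
  swap
  · refine wp_ite_false (by simp [hk, hn]) (wp_setC hw ?_)
    exact h2 (by simp [Micro.undo, hn]) k.slot
  refine wp_ite_true (by simp [hk, hn]) ?_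
  cases hi : M.instr t with
  | push i b =>
    cases r with
    | some r => exact wp_setC hw (h2 (by simp [Micro.undo, hi]) k.slot)
    | none =>
      simp only [Micro.undo, hn, hi, if_true] at h1 h2 hvalid ⊢
      refine wp_seq.2 (wp_expect (fun _ => rfl) hw ?_ ?_)
      · rw [F.store_get]
        intro hb
        rw [if_pos hb] at h1 hvalid
        obtain ⟨l, hl⟩ := List.head?_eq_some_iff.1 hb
        have hw2 := (weight_set_tail (st := F.store d) (idx i)).trans hw
        rw [F.store_get] at hw2
        have e : ((F.store d).set (idx i) (d.get i).tail).set (.reg .fr)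
            (bits F.w (F.f - d.space + 1)) = F.store { d.set i (d.get i).tail with s := t } := by
          have : F.f - ({ d.set i (d.get i).tail with s := t } : Conf S).space =
              F.f - d.space + 1 := by
            cases i <;> simp [Conf.space, Conf.set, Conf.get] at * <;> simp [hl] at * <;> omega
          simp only [Frame.store, this]
          cases i <;> simp [hl, Conf.set, Store.set, idx]
        have hpos : F.f - d.space + 1 ≤ F.f := by
          cases i <;> simp [Conf.get, Conf.space] at * <;> simp [hl] at * <;> omega
        refine wp_ite_true rfl (wp_seq.2 (wp_inc_of_lt (w := F.w) (v := F.f - d.space)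
          (by cases i <;> rfl) (by omega) hw2 ?_))
        rw [e]
        exact wp_setC (hvalid _ rfl) (h1 _ rfl _)
      · rw [F.store_get]
        intro hb x
        rw [if_neg hb] at h2
        exact wp_ite_false rfl (wp_nop hw (h2 rfl _))
  | pop i =>
    cases r with
    | none =>
      simp only [Micro.undo, hn, hi, if_true] at h1 h2 hvalid ⊢
      refine wp_expect (fun _ => rfl) hw ?_ ?_
      · rw [F.store_get]
        intro hb
        rw [if_pos hb] at h1
        have e : (F.store d).set (idx i) (d.get i).tail = F.store { d with s := t } := by
          rw [List.head?_eq_none_iff] at hb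
          cases i <;> simp [Frame.store, Conf.get, Store.set, idx, Conf.space] at * <;>
            simp [hb]
        rw [e]
        exact h1 _ rfl _
      · rw [F.store_get]
        intro hb
        rw [if_neg hb] at h2
        exact h2 rfl
    | some b =>
      simp only [Micro.undo, hn, hi, if_true] at h1 h2 hvalid ⊢
      refine wp_seq.2 ?_
      by_cases hs : d.space < F.f
      · rw [if_pos hs] at h1 hvalid
        obtain ⟨v, hv⟩ : ∃ v, F.f - d.space = v + 1 := ⟨F.f - d.space - 1, by omega⟩
        refine wp_dec (w := F.w) (v := v) (by rw [← hv]; rfl) (by omega) hw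
          (wp_ite_false rfl (wp_seq.2 ?_))
        have e : ((F.store d).set (.reg .fr) (bits F.w v)).set (idx i)
            (b :: ((F.store d).set (.reg .fr) (bits F.w v)).get (idx i)) =
            F.store { d.set i (b :: d.get i) with s := t } := by
          have : F.f - ({ d.set i (b :: d.get i) with s := t } : Conf S).space = v := by
            cases i <;> simp [Conf.space, Conf.set, Conf.get] at * <;> omega
          simp only [Frame.store, this]
          cases i <;> rfl
        refine wp_pushS (by rw [e]; exact hvalid _ rfl) ?_
        rw [e]
        exact wp_setC (hvalid _ rfl) (h1 _ rfl _)
      · rw [if_neg hs] at h2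
        have hz : (F.store d).get (.reg .fr) = bits F.w 0 := by
          have : F.f - d.space = 0 := by omega
          simp [Frame.store, Store.get, this]
        exact wp_dec_zero hz hw (wp_ite_true rfl (wp_seq.2 (wp_inc_restore hz hw
          (wp_setC hw (h2 rfl _)))))
  | read =>
    cases r with
    | none =>
      simp only [Micro.undo, hn, hi, if_true] at h1 h2 ⊢
      refine wp_expect (fun _ => rfl) hw ?_ ?_
      · intro hb
        have hb' : d.pr.head? = none := hb
        rw [if_pos hb'] at h1
        have e : (F.store d).set (.reg .pr) ((F.store d).get (.reg .pr)).tail =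
            F.store { d with s := t } := by
          rw [List.head?_eq_none_iff] at hb'
          simp [Frame.store, Store.get, Store.set, Conf.space, hb']
        rw [e]
        exact h1 _ rfl _
      · intro hb
        have hb' : ¬ d.pr.head? = none := hb
        rw [if_neg hb'] at h2
        exact h2 rfl
    | some b =>
      simp only [Micro.undo, hn, hi, if_true] at h1 h2 hvalid ⊢
      refine wp_seq.2 (wp_expect (fun _ => rfl) hw ?_ ?_)
      · intro hb
        have hb' : d.pd.head? = some b := hb
        rw [if_pos hb'] at h1 hvalid
        exact wp_ite_true rfl (wp_pushS (hvalid _ rfl) (h1 _ rfl _))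
      · intro hb x
        have hb' : ¬ d.pd.head? = some b := hb
        rw [if_neg hb'] at h2
        exact wp_ite_false rfl (wp_nop hw (h2 rfl _))
  | out x =>
    cases r with
    | none => exact wp_setC hw (h1 { d with s := t } (by simp [Micro.undo, hi, hn]) k.slot)
    | some r => exact wp_setC hw (h2 (by simp [Micro.undo, hi]) k.slot)
  | halt => exact wp_setC hw (h2 (by cases r <;> simp [Micro.undo, hi]) k.slot)

end

end StackMachine

/-! ### The halting test and the comparison of outputs -/

namespace StackMachine

/-- A comparison only moves bits between `xd` and `xr`, so the sum of their lengths is all that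
matters. -/
theorem Frame.Fits.with {F : Frame} {s : ℕ} {q : List Bool} (hF : F.Fits s q) {xd xr : List Bool}
    (h : xd.length + xr.length = F.xd.length + F.xr.length) :
    ({ F with xd := xd, xr := xr } : Frame).Fits s q := by
  refine ⟨hF.lt, ?_⟩
  have := hF.le
  simp only [bound] at this ⊢
  omega

section

variable {S : Type} {s : ℕ} {k : Ctl S} {st : Store} {p c o : List Bool} {Q : Data (Ctl S) → Prop}
variable [Finite S] {M : Micro S} {F : Frame} {q : List Bool} {d : Conf S}

variable (M) in
open Classical in
/-- Stop if the simulated machine is in its initial configuration. -/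
noncomputable def returnProg : RProg (Ctl S) :=
  .ite (fun k => decide (k.s = M.start)) (.seq (expect .a fun _ => none) (.ite (fun k => k.cy)
    (.seq (expect .b fun _ => none) (.ite (fun k => k.cy) (.seq (expect (.reg .pd) fun _ => none)
      (.ite (fun k => k.cy) (setC fun k => { k with run := false, acc := false }) nop)) nop)) nop))
    nop

-- Three tests for emptiness and one for the state suffice: if nothing has been read, validity
-- forces the unread part to be all of `q`.
omit [Finite S] in
theorem wp_returnProg (hF : F.Fits s q) (hd : Micro.Valid F.f q d) (hk : k.s = d.s)
    (hQ : ∀ k', k'.s = k.s → k'.up = k.up → k'.ov = k.ov →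
      (d ≠ .initial M.start q → k'.run = k.run) →
      (d = .initial M.start q → k'.run = false ∧ k'.acc = false) →
      Q ⟨k', F.store d, p, c, o⟩) :
    Wp s (returnProg M) Q ⟨k, F.store d, p, c, o⟩ := by
  have hw := hF.weight_le hd
  have hset : ∀ i, ((F.store d).get i).head? = none →
      (F.store d).set i ((F.store d).get i).tail = F.store d := by
    intro i hi
    conv_rhs => rw [← Store.set_get (F.store d) i]
    rw [List.head?_eq_none_iff] at hi
    rw [hi]; rfl
  have hne : ∀ k' : Ctl S, k'.s = k.s → k'.up = k.up → k'.ov = k.ov → k'.run = k.run →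
      d ≠ .initial M.start q → Q ⟨k', F.store d, p, c, o⟩ := fun k' h1 h2 h3 h4 h5 =>
    hQ k' h1 h2 h3 (fun _ => h4) (fun h => absurd h h5)
  by_cases hs : d.s = M.start
  swap
  · refine wp_ite_false (by simp [hk, hs]) (wp_nop hw (hne _ rfl rfl rfl rfl ?_))
    rintro rfl; exact hs rfl
  refine wp_ite_true (by simp [hk, hs]) (wp_seq.2 (wp_expect (fun _ => rfl) hw ?_ ?_))
  swap
  · intro ha x
    refine wp_ite_false rfl (wp_nop hw (hne _ rfl rfl rfl rfl ?_))
    rintro rfl; exact ha rfl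
  intro ha
  rw [hset _ ha]
  refine wp_ite_true rfl (wp_seq.2 (wp_expect (fun _ => rfl) hw ?_ ?_))
  swap
  · intro hb x
    refine wp_ite_false rfl (wp_nop hw (hne _ rfl rfl rfl rfl ?_))
    rintro rfl; exact hb rfl
  intro hb
  rw [hset _ hb]
  refine wp_ite_true rfl (wp_seq.2 (wp_expect (fun _ => rfl) hw ?_ ?_))
  swap
  · intro hp x
    refine wp_ite_false rfl (wp_nop hw (hne _ rfl rfl rfl rfl ?_))
    rintro rfl; exact hp rfl
  intro hp
  rw [hset _ hp]
  refine wp_ite_true rfl (wp_setC hw (hQ _ rfl rfl rfl (fun h => absurd ?_ h) fun _ => ⟨rfl, rfl⟩))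
  have h := hd.2
  obtain ⟨t, a, b, pd, pr⟩ := d
  have ha' : a = [] := List.head?_eq_none_iff.1 ha
  have hb' : b = [] := List.head?_eq_none_iff.1 hb
  have hp' : pd = [] := List.head?_eq_none_iff.1 hp
  subst ha' hb' hp'
  simp at h hs
  simp [Conf.initial, h, hs]

variable (M) in
open Classical in
/-- One step of the traversal of the configuration graph. -/
noncomputable def walkBody : RProg (Ctl S) :=
  .ite (fun k => k.up)
    (.ite (fun k => decide (M.instr k.s = .halt)) (setC fun k => { k with run := false, acc := true })
      (.seq (stepProg M) (.ite (fun k => k.cy) (setC fun k => { k with run := false, acc := false })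
        (setC fun k => { k with
          j := (Finite.equivFin _ (k.s, k.slot)).succ, s := M.next k.s k.slot, up := false }))))
    (.ite (fun k => decide (k.j.val < Nat.card (S × Option Bool)))
      (.seq (undoProg M) (.ite (fun k => k.cy) (setC fun k => { k with s := k.edge.1, j := 0 })
        (setC fun k => { k with
          j := if h : k.j.val < Nat.card (S × Option Bool) then Fin.succ ⟨k.j.val, h⟩ else k.j })))
      (.seq (setC fun k => { k with up := true }) (returnProg M)))

/-- The control memory describes the position of the traversal. -/
def Ctl.At (k : Ctl S) (x : Conf S × Option (Fin (Nat.card (S × Option Bool) + 1))) : Prop :=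
  k.s = x.1.s ∧ match x.2 with
    | none => k.up = true
    | some j => k.up = false ∧ k.j = j

/-- The return to the start is tested only when the labels at a configuration are exhausted, for a
position with mark `none` is entered in no other way. -/
theorem wp_walkBody {x y : Conf S × Option (Fin (Nat.card (S × Option Bool) + 1))}
    (hF : F.Fits s q) (hx : Micro.Valid F.f q x.1) (hk : k.At x)
    (hxy : (M.system F.f q).walk x = some y)
    (hQ : ∀ k', k'.At y → k'.ov = k.ov → (y ≠ (.initial M.start q, none) → k'.run = k.run) →
      (y = (.initial M.start q, none) → k'.run = false ∧ k'.acc = false) →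
      Q ⟨k', F.store y.1, p, c, o⟩) :
    Wp s (walkBody M) Q ⟨k, F.store x.1, p, c, o⟩ := by
  have hw := hF.weight_le hx
  have hy : Micro.Valid F.f q y.1 := LabeledSystem.valid_walk (L := M.system F.f q) hx hxy
  have hw' := hF.weight_le hy
  obtain ⟨d, _ | j⟩ := x
  · obtain ⟨hs, hup⟩ := hk
    simp only [LabeledSystem.walk, Option.map_eq_some_iff] at hxy
    obtain ⟨e, he, rfl⟩ := hxy
    have he' : M.step F.f d = some e := he
    have hh : M.instr d.s ≠ .halt := fun h => by simp [Micro.step_of_halt h] at he'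
    refine wp_ite_true hup (wp_ite_false ?_ (wp_seq.2 (wp_stepProg hF hx hs hh ?_ ?_)))
    · simp only at hs; simp [hs, hh]
    · intro e' hs'
      rw [he', Option.some.injEq] at hs'
      subst hs'
      refine wp_ite_false rfl (wp_setC hw' (hQ _ ⟨?_, rfl, ?_⟩ rfl (fun _ => rfl) fun h => by cases h))
      · simp only at hs ⊢
        have : e.s = M.next d.s (M.res d) := by
          unfold Micro.step at he'
          split at he'
          · rename_i hi
            split_ifs at he'
            cases he'; simp [Micro.res, hi]
          · rename_i hi; cases he'; simp [Micro.res, hi]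
          · rename_i hi; cases he'; simp [Micro.res, hi]
          · rename_i hi; cases he'; simp [Micro.res, hi]
          · cases he'
        rw [this, hs]
      · simp only at hs ⊢
        rw [hs]; rfl
    · intro h; rw [he'] at h; cases h
  · obtain ⟨hs, hup, hj⟩ := hk
    simp only at hs
    simp only [LabeledSystem.walk, Option.some.injEq] at hxy
    refine wp_ite_false hup ?_
    by_cases hlt : j.val < Nat.card (S × Option Bool)
    · rw [dif_pos hlt] at hxy
      subst hj
      have hedge : k.edge = (Finite.equivFin _).symm ⟨k.j.val, hlt⟩ := dif_pos hlt
      refine wp_ite_true (decide_eq_true hlt) (wp_seq.2 (wp_undoProg hF hx hs ?_ ?_))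
      · intro e he z
        rw [hedge] at he
        have hb : (M.system F.f q).bwd ⟨k.j.val, hlt⟩ d = some e := he
        rw [hb] at hxy
        subst hxy
        refine wp_ite_true rfl (wp_setC hw' (hQ _ ⟨?_, hup, rfl⟩ rfl (fun _ => rfl)
          fun h => by simp at h))
        have h3 := congrArg Prod.fst ((M.undo_iff hx.1).1 he).2.2
        simp only at h3
        rw [h3, ← hedge]; rfl
      · intro he z
        rw [hedge] at he
        have hb : (M.system F.f q).bwd ⟨k.j.val, hlt⟩ d = none := he
        rw [hb] at hxy
        subst hxy
        refine wp_ite_false rfl (wp_setC hw' (hQ _ ⟨hs, hup, ?_⟩ rfl (fun _ => rfl)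
          fun h => by simp at h))
        exact dif_pos hlt
    · rw [dif_neg hlt] at hxy
      subst hxy hj
      refine wp_ite_false (decide_eq_false hlt) (wp_seq.2 (wp_setC hw (wp_returnProg hF hx hs ?_)))
      intro k' h1 h2 h3 h4 h5
      exact hQ k' ⟨h1.trans hs, h2⟩ h3 (fun h => h4 (by simpa using h)) (fun h => h5 (by simpa using h))

/-- The simulated machine stops either in a halting state or at a push for which no cell is free;
only the first counts as halting. -/
theorem wp_walkBody_final (hF : F.Fits s q) (hd : Micro.Valid F.f q d) (hk : k.At (d, none))
    (hend : M.step F.f d = none)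
    (hQ : ∀ k', k'.ov = k.ov → k'.run = false → (k'.acc = true ↔ M.instr d.s = .halt) →
      Q ⟨k', F.store d, p, c, o⟩) :
    Wp s (walkBody M) Q ⟨k, F.store d, p, c, o⟩ := by
  have hw := hF.weight_le hd
  obtain ⟨hs, hup⟩ := hk
  simp only at hs
  refine wp_ite_true hup ?_
  by_cases hh : M.instr d.s = .halt
  · exact wp_ite_true (by simp [hs, hh]) (wp_setC hw (hQ _ rfl rfl (by simp [hh])))
  · refine wp_ite_false (by simp [hs, hh]) (wp_seq.2 (wp_stepProg hF hd hs hh ?_ ?_))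
    · intro e he; rw [hend] at he; cases he
    · intro _ x
      exact wp_ite_true rfl (wp_setC hw (hQ _ rfl rfl (by simp [hh])))

variable (M) in
/-- Test whether the simulated machine halts on the given program in the available space. -/
noncomputable def walkProg : RProg (Ctl S) :=
  .seq (setC fun k => { k with s := M.start, up := true, run := true })
    (.loop (fun k => k.run) (walkBody M))

omit [Finite S] in
theorem Frame.Fits.valid_initial {t : S} : Micro.Valid F.f q (Conf.initial t q) := by
  simp [Micro.Valid, Conf.initial, Conf.space]

/-- Termination comes from the length `n` provided by `walk_dichotomy`. A walk that ends without a
return has found the final configuration of the computation, where halting can be read off; a return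
shows that there is no final configuration, hence no output in space `F.f`. -/
theorem wp_walkProg (hF : F.Fits s q)
    (hQ : ∀ (k' : Ctl S) (d : Conf S), Micro.Valid F.f q d → k'.ov = k.ov → (k'.acc = true ↔ ∃ z, M.Outputs F.f q z) →
      Q ⟨k', F.store d, p, c, o⟩) :
    Wp s (walkProg M) Q ⟨k, F.store (.initial M.start q), p, c, o⟩ := by
  have hv : Micro.Valid F.f q (.initial M.start q) := Frame.Fits.valid_initial
  have hw := hF.weight_le hv
  refine wp_seq.2 (wp_setC hw ?_)
  obtain ⟨n, g, g0, hg, hne, hval, hend⟩ :=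
    LabeledSystem.walk_dichotomy (L := M.system F.f q) (c := .initial M.start q) hv
  have key : ∀ m i, i + m = n → ∀ k' : Ctl S, k'.At (g i) → k'.run = true → k'.ov = k.ov →
      (i < n ∨ ∃ d, (M.system F.f q).Reach (.initial M.start q) d ∧ M.step F.f d = none ∧
        g n = (d, none)) →
      Wp s (.loop (fun k => k.run) (walkBody M)) Q ⟨k', F.store (g i).1, p, c, o⟩ := by
    intro m
    induction m with
    | zero =>
      intro i hi k' hat hrun hov hcase
      obtain rfl : i = n := by omega
      obtain ⟨d, hreach, hd, hgn⟩ := hcase.resolve_left (lt_irrefl _)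
      rw [hgn] at hat ⊢
      have hvd := hval i le_rfl
      rw [hgn] at hvd
      refine wp_loop_true hrun (wp_walkBody_final hF hvd hat hd ?_)
      intro k'' h1 h2 h3
      refine wp_loop_false h2 (hQ _ _ hvd (h1.trans hov) (h3.trans ?_))
      obtain ⟨l, hl⟩ := Micro.exists_path hreach
      constructor
      · exact fun h => ⟨l, d, hl, h⟩
      · rintro ⟨z, d', h4, h5⟩
        have := (hl.unique h4 hd (Micro.step_of_halt h5)).2
        rwa [this]
    | succ m ih =>
      intro i hi k' hat hrun hov hcase
      refine wp_loop_true hrun (wp_walkBody hF (hval i (by omega)) hat (hg i (by omega)) ?_)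
      intro k'' h1 h2 h3 h4
      by_cases hret : g (i + 1) = (.initial M.start q, none)
      · have hlast : i + 1 = n := by
          by_contra hne'
          exact hne (i + 1) (by omega) (by omega) hret
        rcases hend with ⟨d, -, -, -, hd⟩ | ⟨hno, -, -⟩
        · exact absurd (hlast ▸ hret) (hd (by omega))
        · refine wp_loop_false (h4 hret).1 (hQ _ _ (hval _ (by omega)) (h2.trans hov) ?_)
          simp only [(h4 hret).2, Bool.false_eq_true, false_iff]
          rintro ⟨z, d, h5, h6⟩
          exact hno d h5.reach (Micro.step_of_halt h6)
      · refine ih (i + 1) (by omega) k'' h1 ((h3 hret).trans hrun) (h2.trans hov) ?_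
        rcases hend with ⟨d, h5, h6, h7, -⟩ | ⟨-, -, h7⟩
        · exact .inr ⟨d, h5, h6, h7⟩
        · left
          by_contra hlt
          obtain rfl : i + 1 = n := by omega
          exact hret h7
  have := key n 0 (by omega) { k with s := M.start, up := true, run := true }
    (by rw [g0]; exact ⟨rfl, rfl⟩) rfl rfl (by
      rcases hend with ⟨d, h5, h6, h7, -⟩ | ⟨-, h6, -⟩
      · exact .inr ⟨d, h5, h6, h7⟩
      · exact .inl h6)
  rw [g0] at this
  exact this

/-- Return to the initial configuration. -/
def cleanProg : RProg (Ctl S) :=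
  .seq (drain .a (bump .fr true false)) (.seq (drain .b (bump .fr true false))
    (moveAll (.reg .pd) (.reg .pr)))

-- No copy of the program is needed: `pd` and `pr` always make up `q`, so the initial configuration
-- can be restored from wherever the walk has stopped. Each cell removed from a stack is credited to
-- `fr`.
omit [Finite S] in
theorem wp_cleanProg (hF : F.Fits s q) (hd : Micro.Valid F.f q d) {t : S}
    (hQ : ∀ k', k.Same k' → Q ⟨k', F.store (.initial t q), p, c, o⟩) :
    Wp s cleanProg Q ⟨k, F.store d, p, c, o⟩ := by
  obtain ⟨u, a, b, pd, pr⟩ := d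
  have hsp := hd.1
  have hlt := hF.lt
  simp only [Conf.space] at hsp
  have hv1 : ∀ m, m <:+ a → Micro.Valid F.f q ⟨u, m, b, pd, pr⟩ := fun m hm =>
    ⟨by have := hm.length_le; simp only [Conf.space]; omega, hd.2⟩
  have hv2 : ∀ m, m <:+ b → Micro.Valid F.f q ⟨u, [], m, pd, pr⟩ := fun m hm =>
    ⟨by have := hm.length_le; simp [Conf.space]; omega, hd.2⟩
  have hv3 : ∀ m, m <:+ pd → Micro.Valid F.f q ⟨u, [], [], m, q.drop m.length⟩ := by
    rintro m ⟨l, rfl⟩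
    refine ⟨by simp [Conf.space], ?_⟩
    rw [← hd.2]
    simp
  refine wp_seq.2 (wp_drain (T := fun l => F.store (⟨u, l, b, pd, pr⟩ : Conf S)) (O := fun _ => o)
    (fun _ => rfl) a (fun m hm => hF.weight_le (hv1 m hm)) ?_ ?_)
  · intro x m k' Q' hm hr hsl hQ'
    have h1 := (hv1 _ hm).1
    simp only [Conf.space, List.length_cons] at h1
    have e : F.f - (m.length + 1 + b.length) + 1 = F.f - (m.length + b.length) := by omega
    refine wp_inc_of_lt (w := F.w) (v := F.f - (m.length + 1 + b.length)) rfl (by omega) ?_ ?_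
    · exact (weight_set_tail (st := F.store (⟨u, x :: m, b, pd, pr⟩ : Conf S)) .a).trans
        (hF.weight_le (hv1 _ hm))
    · rw [e]; exact hQ' _ ⟨rfl, rfl, rfl⟩ hr
  intro k1 hk1
  refine wp_seq.2 (wp_drain (T := fun l => F.store (⟨u, [], l, pd, pr⟩ : Conf S)) (O := fun _ => o)
    (fun _ => rfl) b (fun m hm => hF.weight_le (hv2 m hm)) ?_ ?_)
  · intro x m k' Q' hm hr hsl hQ'
    have h1 := (hv2 _ hm).1
    simp only [Conf.space, List.length_cons, List.length_nil] at h1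
    have e : F.f - (0 + (m.length + 1)) + 1 = F.f - (0 + m.length) := by omega
    refine wp_inc_of_lt (w := F.w) (v := F.f - (0 + (m.length + 1))) rfl (by omega) ?_ ?_
    · exact (weight_set_tail (st := F.store (⟨u, [], x :: m, pd, pr⟩ : Conf S)) .b).trans
        (hF.weight_le (hv2 _ hm))
    · rw [e]; exact hQ' _ ⟨rfl, rfl, rfl⟩ hr
  intro k2 hk2
  have hpr : pr = q.drop pd.length := by rw [← hd.2]; simp
  have hgoal : Wp s (moveAll (.reg .pd) (.reg .pr)) Q
      ⟨k2, F.store (⟨u, [], [], pd, q.drop pd.length⟩ : Conf S), p, c, o⟩ := by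
    refine wp_drain (T := fun l => F.store (⟨u, [], [], l, q.drop l.length⟩ : Conf S))
      (O := fun _ => o) (fun _ => rfl) pd (fun m hm => hF.weight_le (hv3 m hm)) ?_ ?_
    · intro x m k' Q' hm hr hsl hQ'
      have e : x :: q.drop (m.length + 1) = q.drop m.length := by
        obtain ⟨l, hl⟩ := hm
        rw [← hd.2]
        simp only
        rw [← hl]
        have e1 : (l ++ x :: m).reverse ++ pr = m.reverse ++ ([x] ++ (l.reverse ++ pr)) := by simp
        have e2 : m.length + 1 = (m.reverse ++ [x]).length := by simp
        rw [e1]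
        conv_lhs => rw [e2, ← List.append_assoc, List.drop_left]
        conv_rhs => rw [← List.length_reverse (as := m), List.drop_left]
        rfl
      have e' : ((F.store (⟨u, [], [], x :: m, q.drop (x :: m).length⟩ : Conf S)).set (.reg .pd)
          m).set (.reg .pr) (x :: q.drop (m.length + 1)) =
          F.store (⟨u, [], [], m, q.drop m.length⟩ : Conf S) := by
        rw [e]; rfl
      refine wp_pushS ?_ ?_
      · simp only [hsl, Option.getD_some]
        exact (congrArg Store.weight e').trans_le
          (hF.weight_le (hv3 m ((List.suffix_cons x m).trans hm)))
      · simp only [hsl, Option.getD_some]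
        have := hQ' k' ⟨rfl, rfl, rfl⟩ hr
        rw [← e'] at this
        exact this
    · intro k3 hk3
      exact hQ k3 (hk1.trans (hk2.trans hk3))
  rw [← hpr] at hgoal
  exact hgoal

end

end StackMachine

/-! ### Comparison of outputs with a pair code -/

namespace StackMachine

/-- The state of the comparison of an output with the code of a pair whose first component is given
by `xd.reverse ++ xr`; the second component is copied to `out`. -/
structure Observer where
  ms : Matcher
  xd : List Bool
  xr : List Bool
  out : List Bool

namespace Observer

/-- Process a bit. -/
def step (emit : Bool) (w : Observer) (b : Bool) : Observer :=
  match w.ms with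
  | .even =>
    if w.xr.head? = some b then { w with ms := .odd b, xd := b :: w.xd, xr := w.xr.tail }
    else { w with ms := if w.xr.head? = none ∧ b = false then .sep else .fail }
  | .odd b' => { w with ms := if b = b' then .even else .fail }
  | .sep => { w with ms := if b then .rest else .fail }
  | .rest => if emit then { w with out := w.out ++ [b] } else w
  | .fail => w

variable {emit : Bool}

theorem step_word (w : Observer) (b : Bool) :
    (w.step emit b).xd.reverse ++ (w.step emit b).xr = w.xd.reverse ++ w.xr := by
  obtain ⟨ms, xd, xr, o⟩ := w
  cases ms with
  | even =>
    simp only [step]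
    split_ifs with h
    · obtain ⟨r, rfl⟩ := List.head?_eq_some_iff.1 h
      simp
    all_goals rfl
  | rest => simp only [step]; split_ifs <;> rfl
  | _ => rfl

theorem foldl_word (l : List Bool) (w : Observer) :
    (l.foldl (step emit) w).xd.reverse ++ (l.foldl (step emit) w).xr = w.xd.reverse ++ w.xr := by
  induction l generalizing w with
  | nil => rfl
  | cons b l ih => rw [List.foldl_cons, ih, step_word]

theorem foldl_fail (l : List Bool) (xd xr o : List Bool) :
    l.foldl (step emit) ⟨.fail, xd, xr, o⟩ = ⟨.fail, xd, xr, o⟩ := by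
  induction l with
  | nil => rfl
  | cons b l ih => rw [List.foldl_cons]; exact ih

theorem foldl_rest (l : List Bool) (xd xr o : List Bool) :
    l.foldl (step emit) ⟨.rest, xd, xr, o⟩ = ⟨.rest, xd, xr, if emit then o ++ l else o⟩ := by
  induction l generalizing o with
  | nil => simp
  | cons b l ih =>
    rw [List.foldl_cons]
    cases emit
    · exact ih o
    · exact (ih _).trans (by simp)

theorem foldl_pairCode (x y xd o : List Bool) :
    (pairCode x y).foldl (step emit) ⟨.even, xd, x, o⟩ =
      ⟨.rest, x.reverse ++ xd, [], if emit then o ++ y else o⟩ := by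
  induction x generalizing xd with
  | nil => exact (foldl_rest y xd [] o)
  | cons a x ih =>
    have : pairCode (a :: x) y = a :: a :: pairCode x y := by simp [pairCode]
    rw [this, List.foldl_cons, List.foldl_cons]
    simp [step, ih]

/-- The state `fail` is absorbing, so every bit of `x` must have been met by two equal bits,
followed by the delimiter. -/
theorem exists_of_foldl_eq_rest {x xd o l : List Bool}
    (h : (l.foldl (step emit) ⟨.even, xd, x, o⟩).ms = .rest) : ∃ y, l = pairCode x y := by
  induction x generalizing xd l with
  | nil =>
    rcases l with _ | ⟨b, l⟩
    · simp at h
    rw [List.foldl_cons] at h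
    cases b
    · rcases l with _ | ⟨b, l⟩
      · simp [step] at h
      rw [List.foldl_cons] at h
      cases b
      · simp [step, foldl_fail] at h
      · exact ⟨l, rfl⟩
    · simp [step, foldl_fail] at h
  | cons a x ih =>
    rcases l with _ | ⟨b, l⟩
    · simp at h
    rw [List.foldl_cons] at h
    by_cases hb : a = b
    swap
    · simp [step, hb, foldl_fail] at h
    subst hb
    rcases l with _ | ⟨b, l⟩
    · simp [step] at h
    rw [List.foldl_cons] at h
    by_cases hb : b = a
    swap
    · simp [step, hb, foldl_fail] at h
    subst hb
    obtain ⟨y, rfl⟩ := ih (l := l) (by simpa [step] using h)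
    exact ⟨y, by simp [pairCode]⟩

end Observer

theorem pairCode_inj {x x' y y' : List Bool} (h : pairCode x y = pairCode x' y') :
    x = x' ∧ y = y' := by
  have hx : x = x' := by
    induction x generalizing x' with
    | nil =>
      rcases x' with _ | ⟨b, x'⟩
      · rfl
      · cases b <;> simp [pairCode] at h
    | cons a x ih =>
      rcases x' with _ | ⟨b, x'⟩
      · cases a <;> simp [pairCode] at h
      · simp [pairCode] at h
        rw [h.1, ih (by simpa [pairCode] using h.2)]
  subst hx
  exact ⟨rfl, by simpa [pairCode] using h⟩

namespace Micro

variable {S : Type}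

/-- On the program `q` the machine halts in space `f`, and its output is the code of a pair with the
first component `x`. -/
def Accepts (M : Micro S) (f : ℕ) (x q : List Bool) : Prop := ∃ y, M.Outputs f q (pairCode x y)

variable {M : Micro S}

theorem Accepts.mono {f g : ℕ} (hfg : f ≤ g) {x q : List Bool} (h : M.Accepts f x q) :
    M.Accepts g x q := by
  obtain ⟨y, hy⟩ := h
  exact ⟨y, hy.mono hfg⟩

/-- Different strings have disjoint sets of accepted programs, even for different space bounds; the
counting of strings rests on this. -/
theorem Accepts.unique {f g : ℕ} {x x' q : List Bool} (h : M.Accepts f x q)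
    (h' : M.Accepts g x' q) : x = x' := by
  obtain ⟨y, hy⟩ := h
  obtain ⟨y', hy'⟩ := h'
  exact (pairCode_inj (hy.unique hy')).1

end Micro

section

variable {S : Type} {s : ℕ} {k : Ctl S} {st : Store} {p c o : List Bool} {Q : Data (Ctl S) → Prop}
variable [Finite S] {M : Micro S} {F : Frame} {q : List Bool} {d : Conf S}

/-- Process a bit of the output of the simulated machine. -/
noncomputable def matchProg (emit b : Bool) : RProg (Ctl S) :=
  dispatch (fun k => k.ms) fun
    | .even => .seq (expect (.reg .xr) fun _ => some b) (.ite (fun k => k.cy)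
        (.seq (pushS (.reg .xd) fun _ => b) (setC fun k => { k with ms := .odd b }))
        (.seq (expect (.reg .xr) fun _ => none)
          (setC fun k => { k with ms := if k.cy && !b then .sep else .fail })))
    | .odd b' => setC fun k => { k with ms := if b = b' then .even else .fail }
    | .sep => setC fun k => { k with ms := if b then .rest else .fail }
    | .rest => if emit then .prim (.write fun _ => b) else nop
    | .fail => nop

/-- The frame that contains the current state of the comparison. -/
def Frame.observe (F : Frame) (w : Observer) : Frame := { F with xd := w.xd, xr := w.xr }

omit [Finite S] in
theorem wp_matchProg {emit b : Bool} {w : Observer} (hF : (F.observe w).Fits s q)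
    (hd : Micro.Valid F.f q d) (hm : k.ms = w.ms)
    (hQ : ∀ k' : Ctl S, k'.s = k.s → k'.run = k.run → k'.ov = k.ov → k'.ms = (w.step emit b).ms →
      Q ⟨k', (F.observe (w.step emit b)).store d, p, c, (w.step emit b).out⟩) :
    Wp s (matchProg emit b) Q ⟨k, (F.observe w).store d, p, c, w.out⟩ := by
  have hw := hF.weight_le (c := d) hd
  have hlen := congrArg List.length (w.step_word (emit := emit) b)
  simp only [List.length_append, List.length_reverse] at hlen
  have hw' : ((F.observe (w.step emit b)).store d).weight ≤ s :=
    (Frame.Fits.with hF (xd := (w.step emit b).xd) (xr := (w.step emit b).xr) hlen).weight_le hd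
  refine wp_dispatch ?_
  dsimp only
  rw [hm]
  obtain ⟨ms, xd, xr, out⟩ := w
  cases ms with
  | even =>
    refine wp_seq.2 (wp_expect (fun _ => rfl) hw ?_ ?_)
    · intro h
      have h' : xr.head? = some b := h
      simp only [Observer.step, if_pos h'] at hQ hw'
      exact wp_ite_true rfl (wp_seq.2 (wp_pushS hw' (wp_setC hw' (hQ _ rfl rfl rfl rfl))))
    · intro h x
      have h' : ¬ xr.head? = some b := h
      simp only [Observer.step, if_neg h'] at hQ hw'
      refine wp_ite_false rfl (wp_seq.2 (wp_expect (fun _ => rfl) hw ?_ ?_))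
      · intro h2
        have h2' : xr.head? = none := h2
        have e : ((F.observe ⟨.even, xd, xr, out⟩).store d).set (.reg .xr)
            (((F.observe ⟨.even, xd, xr, out⟩).store d).get (.reg .xr)).tail =
            (F.observe ⟨.even, xd, xr, out⟩).store d := by
          rw [List.head?_eq_none_iff] at h2'
          subst h2'
          rfl
        rw [e]
        refine wp_setC hw (hQ _ rfl rfl rfl ?_)
        cases b <;> simp [h2']
      · intro h2 x
        have h2' : ¬ xr.head? = none := h2
        refine wp_setC hw (hQ _ rfl rfl rfl ?_)
        simp [h2']
  | odd b' => exact wp_setC hw (hQ _ rfl rfl rfl rfl)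
  | sep => exact wp_setC hw (hQ _ rfl rfl rfl rfl)
  | rest =>
    cases emit
    · exact wp_nop hw (hQ _ rfl rfl rfl hm)
    · exact wp_prim.2 ⟨hw, hQ _ rfl rfl rfl hm⟩
  | fail => exact wp_nop hw (hQ _ rfl rfl rfl hm)

variable (M) in
open Classical in
/-- One step of a simulation with comparison of the output. -/
noncomputable def runBody (emit : Bool) : RProg (Ctl S) :=
  .ite (fun k => decide (M.instr k.s = .halt)) (setC fun k => { k with run := false })
    (.seq (dispatch (fun k => k.s) fun t => match M.instr t with
        | .out (some b) => matchProg emit b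
        | _ => nop)
      (.seq (stepProg M) (setC fun k => { k with s := M.next k.s k.slot })))

variable (M) in
/-- Simulation with comparison of the output. -/
noncomputable def runProg (emit : Bool) : RProg (Ctl S) :=
  .seq (setC fun k => { k with s := M.start, run := true, ms := .even })
    (.loop (fun k => k.run) (runBody M emit))

omit [Finite S] in
theorem Micro.next_of_step {f : ℕ} {d e : Conf S} (h : M.step f d = some e) :
    e.s = M.next d.s (M.res d) := by
  unfold Micro.step at h
  split at h
  · rename_i hi
    split_ifs at h
    cases h; simp [Micro.res, hi]
  · rename_i hi; cases h; simp [Micro.res, hi]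
  · rename_i hi; cases h; simp [Micro.res, hi]
  · rename_i hi; cases h; simp [Micro.res, hi]
  · cases h

/-- The computation is already known to halt, so termination is an induction along its path. The
output is never stored: the observer processes it bit by bit. -/
theorem wp_runLoop {emit : Bool} {w : Observer} {l : List Bool} {e : Conf S}
    (hp : M.Path F.f d l e) (he : M.instr e.s = .halt) (hF : (F.observe w).Fits s q)
    (hd : Micro.Valid F.f q d) (hk : k.s = d.s) (hm : k.ms = w.ms) (hr : k.run = true)
    (hQ : ∀ k' : Ctl S, k'.ov = k.ov → k'.ms = (l.foldl (Observer.step emit) w).ms →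
      Micro.Valid F.f q e →
      Q ⟨k', (F.observe (l.foldl (Observer.step emit) w)).store e, p, c,
        (l.foldl (Observer.step emit) w).out⟩) :
    Wp s (.loop (fun k => k.run) (runBody M emit)) Q ⟨k, (F.observe w).store d, p, c, w.out⟩ := by
  induction hp generalizing k w with
  | nil d =>
    exact wp_loop_true hr (wp_ite_true (by simp [hk, he]) (wp_setC (hF.weight_le hd)
      (wp_loop_false rfl (hQ _ rfl hm hd))))
  | @cons d d' e l hs _ ih =>
    have hh : M.instr d.s ≠ .halt := fun h => by simp [Micro.step_of_halt h] at hs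
    have hd' : Micro.Valid F.f q d' :=
      ⟨M.space_le_of_step hd.1 hs, (M.program_of_step hs).trans hd.2⟩
    rw [List.foldl_append] at hQ
    have key : ∀ k' : Ctl S, k'.s = k.s → k'.run = k.run → k'.ov = k.ov →
        k'.ms = ((M.emit d).foldl (Observer.step emit) w).ms →
        Wp s (.seq (stepProg M) (setC fun k => { k with s := M.next k.s k.slot }))
          (Wp s (.loop (fun k => k.run) (runBody M emit)) Q)
          ⟨k', (F.observe ((M.emit d).foldl (Observer.step emit) w)).store d, p, c,
            ((M.emit d).foldl (Observer.step emit) w).out⟩ := by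
      intro k' h1 h2 h3 h4
      have hlen := congrArg List.length (Observer.foldl_word (emit := emit) (M.emit d) w)
      simp only [List.length_append, List.length_reverse] at hlen
      have hF' : (F.observe ((M.emit d).foldl (Observer.step emit) w)).Fits s q :=
        Frame.Fits.with hF hlen
      refine wp_seq.2 (wp_stepProg hF' hd (h1.trans hk) hh ?_ ?_)
      · intro e' he'
        have he'' : M.step F.f d = some e' := he'
        rw [hs, Option.some.injEq] at he''
        subst he''
        refine wp_setC (hF'.weight_le hd') (ih he hF' hd' ?_ h4 (h2.trans hr) ?_)
        · simp only [h1, hk, Micro.next_of_step hs]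
        · intro k'' h5 h6 h7
          exact hQ k'' (h5.trans h3) h6 h7
      · intro h
        have h' : M.step F.f d = none := h
        rw [hs] at h'; cases h'
    refine wp_loop_true hr (wp_ite_false (by simp [hk, hh]) (wp_seq.2 (wp_dispatch ?_)))
    dsimp only
    rw [hk]
    have hw := hF.weight_le (c := d) hd
    cases hi : M.instr d.s with
    | out x =>
      cases x with
      | none =>
        refine wp_nop hw ?_
        have := key k rfl rfl rfl (by simp [Micro.emit, hi, hm])
        simpa [Micro.emit, hi] using this
      | some b =>
        refine wp_matchProg hF hd hm fun k' h1 h2 h3 h4 => ?_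
        have := key k' h1 h2 h3 (by simp [Micro.emit, hi, h4])
        simpa [Micro.emit, hi] using this
    | halt => exact absurd hi hh
    | _ =>
      refine wp_nop hw ?_
      have := key k rfl rfl rfl (by simp [Micro.emit, hi, hm])
      simpa [Micro.emit, hi] using this

theorem wp_runProg {emit : Bool} {l : List Bool} (hl : M.Outputs F.f q l) (hF : F.Fits s q)
    (hQ : ∀ (k' : Ctl S) (e : Conf S) (w : Observer), k'.ov = k.ov →
      w = l.foldl (Observer.step emit) ⟨.even, F.xd, F.xr, o⟩ → k'.ms = w.ms →
      Micro.Valid F.f q e → Q ⟨k', (F.observe w).store e, p, c, w.out⟩) :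
    Wp s (runProg M emit) Q ⟨k, F.store (.initial M.start q), p, c, o⟩ := by
  obtain ⟨e, hp, he⟩ := hl
  have hd := Frame.Fits.valid_initial (F := F) (q := q) (t := M.start)
  refine wp_seq.2 (wp_setC (hF.weight_le hd) ?_)
  exact wp_runLoop (F := F) (w := ⟨.even, F.xd, F.xr, o⟩) hp he hF hd rfl rfl rfl
    fun k' h1 h2 h3 => hQ k' e _ h1 rfl h2 h3

variable (M) in
open Classical in
/-- Test whether the program is accepted by `M`. -/
noncomputable def acceptProg : RProg (Ctl S) :=
  .seq (walkProg M) (.seq cleanProg (.ite (fun k => k.acc)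
    (.seq (runProg M false) (.seq (setC fun k => { k with acc := decide (k.ms = .rest) })
      (.seq cleanProg (moveAll (.reg .xd) (.reg .xr))))) nop))

omit [Finite S] in
theorem wp_moveAll_word (hF : F.Fits s q) {t : S} (hd : Micro.Valid F.f q (Conf.initial t q))
    (hQ : ∀ k', k.Same k' → Q ⟨k', ({ F with xd := [], xr := F.xd.reverse ++ F.xr } : Frame).store
      (Conf.initial t q), p, c, o⟩) :
    Wp s (moveAll (.reg .xd) (.reg .xr)) Q ⟨k, F.store (Conf.initial t q), p, c, o⟩ := by
  set T : List Bool → Store := fun l => ({ F with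
    xd := l, xr := (F.xd.reverse ++ F.xr).drop l.length } : Frame).store (Conf.initial t q) with hT
  have hw : ∀ m, m <:+ F.xd → (T m).weight ≤ s := by
    intro m hm
    refine (Frame.Fits.with hF ?_).weight_le hd
    have := hm.length_le
    simp
    omega
  have h0 : F.store (Conf.initial t q) = T F.xd := by
    simp only [hT]
    congr
    rw [← List.length_reverse (as := F.xd), List.drop_left]
  rw [h0]
  refine wp_drain T (fun _ => o) (fun _ => rfl) F.xd hw ?_ ?_
  · intro x m k' Q' hm hr hsl hQ'
    have e : x :: (F.xd.reverse ++ F.xr).drop (m.length + 1) =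
        (F.xd.reverse ++ F.xr).drop m.length := by
      obtain ⟨l, hl⟩ := hm
      rw [← hl]
      have e1 : (l ++ x :: m).reverse ++ F.xr = m.reverse ++ ([x] ++ (l.reverse ++ F.xr)) := by simp
      have e2 : m.length + 1 = (m.reverse ++ [x]).length := by simp
      rw [e1]
      conv_lhs => rw [e2, ← List.append_assoc, List.drop_left]
      conv_rhs => rw [← List.length_reverse (as := m), List.drop_left]
      rfl
    have e' : ((T (x :: m)).set (.reg .xd) m).set (.reg .xr)
        (x :: (F.xd.reverse ++ F.xr).drop (m.length + 1)) = T m := by rw [e]; rfl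
    refine wp_pushS ?_ ?_
    · simp only [hsl, Option.getD_some]
      exact (congrArg Store.weight e').trans_le (hw m ((List.suffix_cons x m).trans hm))
    · simp only [hsl, Option.getD_some]
      have := hQ' k' ⟨rfl, rfl, rfl⟩ hr
      rw [← e'] at this
      exact this
  · exact hQ

/-- The halting test comes first because a plain simulation need not terminate. As `xd` is empty at
the beginning, moving the matched bits back restores the frame. -/
theorem wp_acceptProg (hF : F.Fits s q) (hxd : F.xd = [])
    (hQ : ∀ k' : Ctl S, k'.ov = k.ov → (k'.acc = true ↔ M.Accepts F.f F.xr q) →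
      Q ⟨k', F.store (.initial M.start q), p, c, o⟩) :
    Wp s (acceptProg M) Q ⟨k, F.store (.initial M.start q), p, c, o⟩ := by
  have hv := Frame.Fits.valid_initial (F := F) (q := q) (t := M.start)
  refine wp_seq.2 (wp_walkProg hF fun k1 d1 hd1 hov1 hacc1 => wp_seq.2 (wp_cleanProg hF hd1
    (t := M.start) fun k2 hk2 => ?_))
  by_cases hz : ∃ z, M.Outputs F.f q z
  swap
  · have h2 : k2.acc = false := by
      rw [hk2.1]; simpa using (not_congr hacc1).2 hz
    refine wp_ite_false h2 (wp_nop (hF.weight_le hv) (hQ _ (hk2.2.1.trans hov1) ?_))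
    simp only [h2, Bool.false_eq_true, false_iff]
    rintro ⟨y, hy⟩
    exact hz ⟨_, hy⟩
  refine wp_ite_true (hk2.1.trans (hacc1.2 hz)) ?_
  obtain ⟨z, hz⟩ := hz
  refine wp_seq.2 (wp_runProg hz hF ?_)
  intro k3 e w hov3 hw hms3 he
  have hword := Observer.foldl_word (emit := false) z ⟨.even, F.xd, F.xr, o⟩
  rw [← hw] at hword
  have hF' : (F.observe w).Fits s q := by
    have := congrArg List.length hword
    simp only [List.length_append, List.length_reverse] at this
    exact Frame.Fits.with hF this
  have hout : w.out = o := by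
    rw [hw]
    clear hw hword hms3 hz
    have : ∀ (z : List Bool) (w : Observer), (z.foldl (Observer.step false) w).out = w.out := by
      intro z
      induction z with
      | nil => intro w; rfl
      | cons b z ih =>
        intro w
        rw [List.foldl_cons, ih]
        obtain ⟨ms, xd, xr, o⟩ := w
        cases ms with
        | even => simp only [Observer.step]; split_ifs <;> rfl
        | _ => rfl
    exact this z _
  refine wp_seq.2 (wp_setC (hF'.weight_le he) (wp_seq.2 (wp_cleanProg (F := F.observe w) hF' he
    (t := M.start) fun k4 hk4 => wp_moveAll_word hF' hv fun k5 hk5 => ?_)))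
  have hfin : ({ F.observe w with xd := [], xr := (F.observe w).xd.reverse ++ (F.observe w).xr } :
      Frame) = F := by
    have h1 : (F.observe w).xd.reverse ++ (F.observe w).xr = F.xr := by
      simpa [hxd, Frame.observe] using hword
    rw [h1]
    obtain ⟨xd, xr, ct, ix, f, w'⟩ := F
    simp only at hxd
    subst hxd
    rfl
  rw [hfin, hout]
  refine hQ _ ?_ ?_
  · exact hk5.2.1.trans (hk4.2.1.trans (hov3.trans (hk2.2.1.trans hov1)))
  · rw [hk5.1, hk4.1]
    simp only [decide_eq_true_eq, hms3]
    rw [hxd] at hw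
    constructor
    · intro h
      rw [hw] at h
      obtain ⟨y, rfl⟩ := Observer.exists_of_foldl_eq_rest h
      exact ⟨y, hz⟩
    · rintro ⟨y, hy⟩
      rw [hw, hz.unique hy, Observer.foldl_pairCode]

theorem wp_emit {y : List Bool} (hF : F.Fits s q) (hxd : F.xd = [])
    (hy : M.Outputs F.f q (pairCode F.xr y))
    (hQ : ∀ k' (st : Store), st.weight ≤ s → Q ⟨k', st, p, c, o ++ y⟩) :
    Wp s (runProg M true) Q ⟨k, F.store (.initial M.start q), p, c, o⟩ := by
  refine wp_runProg hy hF fun k' e w _ hw _ he => ?_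
  rw [hxd, Observer.foldl_pairCode] at hw
  have hF' : (F.observe w).Fits s q := by
    refine Frame.Fits.with hF ?_
    simp [hw, hxd]
  have := hQ k' _ (hF'.weight_le he)
  simpa [hw] using this

end

end StackMachine

/-! ### Counting and searching -/

namespace StackMachine

/-- A carry leaves a register of minimal width exactly when the new value is a power of two.
Appending a digit then keeps the width minimal, so `fr` costs only a logarithm. -/
theorem bits_size_succ (v : ℕ) : ∃ cy, bumpList true true (bits v.size v) =
    (cy, bits v.size (v + 1)) ∧ bits (v + 1).size (v + 1) =
      if cy then bits v.size (v + 1) ++ [true] else bits v.size (v + 1) := by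
  refine ⟨_, bumpList_true_bits _ _, ?_⟩
  have h1 : v < 2 ^ v.size := Nat.lt_size_self v
  have h2 : v.size ≤ (v + 1).size := Nat.size_le_size (Nat.le_succ v)
  by_cases h : v + 1 < 2 ^ v.size
  · have h3 : (v + 1).size = v.size := le_antisymm (Nat.size_le.2 h) h2
    simp [not_dvd_of_lt h, h3]
  · have h3 : v + 1 = 2 ^ v.size := by omega
    have h4 : (v + 1).size = v.size + 1 := by rw [h3, Nat.size_pow]
    rw [h4, h3]
    simp [bits_succ_pow, bits_pow]

section

variable {S : Type} {s : ℕ} {k : Ctl S} {st : Store} {p c o : List Bool} {Q : Data (Ctl S) → Prop}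

/-- Subtract three from a multiple of three. -/
def dec3 : RProg (Ctl S) :=
  .seq (bump .fr false false) (.ite (fun k => k.cy) (bump .fr true false)
    (.seq (bump .fr false false) (bump .fr false false)))

def inc3 : RProg (Ctl S) :=
  .seq (bump .fr true false) (.seq (bump .fr true false) (bump .fr true false))

def ext3 : RProg (Ctl S) :=
  .seq (bump .fr true true) (.seq (bump .fr true true) (bump .fr true true))

theorem wp_dec3 {w g : ℕ} (hst : st.get (.reg .fr) = bits w (3 * g)) (hg : 3 * g < 2 ^ w)
    (hw : st.weight ≤ s) (h1 : g = 0 → Q ⟨{ k with cy := true }, st, p, c, o⟩)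
    (h2 : ∀ g', g = g' + 1 →
      Q ⟨{ k with cy := false }, st.set (.reg .fr) (bits w (3 * g')), p, c, o⟩) :
    Wp s dec3 Q ⟨k, st, p, c, o⟩ := by
  have hw' : ∀ v, (st.set (.reg .fr) (bits w v)).weight ≤ s := fun v => by
    rw [weight_set_of_length (by simp [hst])]; exact hw
  refine wp_seq.2 ?_
  rcases g with _ | g
  · exact wp_dec_zero hst hw (wp_ite_true rfl (wp_inc_restore hst hw (h1 rfl)))
  · refine wp_dec (v := 3 * g + 2) hst hg hw (wp_ite_false rfl (wp_seq.2
      (wp_dec (v := 3 * g + 1) (Store.get_set _ _) (by omega) (hw' _)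
        (wp_dec (v := 3 * g) (Store.get_set _ _) (by omega) ?_ ?_))))
    · rw [Store.set_set]; exact hw' _
    · rw [Store.set_set, Store.set_set]; exact h2 g rfl

theorem wp_inc3 {w v : ℕ} (hst : st.get (.reg .fr) = bits w v) (hv : v + 3 < 2 ^ w)
    (hw : st.weight ≤ s)
    (hQ : Q ⟨{ k with cy := false }, st.set (.reg .fr) (bits w (v + 3)), p, c, o⟩) :
    Wp s inc3 Q ⟨k, st, p, c, o⟩ := by
  have hw' : ∀ v, (st.set (.reg .fr) (bits w v)).weight ≤ s := fun v => by
    rw [weight_set_of_length (by simp [hst])]; exact hw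
  refine wp_seq.2 (wp_inc_of_lt hst (by omega) hw (wp_seq.2 (wp_inc_of_lt (Store.get_set _ _)
    (by omega) (hw' _) (wp_inc_of_lt (Store.get_set _ _) (by omega) ?_ ?_))))
  · rw [Store.set_set]; exact hw' _
  · rw [Store.set_set, Store.set_set]; exact hQ

theorem weight_set_le {r : Reg} {l m : List Bool} (h : l.length ≤ m.length) :
    (st.set (.reg r) l).weight ≤ (st.set (.reg r) m).weight := by
  cases r <;> simp [Store.set, Store.weight] <;> omega

theorem wp_ext3 {v : ℕ} (hst : st.get (.reg .fr) = bits v.size v)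
    (hw : (st.set (.reg .fr) (bits (v + 3).size (v + 3))).weight ≤ s)
    (hQ : ∀ cy, Q ⟨{ k with cy := cy }, st.set (.reg .fr) (bits (v + 3).size (v + 3)), p, c, o⟩) :
    Wp s ext3 Q ⟨k, st, p, c, o⟩ := by
  have hw' : ∀ u, u ≤ v + 3 → (st.set (.reg .fr) (bits u.size u)).weight ≤ s := fun u hu =>
    (weight_set_le (by simpa using Nat.size_le_size hu)).trans hw
  have h0 : st.weight ≤ s := by
    have := hw' v (by omega)
    rwa [← hst, Store.set_get] at this
  obtain ⟨c1, e1, f1⟩ := bits_size_succ v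
  obtain ⟨c2, e2, f2⟩ := bits_size_succ (v + 1)
  obtain ⟨c3, e3, f3⟩ := bits_size_succ (v + 2)
  refine wp_seq.2 (wp_bump_ext (by rw [hst]; exact e1) f1 (hw' _ (by omega)) h0 (wp_seq.2
    (wp_bump_ext (by rw [Store.get_set]; exact e2) f2 ?_ (hw' _ (by omega))
      (wp_bump_ext (by rw [Store.get_set]; exact e3) f3 ?_ ?_ ?_))))
  all_goals simp only [Store.set_set]
  · exact hw' _ (by omega)
  · exact hw' _ (by omega)
  · exact hw' _ (by omega)
  · exact hQ c3

end

/-- The frame with the space bound `3 * g`. -/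
def Frame.at (F : Frame) (g : ℕ) : Frame := { F with f := 3 * g }

/-! ### Counting accepted programs and locating an object by its rank -/

section

variable {S : Type} [Finite S] (M : Micro S)

open Classical in
/-- At least `2 ^ m` programs of length `n` are accepted. -/
def Micro.Popular (n m f : ℕ) (x : List Bool) : Prop :=
  2 ^ m ≤ Nat.count (fun v => M.Accepts f x (bits n v)) (2 ^ n)

variable {M}

open Classical in
omit [Finite S] in
theorem Micro.Popular.mono {n m f g : ℕ} {x : List Bool} (hfg : f ≤ g) (h : M.Popular n m f x) :
    M.Popular n m g x :=
  h.trans (Nat.count_mono_left fun _ _ h' => h'.mono hfg)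

variable (M) in
/-- Count the accepted programs and compare their number with a power of two. -/
noncomputable def countProg : RProg (Ctl S) :=
  .seq (setC fun k => { k with ov := false, cy := false })
    (.seq (.loop (fun k => !k.cy) (.seq (acceptProg M) (.seq
      (.ite (fun k => k.acc)
        (.seq (bump .ct true false) (setC fun k => { k with ov := k.ov || k.cy })) nop)
      (bump .pr true false))))
    (.seq (clear .ct) (setC fun k => { k with acc := k.ov })))

variable {s : ℕ} {k : Ctl S} {st : Store} {p c o : List Bool} {Q : Data (Ctl S) → Prop}
variable {F : Frame} {t : S} {n m : ℕ}

-- The program register `pr` is itself the loop counter: its overflow ends the loop and leaves the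
-- value zero that it had before. The register `ct` has `m` digits, so its first overflow means that
-- the count has reached 2^m. This is recorded in `ov`, after which the count may wrap around.
open Classical in
theorem wp_countProg (hF : F.Fits s (bits n 0)) (hxd : F.xd = []) (hct : F.ct = bits m 0)
    (hQ : ∀ k' : Ctl S, (k'.acc = true ↔ M.Popular n m F.f F.xr) →
      Q ⟨k', F.store (.initial M.start (bits n 0)), p, c, o⟩) :
    Wp s (countProg M) Q ⟨k, F.store (.initial M.start (bits n 0)), p, c, o⟩ := by
  set N : ℕ → ℕ := Nat.count fun v => M.Accepts F.f F.xr (bits n v) with hN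
  set G : ℕ → Frame := fun a => { F with ct := bits m a } with hG
  have hfit : ∀ a v, (G a).Fits s (bits n v) := fun a v => by
    refine ⟨hF.lt, ?_⟩
    have := hF.le
    simpa [Frame.bound, hG, hct] using this
  have hw : ∀ a v, ((G a).store (.initial M.start (bits n v))).weight ≤ s := fun a v =>
    (hfit a v).weight_le Frame.Fits.valid_initial
  have hG0 : F = G 0 := by simp [hG, ← hct]
  have hend : ∀ k' : Ctl S, (k'.ov = true ↔ 2 ^ m ≤ N (2 ^ n)) → ∀ a,
      Wp s (.seq (clear .ct) (setC fun k => { k with acc := k.ov })) Q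
        ⟨k', (G a).store (.initial M.start (bits n 0)), p, c, o⟩ := by
    intro k' hk' a
    have e : ((G a).store (.initial M.start (bits n 0))).set (.reg .ct) (bits
        (((G a).store (.initial M.start (bits n 0))).get (.reg .ct)).length 0) =
        F.store (.initial M.start (bits n 0)) := by
      conv_rhs => rw [hG0]
      simp [Frame.store, Store.set, Store.get, hG]
    refine wp_seq.2 (wp_clear (hw _ _) ?_)
    rw [e]
    refine wp_setC ?_ (hQ _ hk')
    rw [hG0]; exact hw _ _
  have key : ∀ j v, v + j = 2 ^ n → ∀ k' : Ctl S, (k'.ov = true ↔ 2 ^ m ≤ N v) →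
      k'.cy = decide (j = 0) → Wp s (.loop (fun k => !k.cy) (.seq (acceptProg M) (.seq
        (.ite (fun k => k.acc)
          (.seq (bump .ct true false) (setC fun k => { k with ov := k.ov || k.cy })) nop)
        (bump .pr true false))))
        (Wp s (.seq (clear .ct) (setC fun k => { k with acc := k.ov })) Q)
        ⟨k', (G (N v)).store (.initial M.start (bits n v)), p, c, o⟩ := by
    intro j
    induction j with
    | zero =>
      intro v hv k' hov hcy
      obtain rfl : v = 2 ^ n := by omega
      refine wp_loop_false (by simp [hcy]) ?_
      rw [bits_pow]
      exact hend _ hov _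
    | succ j ih =>
      intro v hv k' hov hcy
      have hlt : v < 2 ^ n := by omega
      have hstep : ∀ k' : Ctl S, (k'.ov = true ↔ 2 ^ m ≤ N (v + 1)) →
          Wp s (bump .pr true false) (Wp s (.loop (fun k => !k.cy) (.seq (acceptProg M) (.seq
            (.ite (fun k => k.acc)
              (.seq (bump .ct true false) (setC fun k => { k with ov := k.ov || k.cy })) nop)
            (bump .pr true false))))
            (Wp s (.seq (clear .ct) (setC fun k => { k with acc := k.ov })) Q))
            ⟨k', (G (N (v + 1))).store (.initial M.start (bits n v)), p, c, o⟩ := by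
        intro k' hk'
        refine wp_inc (w := n) (v := v) rfl (hw _ _) (ih (v + 1) (by omega) _ hk' ?_)
        rw [decide_eq_decide]
        constructor
        · intro h
          have := Nat.le_of_dvd (by omega) h
          omega
        · rintro rfl
          exact dvd_of_eq (by omega)
      refine wp_loop_true (by simp [hcy]) (wp_seq.2 (wp_acceptProg (hfit _ _) hxd ?_))
      intro k1 hov1 hacc1
      have hacc1' : k1.acc = true ↔ M.Accepts F.f F.xr (bits n v) := hacc1
      have hsucc : N (v + 1) = N v + if k1.acc then 1 else 0 := by
        rw [hN, Nat.count_succ]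
        simp only [hacc1']
      refine wp_seq.2 ?_
      cases ha : k1.acc with
      | false =>
        refine wp_ite_false ha (wp_nop (hw _ _) ?_)
        have e : N (v + 1) = N v := by rw [hsucc, ha]; rfl
        have := hstep k1 (by rw [hov1, hov, e])
        rwa [e] at this
      | true =>
        have e : N (v + 1) = N v + 1 := by rw [hsucc, ha]; rfl
        have e' : ((G (N v)).store (.initial M.start (bits n v))).set (.reg .ct)
            (bits m (N v + 1)) = (G (N (v + 1))).store (.initial M.start (bits n v)) := by
          rw [e]; rfl
        refine wp_ite_true ha (wp_seq.2 (wp_inc (w := m) (v := N v) rfl (hw _ _) ?_))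
        rw [e']
        refine wp_setC (hw _ _) (hstep _ ?_)
        simp only [Bool.or_eq_true, decide_eq_true_eq, hov1, hov, e]
        constructor
        · rintro (h | h)
          · omega
          · exact Nat.le_of_dvd (by omega) h
        · intro h
          by_cases h' : 2 ^ m ≤ N v
          · exact .inl h'
          · exact .inr (dvd_of_eq (by omega))
  have h0 : N 0 = 0 := Nat.count_zero _
  refine wp_seq.2 (wp_setC ?_ (wp_seq.2 ?_))
  · rw [hG0]; exact hw _ _
  · have := key (2 ^ n) 0 (by omega) { k with ov := false, cy := false } (by simp [h0]) (by simp)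
    rw [h0, ← hG0] at this
    exact this

/-- Determine whether the test `P` succeeds for the present space bound and for no smaller one. -/
def newProg (P : RProg (Ctl S)) : RProg (Ctl S) :=
  .seq P (.ite (fun k => k.acc) (.seq dec3 (.ite (fun k => k.cy) nop
    (.seq P (.seq (setC fun k => { k with acc := !k.acc }) inc3)))) nop)

-- By monotonicity, minimality of the bound is settled by one more test, at `g - 1`; for `g = 0`
-- there is nothing to test.
omit [Finite S] in
theorem wp_newProg {P : RProg (Ctl S)} {B : ℕ → Prop} (hB : ∀ g g', g ≤ g' → B g → B g') {g : ℕ}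
    {q : List Bool} (hF : (F.at g).Fits s q)
    (hP : ∀ g' ≤ g, ∀ (k : Ctl S) (Q : Data (Ctl S) → Prop), (∀ k' : Ctl S, (k'.acc = true ↔ B g') →
      Q ⟨k', (F.at g').store (.initial t q), p, c, o⟩) →
      Wp s P Q ⟨k, (F.at g').store (.initial t q), p, c, o⟩)
    (hQ : ∀ k' : Ctl S, (k'.acc = true ↔ B g ∧ ∀ g' < g, ¬ B g') →
      Q ⟨k', (F.at g).store (.initial t q), p, c, o⟩) :
    Wp s (newProg P) Q ⟨k, (F.at g).store (.initial t q), p, c, o⟩ := by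
  have hlt : 3 * g < 2 ^ F.w := hF.lt
  have hw : ∀ g' ≤ g, ((F.at g').store (.initial t q)).weight ≤ s := by
    intro g' hg'
    refine Frame.Fits.weight_le ⟨?_, ?_⟩ Frame.Fits.valid_initial
    · have : 3 * g' < 2 ^ F.w := by omega
      exact this
    · have := hF.le
      simp only [Frame.bound, Frame.at] at this ⊢
      omega
  refine wp_seq.2 (hP g le_rfl _ _ fun k1 h1 => ?_)
  cases ha : k1.acc with
  | false =>
    refine wp_ite_false ha (wp_nop (hw g le_rfl) (hQ _ ?_))
    rw [h1]
    constructor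
    · intro h; rw [h1.2 h] at ha; cases ha
    · exact fun h => h.1
  | true =>
    have hBg := h1.1 ha
    refine wp_ite_true ha (wp_seq.2 (wp_dec3 (w := F.w) (g := g) rfl hlt (hw g le_rfl) ?_ ?_))
    · rintro rfl
      refine wp_ite_true rfl (wp_nop (hw _ le_rfl) (hQ _ ?_))
      simp [ha, hBg]
    · rintro g' rfl
      have e : ((F.at (g' + 1)).store (.initial t q)).set (.reg .fr) (bits F.w (3 * g')) =
          (F.at g').store (.initial t q) := rfl
      rw [e]
      refine wp_ite_false rfl (wp_seq.2 (hP g' (by omega) _ _ fun k2 h2 => wp_seq.2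
        (wp_setC (hw _ (by omega)) (wp_inc3 (w := F.w) (v := 3 * g') rfl (by omega)
          (hw _ (by omega)) (hQ _ ?_)))))
      simp only [hBg, true_and]
      rw [Bool.not_eq_true', ← Bool.not_eq_true, h2]
      constructor
      · intro h g'' hg'' h'
        exact h (hB _ _ (by omega) h')
      · intro h; exact h g' (by omega)

/-- Go through a sequence of states until the number of successful tests makes the register `ix`
overflow. -/
def searchProg (test fin adv : RProg (Ctl S)) : RProg (Ctl S) :=
  .seq (setC fun k => { k with cy := false }) (.loop (fun k => !k.cy)
    (.seq test (.seq (.ite (fun k => k.acc) (bump .ix true false)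
      (setC fun k => { k with cy := false }))
      (.ite (fun k => k.cy) (.seq fin (setC fun k => { k with cy := true }))
        (.seq adv (setC fun k => { k with cy := false }))))))

-- `ix` starts with 2^W minus the rank of the target among the successes, so its overflow occurs at
-- the target. All ranks from 1 to 2^W fit in W digits, and no second counter is needed for a
-- comparison.
open Classical in
omit [Finite S] in
theorem wp_searchProg {test fin adv : RProg (Ctl S)} {W I r : ℕ} {E : ℕ → Prop}
    (T : ℕ → List Bool → Store) {o' : List Bool} (hget : ∀ t l, (T t l).get (.reg .ix) = l)
    (hset : ∀ t l m, (T t l).set (.reg .ix) m = T t m)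
    (hw : ∀ t ≤ r, ∀ l, l.length = W → (T t l).weight ≤ s)
    (htest : ∀ t ≤ r, ∀ l, l.length = W → ∀ (k : Ctl S) (Q : Data (Ctl S) → Prop),
      (∀ k' : Ctl S, (k'.acc = true ↔ E t) → Q ⟨k', T t l, p, c, o⟩) →
      Wp s test Q ⟨k, T t l, p, c, o⟩)
    (hadv : ∀ t < r, ∀ l, l.length = W → ∀ (k : Ctl S) (Q : Data (Ctl S) → Prop),
      (∀ k', Q ⟨k', T (t + 1) l, p, c, o⟩) → Wp s adv Q ⟨k, T t l, p, c, o⟩)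
    (hfin : ∀ l, l.length = W → ∀ (k : Ctl S) (Q : Data (Ctl S) → Prop),
      (∀ k' st, st.weight ≤ s → Q ⟨k', st, p, c, o'⟩) → Wp s fin Q ⟨k, T r l, p, c, o⟩)
    (hE : E r) (hI : I + Nat.count E (r + 1) = 2 ^ W) :
    Wp s (searchProg test fin adv) (fun d => d.out = o') ⟨k, T 0 (bits W I), p, c, o⟩ := by
  have hlast : Nat.count E (r + 1) = Nat.count E r + 1 := by rw [Nat.count_succ, if_pos hE]
  have key : ∀ j t, t + j = r → ∀ k' : Ctl S, k'.cy = false →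
      Wp s (.loop (fun k => !k.cy) (.seq test (.seq (.ite (fun k => k.acc) (bump .ix true false)
        (setC fun k => { k with cy := false }))
        (.ite (fun k => k.cy) (.seq fin (setC fun k => { k with cy := true }))
          (.seq adv (setC fun k => { k with cy := false }))))))
        (fun d => d.out = o') ⟨k', T t (bits W (I + Nat.count E t)), p, c, o⟩ := by
    intro j
    induction j with
    | zero =>
      intro t ht k' hcy
      obtain rfl : t = r := by omega
      refine wp_loop_true (by simp [hcy]) (wp_seq.2 (htest _ le_rfl _ (by simp) _ _ ?_))
      intro k1 h1
      refine wp_seq.2 (wp_ite_true (h1.2 hE) (wp_inc (w := W) (v := I + Nat.count E t) (hget _ _)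
        (hw _ le_rfl _ (by simp)) (wp_ite_true ?_ (wp_seq.2 ?_))))
      · exact decide_eq_true (dvd_of_eq (by omega))
      · rw [hset]
        refine hfin _ (by simp) _ _ fun k' st hst => wp_setC hst (wp_loop_false rfl rfl)
    | succ j ih =>
      intro t ht k' hcy
      have hmono : Nat.count E (t + 1) ≤ Nat.count E r := Nat.count_monotone E (by omega)
      have hcont : ∀ k' : Ctl S, k'.cy = false →
          Wp s (.ite (fun k => k.cy) (.seq fin (setC fun k => { k with cy := true }))
            (.seq adv (setC fun k => { k with cy := false })))
            (Wp s (.loop (fun k => !k.cy) (.seq test (.seq (.ite (fun k => k.acc)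
              (bump .ix true false) (setC fun k => { k with cy := false }))
              (.ite (fun k => k.cy) (.seq fin (setC fun k => { k with cy := true }))
                (.seq adv (setC fun k => { k with cy := false }))))))
              (fun d => d.out = o'))
            ⟨k', T t (bits W (I + Nat.count E (t + 1))), p, c, o⟩ := by
        intro k' hk'
        refine wp_ite_false hk' (wp_seq.2 (hadv _ (by omega) _ (by simp) _ _ fun k'' =>
          wp_setC (hw _ (by omega) _ (by simp)) (ih (t + 1) (by omega) _ rfl)))
      refine wp_loop_true (by simp [hcy]) (wp_seq.2 (htest _ (by omega) _ (by simp) _ _ ?_))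
      intro k1 h1
      refine wp_seq.2 ?_
      by_cases hEt : E t
      · have e : Nat.count E (t + 1) = Nat.count E t + 1 := by rw [Nat.count_succ, if_pos hEt]
        refine wp_ite_true (h1.2 hEt) (wp_inc_of_lt (w := W) (v := I + Nat.count E t) (hget _ _)
          (by omega) (hw _ (by omega) _ (by simp)) ?_)
        rw [hset, add_assoc, ← e]
        exact hcont _ rfl
      · have e : Nat.count E (t + 1) = Nat.count E t := by rw [Nat.count_succ, if_neg hEt]; rfl
        refine wp_ite_false (by simpa using (not_congr h1).2 hEt)
          (wp_setC (hw _ (by omega) _ (by simp)) ?_)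
        rw [← e]
        exact hcont _ rfl
  refine wp_seq.2 (wp_setC (hw _ (by omega) _ (by simp)) ?_)
  have := key r 0 (by omega) { k with cy := false } rfl
  simpa using this

end

end StackMachine

/-! ### Reading the input -/

namespace StackMachine

/-- The binary digits of a number, the highest one first. -/
def numeral (m : ℕ) : List Bool := (bits m.size m).reverse

@[simp] theorem length_numeral (m : ℕ) : (numeral m).length = m.size := by simp [numeral]

theorem length_pairCode (x y : List Bool) :
    (pairCode x y).length = 2 * x.length + 2 + y.length := by
  induction x with
  | nil => simp [pairCode]; omega
  | cons a x ih => simp [pairCode] at ih ⊢; omega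

theorem Frame.Fits.at_le {F : Frame} {s g g' : ℕ} {q : List Bool} (hF : (F.at g).Fits s q)
    (h : g' ≤ g) : (F.at g').Fits s q := by
  refine ⟨lt_of_le_of_lt ?_ hF.lt, ?_⟩
  · simp only [Frame.at]; omega
  · have := hF.le
    simp only [Frame.bound, Frame.at] at this ⊢
    omega

section

variable {S : Type} {s : ℕ} {k : Ctl S} {st : Store} {p c o : List Bool} {Q : Data (Ctl S) → Prop}

def readProgSlot : RProg (Ctl S) := .prim (.readProg fun k o => { k with slot := o })

def readCondSlot : RProg (Ctl S) := .prim (.readCond fun k o => { k with slot := o })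

/-- Read a string with doubled bits up to the delimiter `01`. -/
def readWord : RProg (Ctl S) :=
  .seq (setC fun k => { k with run := true }) (.loop (fun k => k.run) (.seq readProgSlot
    (.seq (setC fun k => { k with acc := k.slot == some true }) (.seq readProgSlot
      (.ite (fun k => k.slot == some k.acc) (pushS (.reg .fr) fun k => k.acc)
        (setC fun k => { k with run := false }))))))

/-- Write in the register `d` as many zeros as the value of `fr`. -/
def unaryProg (d : Reg) : RProg (Ctl S) :=
  .seq (setC fun k => { k with cy := false }) (.loop (fun k => !k.cy)
    (.seq (bump .fr false false) (.ite (fun k => k.cy) nop (pushS (.reg d) fun _ => false))))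

/-- Read the code of a number and write as many zeros in the register `d`. -/
def readNum (d : Reg) : RProg (Ctl S) :=
  .seq readWord (.seq (unaryProg d) (drain (.reg .fr) nop))

/-- Copy the rest of a tape in a register in reverse order. -/
def readAll (rd : RProg (Ctl S)) (d : Reg) : RProg (Ctl S) :=
  .seq (setC fun k => { k with run := true }) (.loop (fun k => k.run) (.seq rd
    (.ite (fun k => k.slot.isSome) (pushS (.reg d) fun k => k.slot.getD false)
      (setC fun k => { k with run := false }))))

theorem wp_readProgSlot (hw : st.weight ≤ s)
    (hQ : Q ⟨{ k with slot := p.head? }, st, p.tail, c, o⟩) :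
    Wp s readProgSlot Q ⟨k, st, p, c, o⟩ := wp_prim.2 ⟨hw, hQ⟩

theorem wp_readCondSlot (hw : st.weight ≤ s)
    (hQ : Q ⟨{ k with slot := c.head? }, st, p, c.tail, o⟩) :
    Wp s readCondSlot Q ⟨k, st, p, c, o⟩ := wp_prim.2 ⟨hw, hQ⟩

/-- The functions `A` and `B` describe the two tapes in terms of the unread part, so that the same
argument serves for the program and for the condition. -/
theorem wp_readAll {rd : RProg (Ctl S)} {d : Reg} (T : List Bool → Store)
    (A B : List Bool → List Bool) {l : List Bool}
    (hrd : ∀ (k : Ctl S) st l Q, st.weight ≤ s →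
      Q ⟨{ k with slot := l.head? }, st, A l.tail, B l.tail, o⟩ → Wp s rd Q ⟨k, st, A l, B l, o⟩)
    (hget : ∀ l, (T l).get (.reg d) = l) (hset : ∀ l m, (T l).set (.reg d) m = T m)
    (hw : ∀ m, m.length ≤ l.length → (T m).weight ≤ s)
    (hQ : ∀ k', Q ⟨k', T l.reverse, A [], B [], o⟩) :
    Wp s (readAll rd d) Q ⟨k, T [], A l, B l, o⟩ := by
  refine wp_seq.2 (wp_setC (hw _ (by simp)) ?_)
  have key : ∀ (m u : List Bool) (k' : Ctl S), k'.run = true → u.reverse ++ m = l →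
      Wp s (.loop (fun k => k.run) (.seq rd
        (.ite (fun k => k.slot.isSome) (pushS (.reg d) fun k => k.slot.getD false)
          (setC fun k => { k with run := false })))) Q ⟨k', T u, A m, B m, o⟩ := by
    intro m
    induction m with
    | nil =>
      rintro u k' hr rfl
      have := hw u (by simp)
      refine wp_loop_true hr (wp_seq.2 (hrd _ _ _ _ this (wp_ite_false rfl (wp_setC this
        (wp_loop_false rfl ?_)))))
      simpa using hQ _
    | cons b m ih =>
      rintro u k' hr hl
      have hlen := congrArg List.length hl
      simp only [List.length_append, List.length_reverse, List.length_cons] at hlen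
      refine wp_loop_true hr (wp_seq.2 (hrd _ _ _ _ (hw u (by omega))
        (wp_ite_true rfl (wp_pushS ?_ ?_))))
      · rw [hget, hset]
        exact hw _ (by simp only [List.length_cons]; omega)
      · rw [hget, hset]
        exact ih (b :: u) _ hr (by simpa using hl)
  exact key l [] _ rfl rfl

theorem wp_readWord (T : List Bool → Store) {u v : List Bool}
    (hget : ∀ l, (T l).get (.reg .fr) = l) (hset : ∀ l m, (T l).set (.reg .fr) m = T m)
    (hw : ∀ m, m.length ≤ u.length → (T m).weight ≤ s)
    (hQ : ∀ k', Q ⟨k', T u.reverse, v, c, o⟩) :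
    Wp s readWord Q ⟨k, T [], pairCode u v, c, o⟩ := by
  refine wp_seq.2 (wp_setC (hw _ (by simp)) ?_)
  have key : ∀ (m z : List Bool) (k' : Ctl S), k'.run = true → z.reverse ++ m = u →
      Wp s (.loop (fun k => k.run) (.seq readProgSlot
        (.seq (setC fun k => { k with acc := k.slot == some true }) (.seq readProgSlot
          (.ite (fun k => k.slot == some k.acc) (pushS (.reg .fr) fun k => k.acc)
            (setC fun k => { k with run := false })))))) Q ⟨k', T z, pairCode m v, c, o⟩ := by
    intro m
    induction m with
    | nil =>
      rintro z k' hr rfl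
      have := hw z (by simp)
      refine wp_loop_true hr (wp_seq.2 (wp_readProgSlot this (wp_seq.2 (wp_setC this (wp_seq.2
        (wp_readProgSlot this (wp_ite_false rfl (wp_setC this (wp_loop_false rfl ?_)))))))))
      simpa [pairCode] using hQ _
    | cons b m ih =>
      rintro z k' hr hl
      have hlen := congrArg List.length hl
      simp only [List.length_append, List.length_reverse, List.length_cons] at hlen
      have := hw z (by omega)
      have e : pairCode (b :: m) v = b :: b :: pairCode m v := by simp [pairCode]
      rw [e]
      refine wp_loop_true hr (wp_seq.2 (wp_readProgSlot this (wp_seq.2 (wp_setC this (wp_seq.2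
        (wp_readProgSlot this (wp_ite_true (by cases b <;> rfl) (wp_pushS ?_ ?_))))))))
      · rw [hget, hset]
        exact hw _ (by simp only [List.length_cons]; omega)
      · rw [hget, hset]
        have e2 : ((some b : Option Bool) == some true) = b := by cases b <;> rfl
        simp only [List.head?_cons, List.tail_cons, e2]
        exact ih (b :: z) _ hr (by simpa using hl)
  exact key u [] _ rfl rfl

/-- The number is needed as a width: what is produced is a counter with that many digits, set to
zero. The failed last decrement leaves ones in `fr`, which are then removed. -/
theorem wp_readNum {d : Reg} (T : List Bool → List Bool → Store) {m : ℕ} {v : List Bool}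
    (hfr : ∀ a b, (T a b).get (.reg .fr) = a) (hd : ∀ a b, (T a b).get (.reg d) = b)
    (sfr : ∀ a b a', (T a b).set (.reg .fr) a' = T a' b)
    (sd : ∀ a b b', (T a b).set (.reg d) b' = T a b')
    (hw : ∀ a b : List Bool, a.length ≤ m.size → b.length ≤ m → (T a b).weight ≤ s)
    (hQ : ∀ k', Q ⟨k', T [] (bits m 0), v, c, o⟩) :
    Wp s (readNum d) Q ⟨k, T [] [], pairCode (numeral m) v, c, o⟩ := by
  refine wp_seq.2 (wp_readWord (fun a => T a []) (fun _ => hfr _ _) (fun _ _ => sfr _ _ _)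
    (fun a ha => hw _ _ (by simpa using ha) (by simp)) fun k1 => ?_)
  simp only [numeral, List.reverse_reverse]
  refine wp_seq.2 (wp_seq.2 (wp_setC (hw _ _ (by simp) (by simp)) ?_))
  have key : ∀ i j, i + j = m → ∀ k' : Ctl S, k'.cy = false →
      Wp s (.loop (fun k => !k.cy) (.seq (bump .fr false false)
        (.ite (fun k => k.cy) nop (pushS (.reg d) fun _ => false))))
        (Wp s (drain (.reg .fr) nop) Q) ⟨k', T (bits m.size i) (bits j 0), v, c, o⟩ := by
    intro i
    have hlt := Nat.lt_size_self m
    induction i with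
    | zero =>
      rintro j hj k' hcy
      obtain rfl : j = m := by omega
      have hweight : ∀ a : List Bool, a.length ≤ j.size → (T a (bits j 0)).weight ≤ s :=
        fun a ha => hw _ _ ha (by simp)
      refine wp_loop_true (by simp [hcy]) (wp_seq.2 (wp_dec_zero (hfr _ _) (hweight _ (by simp)) ?_))
      rw [sfr]
      refine wp_ite_true rfl (wp_nop (hweight _ (by simp)) (wp_loop_false rfl ?_))
      refine wp_drain (fun a => T a (bits j 0)) (fun _ => o) (fun _ => hfr _ _) _
        (fun a ha => hweight _ (by simpa using ha.length_le)) ?_ fun k' _ => hQ k'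
      intro b a k2 Q' ha hr _ hQ'
      rw [sfr]
      refine wp_nop (hweight _ ?_) (hQ' _ ⟨rfl, rfl, rfl⟩ hr)
      have := ha.length_le
      simp at this
      omega
    | succ i ih =>
      rintro j hj k' hcy
      refine wp_loop_true (by simp [hcy]) (wp_seq.2 (wp_dec (v := i) (hfr _ _) (by omega)
        (hw _ _ (by simp) (by simp; omega)) ?_))
      rw [sfr]
      have e : false :: bits j 0 = bits (j + 1) 0 := by simp [bits]
      refine wp_ite_false rfl (wp_pushS ?_ ?_)
      · rw [hd, sd, e]
        exact hw _ _ (by simp) (by simp; omega)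
      · rw [hd, sd, e]
        exact ih (j + 1) (by omega) _ rfl
  have := key m 0 (by omega) { k1 with cy := false } rfl
  simpa [bits] using this

end

/-! ### Description of the first component -/

/-- The pairs of a number `g` and a string, given by its length `L` and its value `v` as a binary
number, are enumerated by increasing `g + L`. -/
def nextPair : ℕ × ℕ × ℕ → ℕ × ℕ × ℕ
  | (g, L, v) => if v + 1 < 2 ^ L then (g, L, v + 1) else
      if 0 < g then (g - 1, L + 1, 0) else (L + 1, 0, 0)

def pairSeq (t : ℕ) : ℕ × ℕ × ℕ := nextPair^[t] (0, 0, 0)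

theorem pairSeq_succ (t : ℕ) : pairSeq (t + 1) = nextPair (pairSeq t) :=
  Function.iterate_succ_apply' _ _ _

theorem pairSeq_lt (t : ℕ) : (pairSeq t).2.2 < 2 ^ (pairSeq t).2.1 := by
  induction t with
  | zero => simp [pairSeq]
  | succ t ih =>
    rw [pairSeq_succ]
    generalize pairSeq t = e
    obtain ⟨g, L, v⟩ := e
    simp only [nextPair]
    split_ifs with h1 h2
    · exact h1
    · positivity
    · simp

/-- The rank of a pair in the enumeration. -/
def pairRank (e : ℕ × ℕ × ℕ) : ℕ ×ₗ ℕ ×ₗ ℕ := toLex (e.1 + e.2.1, toLex (e.2.1, e.2.2))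

theorem pairRank_lt (e : ℕ × ℕ × ℕ) : pairRank e < pairRank (nextPair e) := by
  obtain ⟨g, L, v⟩ := e
  simp only [nextPair, pairRank]
  split_ifs with h1 h2
  · simp [Prod.Lex.toLex_lt_toLex]
  · simp only [Prod.Lex.toLex_lt_toLex]
    right
    exact ⟨by omega, .inl (by simp)⟩
  · simp only [Prod.Lex.toLex_lt_toLex]
    left
    omega

/-- The growth of the rank has two uses: no pair occurs twice, so ranks of discoveries can be
bounded by counting, and `g + L` never decreases, which bounds the memory of the search. -/
theorem strictMono_pairRank : StrictMono fun t => pairRank (pairSeq t) :=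
  strictMono_nat_of_lt_succ fun t => by rw [pairSeq_succ]; exact pairRank_lt _

theorem pairSeq_injective : Function.Injective pairSeq := fun _ _ h =>
  strictMono_pairRank.injective (congrArg pairRank h)

theorem pairSeq_sum_mono {t r : ℕ} (h : t ≤ r) :
    (pairSeq t).1 + (pairSeq t).2.1 ≤ (pairSeq r).1 + (pairSeq r).2.1 := by
  have := strictMono_pairRank.monotone h
  simp only [pairRank, Prod.Lex.toLex_le_toLex] at this
  rcases this with h | h
  · exact h.le
  · exact h.1.le

theorem exists_pairSeq (g L v : ℕ) (hv : v < 2 ^ L) : ∃ t, pairSeq t = (g, L, v) := by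
  -- `step1` runs through the strings of one length, `step2` along a diagonal of constant `g + L`,
  -- and `step3` from one diagonal to the next.
  have step1 : ∀ g L, (∃ t, pairSeq t = (g, L, 0)) → ∀ v < 2 ^ L, ∃ t, pairSeq t = (g, L, v) := by
    intro g L h0 v
    induction v with
    | zero => exact fun _ => h0
    | succ v ih =>
      intro hv
      obtain ⟨t, ht⟩ := ih (by omega)
      exact ⟨t + 1, by rw [pairSeq_succ, ht, nextPair, if_pos hv]⟩
  have hend : ∀ L, ¬ 2 ^ L - 1 + 1 < 2 ^ L := fun L => by
    have := Nat.one_le_two_pow (n := L)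
    omega
  have step2 : ∀ T, (∃ t, pairSeq t = (T, 0, 0)) → ∀ L ≤ T, ∃ t, pairSeq t = (T - L, L, 0) := by
    intro T h0 L
    induction L with
    | zero => exact fun _ => h0
    | succ L ih =>
      intro hL
      obtain ⟨t, ht⟩ := step1 _ _ (ih (by omega)) (2 ^ L - 1) (Nat.sub_lt (by positivity) one_pos)
      refine ⟨t + 1, ?_⟩
      rw [pairSeq_succ, ht, nextPair, if_neg (hend L), if_pos (by omega)]
      congr 1
  have step3 : ∀ T, ∃ t, pairSeq t = (T, 0, 0) := by
    intro T
    induction T with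
    | zero => exact ⟨0, rfl⟩
    | succ T ih =>
      obtain ⟨t, ht⟩ := step1 _ _ (step2 T ih T le_rfl) (2 ^ T - 1) (Nat.sub_lt (by positivity) one_pos)
      refine ⟨t + 1, ?_⟩
      rw [pairSeq_succ, ht, nextPair, if_neg (hend T), if_neg (by omega)]
  have := step1 _ _ (step2 (g + L) (step3 _) L (by omega)) v hv
  rwa [Nat.add_sub_cancel] at this

section

variable {S : Type} [Finite S] {M : Micro S}

/-- At the `t`-th pair of the enumeration the string becomes popular. -/
def Micro.Discovered (M : Micro S) (n m t : ℕ) : Prop :=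
  M.Popular n m (3 * (pairSeq t).1) (bits (pairSeq t).2.1 (pairSeq t).2.2) ∧
    ∀ g < (pairSeq t).1, ¬ M.Popular n m (3 * g) (bits (pairSeq t).2.1 (pairSeq t).2.2)

-- A string is discovered only at its least bound, so different discoveries concern different
-- strings. Their sets of accepted programs are disjoint, have at least 2^m elements each, and lie
-- in a set of size 2^n.
open Classical in
omit [Finite S] in
theorem Micro.count_discovered (n m r : ℕ) :
    Nat.count (M.Discovered n m) r * 2 ^ m ≤ 2 ^ n := by
  rw [Nat.count_eq_card_filter_range]
  set A : ℕ → Finset ℕ := fun t => (Finset.range (2 ^ n)).filter fun v =>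
    M.Accepts (3 * (pairSeq t).1) (bits (pairSeq t).2.1 (pairSeq t).2.2) (bits n v) with hA
  have hdisj : ((Finset.range r).filter (M.Discovered n m) : Set ℕ).PairwiseDisjoint A := by
    intro t ht t' ht' hne
    have hd : M.Discovered n m t := (Finset.mem_filter.1 ht).2
    have hd' : M.Discovered n m t' := (Finset.mem_filter.1 ht').2
    refine Finset.disjoint_left.2 fun v hv hv' => hne (pairSeq_injective ?_)
    have hx := ((Finset.mem_filter.1 hv).2).unique ((Finset.mem_filter.1 hv').2)
    have hlt := pairSeq_lt t
    have hlt' := pairSeq_lt t'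
    simp only [Micro.Discovered] at hd hd'
    generalize pairSeq t = e at *
    generalize pairSeq t' = e' at *
    obtain ⟨g, L, u⟩ := e
    obtain ⟨g', L', u'⟩ := e'
    simp only at *
    have hL : L = L' := by simpa using congrArg List.length hx
    subst hL
    have hu := bits_injOn hlt hlt' hx
    subst hu
    have hg : g = g' := by
      rcases lt_trichotomy g g' with h | h | h
      · exact absurd hd.1 (hd'.2 _ h)
      · exact h
      · exact absurd hd'.1 (hd.2 _ h)
    rw [hg]
  have h1 : ((Finset.range r).filter (M.Discovered n m)).card • 2 ^ m ≤
      ∑ t ∈ (Finset.range r).filter (M.Discovered n m), (A t).card := by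
    refine Finset.card_nsmul_le_sum _ _ _ fun t ht => ?_
    have := (Finset.mem_filter.1 ht).2.1
    rwa [Micro.Popular, Nat.count_eq_card_filter_range] at this
  rw [← Finset.card_biUnion hdisj, smul_eq_mul] at h1
  refine h1.trans ?_
  calc _ ≤ (Finset.range (2 ^ n)).card := Finset.card_le_card (Finset.biUnion_subset.2
        fun t _ => Finset.filter_subset _ _)
    _ = 2 ^ n := Finset.card_range _

/-- Pass to the next pair. -/
def nextPairProg : RProg (Ctl S) :=
  .seq (bump .xr true false) (.ite (fun k => k.cy) (.seq dec3 (.ite (fun k => k.cy)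
    (.seq (drain (.reg .xr) inc3) ext3) (pushS (.reg .xr) fun _ => false))) nop)

/-- The frame in the search of the first component. -/
def pairFrame (m : ℕ) (l : List Bool) (e : ℕ × ℕ × ℕ) : Frame :=
  ⟨[], bits e.2.1 e.2.2, bits m 0, l, 3 * e.1, (3 * (e.1 + e.2.1)).size⟩

variable {s : ℕ} {k : Ctl S} {p c o : List Bool} {Q : Data (Ctl S) → Prop}

-- Lowering `g` by one releases three cells of the simulation, which is the price of one more bit of
-- the candidate; for this reason the bounds are multiples of three. Along a diagonal the reserved
-- memory and the width of `fr` stay the same. At its end the candidate is converted into free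
-- space, three units per bit, and three further units are added with an extension of `fr` if
-- necessary.
omit [Finite S] in
theorem wp_nextPairProg {m : ℕ} {l q : List Bool} {e : ℕ × ℕ × ℕ} {t : S}
    (he : e.2.2 < 2 ^ e.2.1)
    (hw : ((pairFrame m l e).store (.initial t q)).weight ≤ s)
    (hw' : ((pairFrame m l (nextPair e)).store (.initial t q)).weight ≤ s)
    (hQ : ∀ k', Q ⟨k', (pairFrame m l (nextPair e)).store (.initial t q), p, c, o⟩) :
    Wp s nextPairProg Q ⟨k, (pairFrame m l e).store (.initial t q), p, c, o⟩ := by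
  obtain ⟨g, L, v⟩ := e
  simp only at he
  simp only [nextPair] at hw' hQ
  refine wp_seq.2 (wp_inc (w := L) (v := v) rfl hw ?_)
  by_cases h1 : v + 1 < 2 ^ L
  · simp only [if_pos h1] at hw' hQ
    exact wp_ite_false (decide_eq_false (not_dvd_of_lt h1)) (wp_nop hw' (hQ _))
  simp only [if_neg h1] at hw' hQ
  obtain hv : v + 1 = 2 ^ L := by omega
  rw [hv, bits_pow]
  have hw0 : ((pairFrame m l (g, L, 0)).store (.initial t q)).weight ≤ s := by
    simpa [Store.weight, Frame.store, pairFrame] using hw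
  have e0 : ((pairFrame m l (g, L, v)).store (.initial t q)).set (.reg .xr) (bits L 0) =
      (pairFrame m l (g, L, 0)).store (.initial t q) := rfl
  rw [e0]
  refine wp_ite_true (decide_eq_true dvd_rfl) (wp_seq.2 (wp_dec3 (w := (3 * (g + L)).size) (g := g)
    rfl ((Nat.lt_size_self _).trans_le' (by omega)) hw0 ?_ ?_))
  · rintro rfl
    simp only [lt_irrefl, if_false] at hw' hQ
    refine wp_ite_true rfl (wp_seq.2 ?_)
    set T : List Bool → Store := fun a => (⟨[], a, bits m 0, l, 3 * (L - a.length),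
      (3 * (0 + L)).size⟩ : Frame).store (.initial t q) with hT
    have hwT : ∀ a : List Bool, a.length ≤ L → (T a).weight ≤ s := fun a ha => by
      refine le_trans ?_ hw0
      simp [hT, Store.weight, Frame.store, pairFrame]
      omega
    have e1 : (pairFrame m l (0, L, 0)).store (.initial t q) = T (bits L 0) := by
      simp [hT, pairFrame]
    rw [e1]
    refine wp_drain T (fun _ => o) (fun _ => rfl) _ (fun a ha => hwT a ?_) ?_ ?_
    · simpa using ha.length_le
    · intro b a k' Q' ha hr hsl hQ'
      have hlen : a.length + 1 ≤ L := by simpa using ha.length_le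
      have e2 : 3 * (L - (a.length + 1)) + 3 = 3 * (L - a.length) := by omega
      refine wp_inc3 (w := (3 * (0 + L)).size) (v := 3 * (L - (a.length + 1))) rfl ?_ ?_ ?_
      · exact (Nat.lt_size_self _).trans_le' (by omega)
      · exact (weight_set_tail (st := T (b :: a)) (.reg .xr)).trans (hwT _ hlen)
      · rw [e2]; exact hQ' _ ⟨rfl, rfl, rfl⟩ hr
    · intro k' _
      refine wp_ext3 (v := 3 * L) ?_ ?_ fun cy => ?_
      · simp [hT, Frame.store, Store.get, Conf.initial, Conf.space]
      all_goals
        have e3 : (T []).set (.reg .fr) (bits (3 * L + 3).size (3 * L + 3)) =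
            (pairFrame m l (L + 1, 0, 0)).store (.initial t q) := by
          simp [hT, Frame.store, Store.set, Conf.initial, Conf.space, pairFrame, mul_add, bits]
        rw [e3]
      · exact hw'
      · exact hQ _
  · rintro g' rfl
    simp only [Nat.succ_pos, if_true, Nat.add_sub_cancel] at hw' hQ
    have e1 : (((pairFrame m l (g' + 1, L, 0)).store (.initial t q)).set (.reg .fr)
        (bits (3 * (g' + 1 + L)).size (3 * g'))).set (.reg .xr) (false ::
        (((pairFrame m l (g' + 1, L, 0)).store (.initial t q)).set (.reg .fr)
        (bits (3 * (g' + 1 + L)).size (3 * g'))).get (.reg .xr)) =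
        (pairFrame m l (g', L + 1, 0)).store (.initial t q) := by
      have : g' + 1 + L = g' + (L + 1) := by ring
      simp [Frame.store, Store.set, Store.get, Conf.initial, Conf.space, pairFrame, bits, this]
    refine wp_ite_false rfl (wp_pushS ?_ ?_)
    · rw [e1]; exact hw'
    · rw [e1]; exact hQ _

variable (M) in
/-- The program that produces the first component of a pair. -/
noncomputable def firstProg : RProg (Ctl S) :=
  .seq (readNum .pr) (.seq (readNum .ct) (.seq (readAll readProgSlot .ix)
    (searchProg (newProg (countProg M))
      (drain (.reg .xr) (.prim (.write fun k => k.slot.getD false))) nextPairProg)))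

/-- The initial control memory. -/
noncomputable def Ctl.init (t : S) : Ctl S := ⟨t, 0, true, false, false, none, false, .even, false⟩

variable (M) in
noncomputable def firstMachine : StackMachine := RProg.toMachine (firstProg M) (Ctl.init M.start)

-- The program contains `n` and `m` in self-delimiting form and the index 2^(n-m) - N, where N is
-- the rank of the discovery of `x`; `count_discovered` makes it fit in `n - m` digits. The least
-- bound `g₁` is at most `g`, so the search stays within the diagonal of `g + x.length`.
open Classical in
theorem exists_first {n m g : ℕ} {x : List Bool} (h : M.Popular n m (3 * g) x) :
    ∃ p, p.length = 2 * n.size + 2 * m.size + 4 + (n - m) ∧ (firstMachine M).Produces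
      (3 * (g + x.length) + 3 * (3 * (g + x.length)).size + 12 * n + 24) p [] x := by
  have hmn : m ≤ n := (Nat.pow_le_pow_iff_right (by norm_num)).1 (h.trans (Nat.count_le _))
  have hex : ∃ g', M.Popular n m (3 * g') x := ⟨g, h⟩
  set g₁ := Nat.find hex with hg₁
  have hg₁g : g₁ ≤ g := Nat.find_le h
  obtain ⟨v, hv, hx⟩ := exists_eq_bits x
  obtain ⟨r, hr⟩ := exists_pairSeq g₁ x.length v hv
  have hE : M.Discovered n m r := by
    simp only [Micro.Discovered, hr, ← hx]
    exact ⟨Nat.find_spec hex, fun g' hg' => Nat.find_min hex hg'⟩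
  set N := Nat.count (M.Discovered n m) (r + 1) with hN
  have hNle : N ≤ 2 ^ (n - m) := by
    have h1 := Micro.count_discovered (M := M) n m (r + 1)
    have h2 : 2 ^ n = 2 ^ (n - m) * 2 ^ m := by rw [← pow_add, Nat.sub_add_cancel hmn]
    rw [h2] at h1
    exact Nat.le_of_mul_le_mul_right h1 (by positivity)
  -- The index is written in reverse because `readAll` pushes the bits that it reads.
  refine ⟨pairCode (numeral n) (pairCode (numeral m) (bits (n - m) (2 ^ (n - m) - N)).reverse),
    by simp [length_pairCode]; omega, ?_⟩
  set s := 3 * (g + x.length) + 3 * (3 * (g + x.length)).size + 12 * n with hs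
  suffices hW : Wp s (firstProg M) (fun d => d.out = x) ⟨Ctl.init M.start, .empty,
      pairCode (numeral n) (pairCode (numeral m) (bits (n - m) (2 ^ (n - m) - N)).reverse),
      [], []⟩ by
    obtain ⟨d, hd, rfl⟩ := hW
    exact RProg.produces_toMachine hd
  have hsize : ∀ i : ℕ, i.size ≤ i := fun i => Nat.size_le.2 Nat.lt_two_pow_self
  have hnn := hsize n
  have hmm := hsize m
  refine wp_seq.2 (wp_readNum (fun a b => ⟨[], [], [], b, [], [], a, [], []⟩) (fun _ _ => rfl)
    (fun _ _ => rfl) (fun _ _ _ => rfl) (fun _ _ _ => rfl) ?_ fun k1 => ?_)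
  · intro a b ha hb
    simp [Store.weight]
    omega
  refine wp_seq.2 (wp_readNum (fun a b => ⟨[], [], [], bits n 0, [], [], a, b, []⟩) (fun _ _ => rfl)
    (fun _ _ => rfl) (fun _ _ _ => rfl) (fun _ _ _ => rfl) ?_ fun k2 => ?_)
  · intro a b ha hb
    simp [Store.weight]
    omega
  refine wp_seq.2 (wp_readAll (fun a => ⟨[], [], [], bits n 0, [], [], [], bits m 0, a⟩)
    (fun l => l) (fun _ => [])
    (fun _ _ _ _ h1 h2 => wp_readProgSlot h1 h2) (fun _ => rfl) (fun _ _ => rfl) ?_ fun k3 => ?_)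
  · intro a ha
    simp at ha
    simp [Store.weight]
    omega
  -- Pairs that precede the target have no larger sum `g + L`, and this sum determines the width of
  -- `fr`.
  have hfit : ∀ t ≤ r, ∀ l : List Bool, l.length = n - m → ∀ q : List Bool, q.length = n →
      (pairFrame m l (pairSeq t)).Fits s q := by
    intro t ht l hl q hq
    have h1 := pairSeq_sum_mono ht
    rw [hr] at h1
    simp only at h1
    refine ⟨(Nat.lt_size_self _).trans_le' (by simp only [pairFrame]; omega), ?_⟩
    have h2 : (3 * ((pairSeq t).1 + (pairSeq t).2.1)).size ≤ (3 * (g + x.length)).size :=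
      Nat.size_le_size (by omega)
    simp only [Frame.bound, pairFrame, List.length_nil, length_bits, hl, hq, hs]
    omega
  rw [List.reverse_reverse]
  refine wp_searchProg (E := M.Discovered n m) (r := r)
    (fun t l => (pairFrame m l (pairSeq t)).store (.initial M.start (bits n 0)))
    (fun _ _ => rfl) (fun _ _ _ => rfl) ?_ ?_ ?_ ?_ hE (by omega)
  · intro t ht l hl
    exact (hfit t ht l hl _ (by simp)).weight_le Frame.Fits.valid_initial
  · intro t ht l hl k Q hQ
    have hF := hfit t ht l hl (bits n 0) (by simp)
    exact wp_newProg (F := pairFrame m l (pairSeq t)) (g := (pairSeq t).1)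
      (B := fun g => M.Popular n m (3 * g) (bits (pairSeq t).2.1 (pairSeq t).2.2))
      (fun g g' hg h' => h'.mono (by omega)) hF
      (fun g' hg' k Q hQ => wp_countProg (Frame.Fits.at_le (F := pairFrame m l (pairSeq t))
        (g := (pairSeq t).1) hF hg') rfl rfl hQ) hQ
  · intro t ht l hl k Q hQ
    refine wp_nextPairProg (pairSeq_lt t) ?_ ?_ fun k' => ?_
    · exact (hfit t (by omega) l hl _ (by simp)).weight_le Frame.Fits.valid_initial
    · rw [← pairSeq_succ]
      exact (hfit (t + 1) (by omega) l hl _ (by simp)).weight_le Frame.Fits.valid_initial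
    · rw [← pairSeq_succ]
      exact hQ k'
  · intro l hl k Q hQ
    have hF := hfit r le_rfl l hl (bits n 0) (by simp)
    have hw : ∀ a : List Bool, a.length ≤ x.length → (({ pairFrame m l (pairSeq r) with
        xr := a } : Frame).store (.initial M.start (bits n 0))).weight ≤ s := by
      intro a ha
      refine le_trans ?_ (hF.weight_le (Frame.Fits.valid_initial (t := M.start)))
      simp [Store.weight, Frame.store, pairFrame, hr]
      omega
    have e : (pairFrame m l (pairSeq r)).store (.initial M.start (bits n 0)) =
        ({ pairFrame m l (pairSeq r) with xr := x } : Frame).store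
          (.initial M.start (bits n 0)) := by
      have : (pairFrame m l (pairSeq r)).xr = x := by simp only [pairFrame, hr]; exact hx.symm
      rw [← this]
    rw [e]
    have := wp_drain (s := s) (k := k) (p := []) (c := []) (Q := Q) (i := .reg .xr)
      (P := .prim (.write fun k => k.slot.getD false))
      (fun a => ({ pairFrame m l (pairSeq r) with xr := a } : Frame).store
        (.initial M.start (bits n 0))) (fun a => x.take (x.length - a.length)) (fun _ => rfl) x
      (fun a ha => hw a ha.length_le) ?_ ?_
    · simpa using this
    · intro b a k' Q' ha hr' hsl hQ'
      refine wp_prim.2 ⟨?_, ?_⟩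
      · exact hw a (by have := ha.length_le; simp at this; omega)
      · have e2 : x.take (x.length - (b :: a).length) ++ [b] = x.take (x.length - a.length) := by
          obtain ⟨z, rfl⟩ := ha
          have h3 : (z ++ b :: a).length - (b :: a).length = z.length := by simp
          have h4 : (z ++ b :: a).length - a.length = (z ++ [b]).length := by simp; omega
          rw [h3, h4, List.take_left]
          have : z ++ b :: a = (z ++ [b]) ++ a := by simp
          rw [this, List.take_left]
        have := hQ' k' ⟨rfl, rfl, rfl⟩ hr'
        simp only [← e2] at this
        simp only [Op.sem, hsl, Option.getD_some]
        exact this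
    · intro k' _
      simpa using hQ k' _ (hw [] (by simp))

end

end StackMachine

/-! ### Description of the second component given the first -/

namespace StackMachine

section

variable {S : Type} [Finite S] {M : Micro S}

/-- The `t`-th pair of a space bound and a program of length `n` is the first one with this program
that is accepted. -/
def Micro.Settled (M : Micro S) (n : ℕ) (x : List Bool) (t : ℕ) : Prop :=
  M.Accepts (3 * (t / 2 ^ n)) x (bits n (t % 2 ^ n)) ∧
    ∀ g < t / 2 ^ n, ¬ M.Accepts (3 * g) x (bits n (t % 2 ^ n))

-- A program settles only once, at its least bound, and one that settles at a bound up to `g` is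
-- accepted at `3 * g`. Taking remainders therefore embeds the settled positions in the accepted
-- programs.
open Classical in
omit [Finite S] in
theorem Micro.count_settled {n g r : ℕ} {x : List Bool} (hr : r ≤ (g + 1) * 2 ^ n) :
    Nat.count (M.Settled n x) r ≤
      Nat.count (fun v => M.Accepts (3 * g) x (bits n v)) (2 ^ n) := by
  rw [Nat.count_eq_card_filter_range, Nat.count_eq_card_filter_range]
  refine Finset.card_le_card_of_injOn (fun t => t % 2 ^ n) ?_ ?_
  · intro t ht
    obtain ⟨ht, hs⟩ := Finset.mem_filter.1 ht
    refine Finset.mem_filter.2 ⟨Finset.mem_range.2 (Nat.mod_lt _ (by positivity)), hs.1.mono ?_⟩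
    have : t / 2 ^ n < g + 1 :=
      Nat.div_lt_of_lt_mul (by rw [mul_comm]; exact (Finset.mem_range.1 ht).trans_le hr)
    omega
  · intro t ht t' ht' h
    have hs : M.Settled n x t := (Finset.mem_filter.1 ht).2
    have hs' : M.Settled n x t' := (Finset.mem_filter.1 ht').2
    simp only at h
    have hdiv : t / 2 ^ n = t' / 2 ^ n := by
      rcases lt_trichotomy (t / 2 ^ n) (t' / 2 ^ n) with h1 | h1 | h1
      · exact absurd hs.1 (h ▸ hs'.2 _ h1)
      · exact h1
      · exact absurd hs'.1 (h ▸ hs.2 _ h1)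
    rw [← Nat.div_add_mod t (2 ^ n), ← Nat.div_add_mod t' (2 ^ n), h, hdiv]

/-- Pass to the next program, or enlarge the space bound if there is none. -/
def nextProgram : RProg (Ctl S) :=
  .seq (bump .pr true false) (.ite (fun k => k.cy) ext3 nop)

/-- The frame in the search of the second component. -/
def programFrame (x l : List Bool) (g : ℕ) : Frame := ⟨[], x, [], l, 3 * g, (3 * g).size⟩

/-- The registers in the search of the second component. -/
def programStore (x l : List Bool) (n t : ℕ) : Store :=
  (programFrame x l (t / 2 ^ n)).store (.initial () (bits n (t % 2 ^ n)))

variable {s : ℕ} {k : Ctl S} {p c o : List Bool} {Q : Data (Ctl S) → Prop}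

-- The overflow of the program register is the carry from `t % 2 ^ n` to `t / 2 ^ n`. The stacks are
-- empty at this moment, so `fr` holds the whole bound and can simply be increased by three.
omit [Finite S] in
theorem wp_nextProgram {x l : List Bool} {n t : ℕ} (hw : (programStore x l n t).weight ≤ s)
    (hw' : (programStore x l n (t + 1)).weight ≤ s)
    (hQ : ∀ k', Q ⟨k', programStore x l n (t + 1), p, c, o⟩) :
    Wp s nextProgram Q ⟨k, programStore x l n t, p, c, o⟩ := by
  have hpos : 0 < 2 ^ n := by positivity
  have hlt := Nat.mod_lt t hpos
  have hdm := Nat.div_add_mod t (2 ^ n)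
  refine wp_seq.2 (wp_inc (w := n) (v := t % 2 ^ n) rfl hw ?_)
  by_cases h1 : t % 2 ^ n + 1 < 2 ^ n
  · have e : t + 1 = t % 2 ^ n + 1 + 2 ^ n * (t / 2 ^ n) := by omega
    have e1 : (t + 1) / 2 ^ n = t / 2 ^ n := by
      rw [e, Nat.add_mul_div_left _ _ hpos, Nat.div_eq_of_lt h1, zero_add]
    have e2 : (t + 1) % 2 ^ n = t % 2 ^ n + 1 := by
      rw [e, Nat.add_mul_mod_self_left, Nat.mod_eq_of_lt h1]
    have e3 : (programStore x l n t).set (.reg .pr) (bits n (t % 2 ^ n + 1)) =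
        programStore x l n (t + 1) := by
      unfold programStore
      rw [e1, e2]
      rfl
    rw [e3]
    exact wp_ite_false (decide_eq_false (not_dvd_of_lt h1)) (wp_nop hw' (hQ _))
  · have h2 : t % 2 ^ n + 1 = 2 ^ n := by omega
    have e : t + 1 = 2 ^ n * (t / 2 ^ n + 1) := by rw [mul_add]; omega
    have e1 : (t + 1) / 2 ^ n = t / 2 ^ n + 1 := by rw [e, Nat.mul_div_cancel_left _ hpos]
    have e2 : (t + 1) % 2 ^ n = 0 := by rw [e, Nat.mul_mod_right]
    have e3 : ((programStore x l n t).set (.reg .pr) (bits n (t % 2 ^ n + 1))).set (.reg .fr)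
        (bits (3 * (t / 2 ^ n) + 3).size (3 * (t / 2 ^ n) + 3)) =
        programStore x l n (t + 1) := by
      unfold programStore
      rw [e1, e2, h2, bits_pow]
      simp [Frame.store, Store.set, Conf.initial, Conf.space, programFrame, mul_add]
    refine wp_ite_true (decide_eq_true (dvd_of_eq h2.symm))
      (wp_ext3 (v := 3 * (t / 2 ^ n)) rfl ?_ fun cy => ?_)
    · rw [e3]; exact hw'
    · rw [e3]; exact hQ _

variable (M) in
/-- The program that produces the second component of a pair, given the first. -/
noncomputable def secondProg : RProg (Ctl S) :=
  .seq (readNum .pr) (.seq (readAll readProgSlot .ix) (.seq (readAll readCondSlot .xd)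
    (.seq (moveAll (.reg .xd) (.reg .xr))
      (searchProg (newProg (acceptProg M)) (runProg M true) nextProgram))))

variable (M) in
noncomputable def secondMachine : StackMachine := RProg.toMachine (secondProg M) (Ctl.init M.start)

-- The program of the description gives `n` and the rank of `q` among the settled programs, which is
-- at most 2^W because `q` settles at a bound not exceeding `g`. Its output at this smaller bound is
-- the same, so simulating it there and copying what follows the code of `x` yields `y`.
open Classical in
theorem exists_second {g W : ℕ} {x y q : List Bool} (h : M.Outputs (3 * g) q (pairCode x y))
    (hW : Nat.count (fun v => M.Accepts (3 * g) x (bits q.length v)) (2 ^ q.length) ≤ 2 ^ W) :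
    ∃ p, p.length = 2 * q.length.size + 2 + W ∧ (secondMachine M).Produces
      (3 * g + 3 * (3 * g).size + 3 * x.length + 6 * q.length + 3 * W + 24) p x y := by
  obtain ⟨n, hn⟩ : ∃ n, n = q.length := ⟨_, rfl⟩
  rw [← hn] at hW ⊢
  have hex : ∃ g', M.Accepts (3 * g') x q := ⟨g, y, h⟩
  set g₁ := Nat.find hex with hg₁
  have hg₁g : g₁ ≤ g := Nat.find_le ⟨y, h⟩
  have hspec : M.Accepts (3 * g₁) x q := Nat.find_spec hex
  obtain ⟨v, hv, hq⟩ := exists_eq_bits q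
  rw [← hn] at hv hq
  -- The position of the program `q` with its least bound in the enumeration.
  set r := v + 2 ^ n * g₁ with hr
  have hpos : 0 < 2 ^ n := by positivity
  have hdiv : r / 2 ^ n = g₁ := by
    rw [hr, Nat.add_mul_div_left _ _ hpos, Nat.div_eq_of_lt hv, zero_add]
  have hmod : r % 2 ^ n = v := by
    rw [hr, Nat.add_mul_mod_self_left, Nat.mod_eq_of_lt hv]
  have hE : M.Settled n x r := by
    unfold Micro.Settled
    rw [hdiv, hmod, ← hq]
    exact ⟨hspec, fun g' hg' => Nat.find_min hex hg'⟩
  set N := Nat.count (M.Settled n x) (r + 1) with hN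
  have hNle : N ≤ 2 ^ W := by
    refine (Micro.count_settled ?_).trans hW
    have : 2 ^ n * g₁ ≤ 2 ^ n * g := Nat.mul_le_mul_left _ hg₁g
    rw [add_mul, one_mul, mul_comm g]
    omega
  refine ⟨pairCode (numeral n) (bits W (2 ^ W - N)).reverse, by simp [length_pairCode], ?_⟩
  set s := 3 * g + 3 * (3 * g).size + 3 * x.length + 6 * n + 3 * W with hs
  suffices hWp : Wp s (secondProg M) (fun d => d.out = y) ⟨Ctl.init M.start, .empty,
      pairCode (numeral n) (bits W (2 ^ W - N)).reverse, x, []⟩ by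
    obtain ⟨d, hd, rfl⟩ := hWp
    exact RProg.produces_toMachine hd
  have hnn : n.size ≤ n := Nat.size_le.2 Nat.lt_two_pow_self
  refine wp_seq.2 (wp_readNum (fun a b => ⟨[], [], [], b, [], [], a, [], []⟩) (fun _ _ => rfl)
    (fun _ _ => rfl) (fun _ _ _ => rfl) (fun _ _ _ => rfl) ?_ fun k1 => ?_)
  · intro a b ha hb
    simp [Store.weight]
    omega
  refine wp_seq.2 (wp_readAll (fun a => ⟨[], [], [], bits n 0, [], [], [], [], a⟩)
    (fun l => l) (fun _ => x)
    (fun _ _ _ _ h1 h2 => wp_readProgSlot h1 h2) (fun _ => rfl) (fun _ _ => rfl) ?_ fun k2 => ?_)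
  · intro a ha
    simp at ha
    simp [Store.weight]
    omega
  rw [List.reverse_reverse]
  refine wp_seq.2 (wp_readAll
    (fun a => ⟨[], [], [], bits n 0, a, [], [], [], bits W (2 ^ W - N)⟩)
    (fun _ => []) (fun l => l)
    (fun _ _ _ _ h1 h2 => wp_readCondSlot h1 h2) (fun _ => rfl) (fun _ _ => rfl) ?_ fun k3 => ?_)
  · intro a ha
    simp [Store.weight]
    omega
  have hfit : ∀ t ≤ r, ∀ l : List Bool, l.length = W → ∀ q : List Bool, q.length = n →
      (programFrame x l (t / 2 ^ n)).Fits s q := by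
    intro t ht l hl q hq
    have h1 : t / 2 ^ n ≤ g := ((Nat.div_le_div_right ht).trans_eq hdiv).trans hg₁g
    have h2 : (3 * (t / 2 ^ n)).size ≤ (3 * g).size := Nat.size_le_size (by omega)
    refine ⟨Nat.lt_size_self _, ?_⟩
    simp only [Frame.bound, programFrame, List.length_nil, hl, hq, hs]
    omega
  have hw : ∀ t ≤ r, ∀ l : List Bool, l.length = W → (programStore x l n t).weight ≤ s :=
    fun t ht l hl => (hfit t ht l hl _ (by simp)).weight_le Frame.Fits.valid_initial
  have e0 : (⟨[], [], [], bits n 0, x.reverse, [], [], [], bits W (2 ^ W - N)⟩ : Store) =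
      (⟨x.reverse, [], [], bits W (2 ^ W - N), 0, 0⟩ : Frame).store
        (.initial M.start (bits n 0)) := rfl
  rw [e0]
  refine wp_seq.2 (wp_moveAll_word ⟨by simp, by simp [Frame.bound]; omega⟩
    Frame.Fits.valid_initial fun k4 _ => ?_)
  have e1 : ({ (⟨x.reverse, [], [], bits W (2 ^ W - N), 0, 0⟩ : Frame) with
      xd := [], xr := x.reverse.reverse ++ [] } : Frame).store (.initial M.start (bits n 0)) =
      programStore x (bits W (2 ^ W - N)) n 0 := by
    simp [Frame.store, Conf.initial, Conf.space, programStore, programFrame]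
  refine cast (congrArg (fun st => Wp s (searchProg (newProg (acceptProg M)) (runProg M true)
    nextProgram) (fun d => d.out = y) ⟨k4, st, [], [], []⟩) e1.symm) ?_
  refine wp_searchProg (E := M.Settled n x) (r := r) (fun t l => programStore x l n t)
    (fun _ _ => rfl) (fun _ _ _ => rfl) hw ?_ ?_ ?_ hE (by omega)
  · intro t ht l hl k Q hQ
    have hF := hfit t ht l hl (bits n (t % 2 ^ n)) (by simp)
    exact wp_newProg (F := programFrame x l (t / 2 ^ n)) (g := t / 2 ^ n) (t := M.start)
      (B := fun g => M.Accepts (3 * g) x (bits n (t % 2 ^ n)))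
      (fun g g' hg h' => h'.mono (by omega)) hF
      (fun g' hg' k Q hQ => wp_acceptProg (Frame.Fits.at_le (F := programFrame x l (t / 2 ^ n))
        (g := t / 2 ^ n) hF hg') rfl fun k' _ h' => hQ k' h') hQ
  · intro t ht l hl k Q hQ
    exact wp_nextProgram (hw t (by omega) l hl) (hw (t + 1) (by omega) l hl) hQ
  · intro l hl k Q hQ
    have hF := hfit r le_rfl l hl (bits n (r % 2 ^ n)) (by simp)
    obtain ⟨y', hy'⟩ := hspec
    obtain rfl : y' = y := (pairCode_inj (hy'.unique h)).2
    refine wp_emit (F := programFrame x l (r / 2 ^ n)) (y := y') hF rfl ?_ hQ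
    rw [hdiv, hmod, ← hq]
    exact hy'

end

end StackMachine

/-! ### The upper bound for the sum of complexities -/

namespace StackMachine

theorem Produces.mono {M : StackMachine} {s t : ℕ} (hst : s ≤ t) {p x y : List Bool}
    (h : M.Produces s p x y) : M.Produces t p x y := by
  obtain ⟨c, h1, h2⟩ := h
  exact ⟨c, Relation.ReflTransGen.mono (fun _ _ h => ⟨h.1, h.2.trans hst⟩) _ _ h1, h2⟩

theorem condKS_anti {M : StackMachine} {s t : ℕ} (hst : s ≤ t) (y x : List Bool) :
    M.condKS t y x ≤ M.condKS s y x :=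
  le_iInf₂ fun _ h => condKS_le_of_produces (h.mono hst)

theorem exists_of_condKS_le {M : StackMachine} {s n : ℕ} {y x : List Bool}
    (h : M.condKS s y x ≤ n) : ∃ p, M.Produces s p x y ∧ p.length ≤ n := by
  have h1 : M.condKS s y x < (n + 1 : ℕ) := lt_of_le_of_lt h (by exact_mod_cast Nat.lt_succ_self n)
  simp only [condKS, iInf_lt_iff] at h1
  obtain ⟨p, hp, hlt⟩ := h1
  exact ⟨p, hp, Nat.lt_succ_iff.1 (by exact_mod_cast hlt)⟩

/-- Copy the program to the output. -/
def copyProg : RProg (Ctl Unit) :=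
  .seq (setC fun k => { k with run := true }) (.loop (fun k => k.run) (.seq readProgSlot
    (.ite (fun k => k.slot.isSome) (.prim (.write fun k => k.slot.getD false))
      (setC fun k => { k with run := false }))))

noncomputable def copyMachine : StackMachine := RProg.toMachine copyProg (Ctl.init ())

theorem produces_copyMachine (z x : List Bool) : copyMachine.Produces 24 z x z := by
  have hw : Store.empty.weight ≤ 0 := by simp [Store.empty, Store.weight]
  suffices h : Wp 0 copyProg (fun d => d.out = z) ⟨Ctl.init (), .empty, z, x, []⟩ by
    obtain ⟨d, hd, hout⟩ := h
    have := RProg.produces_toMachine hd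
    rwa [hout] at this
  refine wp_seq.2 (wp_setC hw ?_)
  have key : ∀ (l o : List Bool) (k : Ctl Unit), k.run = true → o ++ l = z →
      Wp 0 (.loop (fun k => k.run) (.seq readProgSlot
        (.ite (fun k => k.slot.isSome) (.prim (.write fun k => k.slot.getD false))
          (setC fun k => { k with run := false })))) (fun d => d.out = z)
        ⟨k, .empty, l, x, o⟩ := by
    intro l
    induction l with
    | nil =>
      rintro o k hr rfl
      exact wp_loop_true hr (wp_seq.2 (wp_readProgSlot hw (wp_ite_false rfl (wp_setC hw
        (wp_loop_false rfl (List.append_nil _).symm)))))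
    | cons b l ih =>
      intro o k hr hl
      exact wp_loop_true hr (wp_seq.2 (wp_readProgSlot hw (wp_ite_true rfl (wp_prim.2
        ⟨hw, ih _ _ hr (by simpa using hl)⟩))))
  exact key z [] _ rfl rfl

end StackMachine

/-! ### Logarithmic estimates and the final inequality -/

theorem one_le_log2 (n : ℕ) : 1 ≤ log2 n :=
  Nat.le_log_of_pow_le (by norm_num) (by omega)

theorem add_two_lt_pow_log2 (n : ℕ) : n + 2 < 2 ^ (log2 n + 1) := Nat.lt_pow_succ_log_self (by norm_num) _

/-- A crude bound, one digit per unit of `b`. It suffices because `b` will be linear in the length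
of `x`, and linear terms of this kind are permitted in the space bound. -/
theorem size_add_le (n b : ℕ) : (n + 2 + b).size ≤ log2 n + 1 + b := by
  refine Nat.size_le.2 ?_
  have h1 := add_two_lt_pow_log2 n
  have h2 : b < 2 ^ b := Nat.lt_two_pow_self
  rw [pow_add 2 (log2 n + 1) b]
  nlinarith

open StackMachine

-- The hypothesis `hn` allows all registers of length O(n) to be charged to the lengths of `x` and
-- `y`.
open Classical in
theorem exists_descriptions (V : StackMachine) {s n : ℕ} {x y : List Bool}
    (h : V.pairKS s x y ≤ n) (hn : n ≤ x.length + y.length) : ∃ a b : ℕ,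
    a + b ≤ n + 12 * log2 n + 7 ∧
      (firstMachine (sim V)).condKS (s + 3 * log2 s + 24 * (x.length + y.length) + 60) x [] ≤ a ∧
      (secondMachine (sim V)).condKS (s + 3 * log2 s + 24 * (x.length + y.length) + 60) y x ≤ b := by
  obtain ⟨q, hq, hqn⟩ := exists_of_condKS_le h
  -- Then `3 * g` lies between `s + 2`, the space needed by `sim V`, and `s + 5`.
  set g := (s + 2) / 3 + 1 with hg
  have hout : (sim V).Outputs (3 * g) q (pairCode x y) := hq.outputs_sim.mono (by omega)
  set N := Nat.count (fun v => (sim V).Accepts (3 * g) x (bits q.length v)) (2 ^ q.length) with hN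
  have hpos : N ≠ 0 := by
    obtain ⟨v, hv, e⟩ := exists_eq_bits q
    have : (sim V).Accepts (3 * g) x (bits q.length v) := by rw [← e]; exact ⟨y, hout⟩
    have h1 := Nat.count_strict_mono
      (p := fun v => (sim V).Accepts (3 * g) x (bits q.length v)) this hv
    omega
  set m := Nat.log 2 N with hm
  have hpop : (sim V).Popular q.length m (3 * g) x := Nat.pow_log_le_self 2 hpos
  -- Rounding the logarithm down costs one extra bit in the second description.
  have hN2 : N ≤ 2 ^ (m + 1) := (Nat.lt_pow_succ_log_self (by norm_num) N).le
  have hmq : m ≤ q.length :=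
    (Nat.pow_le_pow_iff_right (by norm_num)).1 (hpop.trans (Nat.count_le _))
  obtain ⟨p₁, hl₁, hp₁⟩ := exists_first hpop
  obtain ⟨p₂, hl₂, hp₂⟩ := exists_second hout hN2
  have hsz : ∀ i ≤ n, i.size ≤ log2 n + 1 := fun i hi => by
    have := size_add_le n 0
    exact (Nat.size_le_size (by omega)).trans this
  have hs1 : (3 * (g + x.length)).size ≤ log2 s + 1 + (3 + 3 * x.length) :=
    (Nat.size_le_size (by omega)).trans (size_add_le s _)
  have hs2 : (3 * g).size ≤ log2 s + 1 + (3 + 3 * x.length) :=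
    (Nat.size_le_size (by omega)).trans (size_add_le s _)
  have hq' := hsz _ hqn
  have hm' := hsz m (by omega)
  have hlog := one_le_log2 n
  -- The length of `q` is written twice and `m` once, with doubled bits, in all six times at most
  -- `log2 n + 1`; seven further bits come from three delimiters and from rounding.
  refine ⟨p₁.length, p₂.length, by omega, ?_, ?_⟩
  · exact condKS_le_of_produces (hp₁.mono (by omega))
  · exact condKS_le_of_produces (hp₂.mono (by omega))

theorem theorem1 (V : StackMachine) (hV : V.IsOptimal) :
    ∃ c : ℕ, ∀ (x y : List Bool) (s s' : ℕ),
      s' = s + c * log2 s + c * (x.length + y.length) →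
        V.KS s' x + V.condKS s' y x ≤ V.pairKS s x y + c * elog2 (V.pairKS s x y) := by
  obtain ⟨c₁, h₁⟩ := hV (firstMachine (sim V))
  obtain ⟨c₂, h₂⟩ := hV (secondMachine (sim V))
  obtain ⟨c₃, h₃⟩ := hV copyMachine
  -- The constants of optimality enter both lengths and space bounds, and `c₃` is used for both
  -- literal descriptions. The number 100 generously covers the numerical terms, which are absorbed
  -- because `log2` is at least 1.
  refine ⟨100 + c₁ + c₂ + 2 * c₃, ?_⟩
  rintro x y s s' rfl
  set c := 100 + c₁ + c₂ + 2 * c₃ with hc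
  set s' := s + c * log2 s + c * (x.length + y.length) with hs'
  obtain hn | ⟨n, hn⟩ : V.pairKS s x y = ⊤ ∨ ∃ n : ℕ, V.pairKS s x y = n := by
    rcases eq_or_ne (V.pairKS s x y) ⊤ with h | h
    · exact .inl h
    · exact .inr ⟨_, (ENat.natCast_toNat h).symm⟩
  · rw [hn, top_add]
    exact le_top
  have hlogs := one_le_log2 s
  have hlogn := one_le_log2 n
  have e : elog2 (n : ℕ∞) = (log2 n : ℕ) := rfl
  rw [hn, e]
  suffices h : ∃ a b : ℕ, V.KS s' x ≤ a ∧ V.condKS s' y x ≤ b ∧ a + b ≤ n + c * log2 n by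
    obtain ⟨a, b, ha, hb, hab⟩ := h
    exact (add_le_add ha hb).trans (by exact_mod_cast hab)
  -- If `n` is at least the sum of the lengths, literal copies of `x` and `y` suffice; the counting
  -- argument is needed only in the other case.
  rcases le_total n (x.length + y.length) with hle | hle
  · obtain ⟨a, b, hab, ha, hb⟩ := exists_descriptions V hn.le hle
    have hspace : ∀ i ≤ c₁ + c₂,
        s + 3 * log2 s + 24 * (x.length + y.length) + 60 + i ≤ s' := fun i hi => by
      have h1 : (63 + i) * log2 s ≤ c * log2 s := Nat.mul_le_mul_right _ (by omega)
      have h2 : 24 * (x.length + y.length) ≤ c * (x.length + y.length) :=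
        Nat.mul_le_mul_right _ (by omega)
      nlinarith
    refine ⟨a + c₁, b + c₂, ?_, ?_, ?_⟩
    · exact (condKS_anti (hspace c₁ (by omega)) _ _).trans
        ((h₁ _ [] x).trans (by push_cast; exact add_le_add_left ha _))
    · exact (condKS_anti (hspace c₂ (by omega)) _ _).trans
        ((h₂ _ x y).trans (by push_cast; exact add_le_add_left hb _))
    · simp only [hc]
      nlinarith
  · have hcopy : ∀ z w : List Bool, V.condKS s' z w ≤ (z.length + c₃ : ℕ) := fun z w => by
      refine (condKS_anti ?_ _ _).trans ((h₃ 24 w z).trans ?_)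
      · simp only [hs', hc]
        nlinarith
      · push_cast
        gcongr
        exact condKS_le_of_produces (produces_copyMachine z w)
    refine ⟨_, _, hcopy _ _, hcopy _ _, ?_⟩
    simp only [hc]
    nlinarith
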